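/- **Setting.** Fix a set of function symbols, a set of built-in constraint symbols containing falsity $\bot$ and the binary symbol $\doteq$ (syntactic equality), a disjoint set of user-defined constraint symbols, and countably infinitely many variables. A *goal* is a finite (possibly empty) conjunction, built from $\top$, atomic constraints and $\wedge$; $\equiv_G$ is equivalence of goals up to associativity and commutativity of $\wedge$ and neutrality of $\top$. A *user-defined* (*built-in*) *constraint* is a goal with only user-defined (built-in) atoms; these are denoted by $\mathbb U$ ($\mathbb B$), arbitrary goals by $\mathbb G$. A *rule* is $H_1\setminus H_2\Leftrightarrow G\mid B_u\wedge B_b$ with $H_1,H_2,B_u$ user-defined, $G,B_b$ built-in and $H_1,H_2$ not both empty; its *local variables* are $\bar y_r=\mathrm{vars}(B_u,B_b,G)\setminus\mathrm{vars}(H_1,H_2)$; a *variant* renames its variables to pairwise distinct ones. A *program* $\mathbb P$ is a set of rules. A *constraint theory* $CT$ is a set of formulas $\forall(\exists\bar x.\mathbb B\to\exists\bar x'.\mathbb B')$; $CT\models\varphi$ denotes derivability of $\varphi$ from $CT$ in intuitionistic first-order logic (free variables of $\varphi$ being read universally). It is assumed that $CT$ entails the equality axioms for $\doteq$ (reflexivity,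 symmetry, transitivity, congruence for function and built-in constraint symbols) and that $CT$ is complete in the sense that $CT\models\exists\mathbb B$ or $CT\models\neg\exists\mathbb B$ for every built-in constraint $\mathbb B$, where $\exists\mathbb B$ is the existential closure. **Operational side.** A *state* is $\langle\mathbb G;\mathbb V\rangle$ with $\mathbb G$ a goal and $\mathbb V$ a finite set of (global) variables; $\langle\mathbb U;\mathbb B;\mathbb V\rangle:=\langle\mathbb U\wedge\mathbb B;\mathbb V\rangle$, and its strictly local variables are $\bar s=\mathrm{vars}(\mathbb B)\setminus(\mathbb V\cup\mathrm{vars}(\mathbb U))$. *State equivalence* $\equiv$ is the smallest equivalence relation such that: 1. $\langle\mathbb G;\mathbb V\rangle\equiv\langle\mathbb G';\mathbb V\rangle$ if $\mathbb G\equiv_G\mathbb G'$; 2. $\langle\mathbb U;x\doteq t\wedge\mathbb B;\mathbb V\rangle\equiv\langle\mathbb U[x/t];x\doteq t\wedge\mathbb B;\mathbb V\rangle$, where $x$ is replaced by $t$; 3. $\langle\mathbb U;\mathbb B;\mathbb V\rangle\equiv\langle\mathbb U;\mathbb B';\mathbb V\rangle$ if $CT\models\exists\bar s.\mathbb B\leftrightarrow\exists\bar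 s'.\mathbb B'$, with $\bar s,\bar s'$ the respective strictly local variables; 4. $\langle\mathbb G;\{x\}\cup\mathbb V\rangle\equiv\langle\mathbb G;\mathbb V\rangle$ if $x\notin\mathrm{vars}(\mathbb G)$; 5. $\langle\mathbb G\wedge\bot;\mathbb V\rangle\equiv\langle\mathbb G'\wedge\bot;\mathbb V'\rangle$. On equivalence classes of states, $\mapsto$ is given by $$[\langle H_1\wedge H_2\wedge\mathbb U;\,G\wedge\mathbb B;\,\mathbb V\rangle]\mapsto[\langle H_1\wedge B_u\wedge\mathbb U;\,G\wedge B_b\wedge\mathbb B;\,\mathbb V\rangle]$$ whenever $H_1\setminus H_2\Leftrightarrow G\mid B_u\wedge B_b$ is a variant of a rule of $\mathbb P$ whose local variables do not occur in $H_1,H_2,\mathbb U,\mathbb B,\mathbb V$, and $CT\models\exists(G\wedge\mathbb B)$. Its reflexive-transitive closure is $\mapsto^*$. *State entailment* $\triangleright$ is the smallest reflexive and transitive relation on equivalence classes of states such that $[\langle\mathbb U;\mathbb B;\mathbb V\rangle]\triangleright[\langle\mathbb U;\mathbb B';\mathbb V\rangle]$ whenever $CT\models\forall(\exists\bar s.\mathbb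 B\to\exists\bar s'.\mathbb B')$ for the respective strictly local variables $\bar s,\bar s'$, and $[\langle\mathbb U;\mathbb B;\{x\}\cup\mathbb V\rangle]\triangleright[\langle\mathbb U;\mathbb B;\mathbb V\rangle]$ for every variable $x$. For states, $S\mapsto^*T$ and $S\triangleright T$ mean that the classes are so related. **Logical side.** $\vdash$ is derivability in the sequent calculus of intuitionistic first-order linear logic (with cut and without proper axioms); for a possibly infinite set $\Theta$ of formulas, $\Theta\vdash\alpha$ means that $\Gamma\vdash\alpha$ for some finite multiset $\Gamma$ of elements of $\Theta$. The translation $(\cdot)^*$ from intuitionistic to linear logic is: $p(\bar t)^*=\,!p(\bar t)$, $\bot^*=\mathbf 0$, $\top^*=\mathbf 1$, $(A\wedge B)^*=A^*\otimes B^*$, $(A\vee B)^*=A^*\oplus B^*$, $(A\to B)^*=\,!(A^*\multimap B^*)$, $(\forall x.A)^*=\,!\forall x.A^*$, $(\exists x.A)^*=\exists x.A^*$. Put $c_u(\bar t)^L=c_u(\bar t)$ for user-defined atoms, $c_b(\bar t)^L=\,!c_b(\bar t)$ for built-in atoms other than $\bot$, $\bot^L=\mathbf 0$, $\top^L=\mathbf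 1$, $(\mathbb G\wedge\mathbb G')^L=\mathbb G^L\otimes\mathbb G'^L$, and $\langle\mathbb G;\mathbb V\rangle^L=\exists\bar z.\,\mathbb G^L$ with $\bar z=\mathrm{vars}(\mathbb G)\setminus\mathbb V$. Let $\mathbb P^L$ be the set of the formulas $$!\forall\bigl(H_1^L\otimes H_2^L\otimes G^L\multimap H_1^L\otimes\exists\bar y_r.(B_u^L\otimes B_b^L\otimes G^L)\bigr)$$ for the rules of $\mathbb P$, and let $CT^L$ consist of the formulas $\alpha^*$, $\alpha\in CT$, and of $$!\forall\bigl(c_u(x_1,\dots,x_j,\dots,x_n)\otimes\,!(x_j\doteq y)\multimap c_u(x_1,\dots,y,\dots,x_n)\otimes\,!(x_j\doteq y)\bigr)$$ for every $n$-ary user-defined constraint symbol $c_u$ and every $1\le j\le n$, with $x_1,\dots,x_n,y$ distinct variables. **Theorem (Soundness and Completeness).** Let $CT$ be a constraint theory as above, $\mathbb P$ a program, and $S,T$ states. There is a state $U$ with $S\mapsto^*U$ and $U\triangleright T$ if and only if $$\mathbb P^L,\,CT^L\vdash\forall(S^L\multimap T^L).$$ -/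

import Mathlib

namespace CHR

universe u v w

/-! ### Constraints, goals, rules

Function symbols and built-in constraint symbols (other than falsity and syntactic equality) are
the function and relation symbols of a first-order language `L`; `U n` is the type of `n`-ary
user-defined constraint symbols. Variables are natural numbers, terms are `L.Term ℕ`. -/

/-- Atomic user-defined constraints. -/
inductive UAtom (L : FirstOrder.Language.{u, v}) (U : ℕ → Type w) : Type (max u w)
  | mk {n : ℕ} (c : U n) (ts : Fin n → L.Term ℕ) : UAtom L U

/-- Atomic built-in constraints: falsity, syntactic equality, and the other ones. -/
inductive BAtom (L : FirstOrder.Language.{u, v}) : Type (max u v)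
  | falsum : BAtom L
  | eq (t t' : L.Term ℕ) : BAtom L
  | rel {n : ℕ} (r : L.Relations n) (ts : Fin n → L.Term ℕ) : BAtom L

/-- Possibly empty conjunctions of atoms of a given kind. -/
inductive Conj (A : Type u) : Type u
  | top : Conj A
  | atom (a : A) : Conj A
  | and (C D : Conj A) : Conj A

/-- User-defined constraints. -/
abbrev UserC (L : FirstOrder.Language.{u, v}) (U : ℕ → Type w) := Conj (UAtom L U)
/-- Built-in constraints. -/
abbrev BuiltinC (L : FirstOrder.Language.{u, v}) := Conj (BAtom L)
/-- Goals. -/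
abbrev Goal (L : FirstOrder.Language.{u, v}) (U : ℕ → Type w) := Conj (UAtom L U ⊕ BAtom L)

section Syn

variable {L : FirstOrder.Language.{u, v}} {U : ℕ → Type w} {A : Type u} {A' : Type v}

def UAtom.vars : UAtom L U → Finset ℕ
  | .mk _ ts => Finset.univ.biUnion fun i => (ts i).varFinset

def UAtom.subst (σ : ℕ → L.Term ℕ) : UAtom L U → UAtom L U
  | .mk c ts => .mk c fun i => (ts i).subst σ

def BAtom.vars : BAtom L → Finset ℕ
  | .falsum => ∅
  | .eq t t' => t.varFinset ∪ t'.varFinset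
  | .rel _ ts => Finset.univ.biUnion fun i => (ts i).varFinset

def BAtom.subst (σ : ℕ → L.Term ℕ) : BAtom L → BAtom L
  | .falsum => .falsum
  | .eq t t' => .eq (t.subst σ) (t'.subst σ)
  | .rel r ts => .rel r fun i => (ts i).subst σ

def Conj.map (f : A → A') : Conj A → Conj A'
  | .top => .top
  | .atom a => .atom (f a)
  | .and C D => .and (C.map f) (D.map f)

/-- The union of the variable sets of the atoms. -/
def Conj.varsWith (f : A → Finset ℕ) : Conj A → Finset ℕ
  | .top => ∅
  | .atom a => f a
  | .and C D => C.varsWith f ∪ D.varsWith f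

/-- The conjunction contains no atom. -/
def Conj.IsEmpty : Conj A → Prop
  | .top => True
  | .atom _ => False
  | .and C D => C.IsEmpty ∧ D.IsEmpty

theorem Conj.isEmpty_map (f : A → A') (C : Conj A) : (C.map f).IsEmpty ↔ C.IsEmpty := by
  induction C with
  | top => rfl
  | atom a => rfl
  | and C D ihC ihD => simp only [Conj.map, Conj.IsEmpty, ihC, ihD]

/-- The conjunction of a finite family of atoms. -/
def Conj.ofFn {n : ℕ} (f : Fin n → A) : Conj A :=
  (List.ofFn f).foldr (fun a C => .and (.atom a) C) .top

def UserC.vars (C : UserC L U) : Finset ℕ := C.varsWith UAtom.vars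
def BuiltinC.vars (B : BuiltinC L) : Finset ℕ := B.varsWith BAtom.vars
def Goal.vars (G : Goal L U) : Finset ℕ := G.varsWith (Sum.elim UAtom.vars BAtom.vars)

def UserC.subst (σ : ℕ → L.Term ℕ) (C : UserC L U) : UserC L U := C.map (UAtom.subst σ)
def BuiltinC.subst (σ : ℕ → L.Term ℕ) (B : BuiltinC L) : BuiltinC L := B.map (BAtom.subst σ)

def UserC.toGoal (C : UserC L U) : Goal L U := C.map Sum.inl
def BuiltinC.toGoal (B : BuiltinC L) : Goal L U := B.map Sum.inr

/-- The substitution that replaces the variable `x` by the term `t`. -/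
def single (x : ℕ) (t : L.Term ℕ) : ℕ → L.Term ℕ := Function.update FirstOrder.Language.Term.var x t

/-- Goal equivalence: associativity and commutativity of conjunction, neutrality of `⊤`. -/
inductive GoalEquiv : Goal L U → Goal L U → Prop
  | refl (G) : GoalEquiv G G
  | symm {G G'} : GoalEquiv G G' → GoalEquiv G' G
  | trans {G G' G''} : GoalEquiv G G' → GoalEquiv G' G'' → GoalEquiv G G''
  | congr {G G' F F'} : GoalEquiv G G' → GoalEquiv F F' → GoalEquiv (.and G F) (.and G' F')
  | assoc (G F E) : GoalEquiv (.and (.and G F) E) (.and G (.and F E))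
  | comm (G F) : GoalEquiv (.and G F) (.and F G)
  | top (G) : GoalEquiv (.and G .top) G

end Syn

/-- A rule `kept \ removed ⇔ guard | bodyU ∧ bodyB`. -/
structure Rule (L : FirstOrder.Language.{u, v}) (U : ℕ → Type w) where
  kept : UserC L U
  removed : UserC L U
  guard : BuiltinC L
  bodyU : UserC L U
  bodyB : BuiltinC L
  head_nonempty : ¬ (kept.IsEmpty ∧ removed.IsEmpty)

section RuleDefs

variable {L : FirstOrder.Language.{u, v}} {U : ℕ → Type w}

def Rule.headVars (R : Rule L U) : Finset ℕ := UserC.vars R.kept ∪ UserC.vars R.removed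

def Rule.vars (R : Rule L U) : Finset ℕ :=
  R.headVars ∪ UserC.vars R.bodyU ∪ BuiltinC.vars R.bodyB ∪ BuiltinC.vars R.guard

/-- The local variables of a rule. -/
def Rule.localVars (R : Rule L U) : Finset ℕ :=
  (UserC.vars R.bodyU ∪ BuiltinC.vars R.bodyB ∪ BuiltinC.vars R.guard) \ R.headVars

def Rule.rename (ρ : ℕ → ℕ) (R : Rule L U) : Rule L U where
  kept := UserC.subst (fun x => .var (ρ x)) R.kept
  removed := UserC.subst (fun x => .var (ρ x)) R.removed
  guard := BuiltinC.subst (fun x => .var (ρ x)) R.guard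
  bodyU := UserC.subst (fun x => .var (ρ x)) R.bodyU
  bodyB := BuiltinC.subst (fun x => .var (ρ x)) R.bodyB
  head_nonempty := by
    simpa only [UserC.subst, Conj.isEmpty_map] using R.head_nonempty

/-- `R'` arises from `R` by replacing its variables by pairwise distinct variables. -/
def Rule.IsVariant (R' R : Rule L U) : Prop :=
  ∃ ρ : ℕ → ℕ, Set.InjOn ρ (R.vars : Set ℕ) ∧ R' = R.rename ρ

end RuleDefs

/-! ### Substitutions under binders

Quantified formulas are in de Bruijn form: below a quantifier, `0` is the bound variable and
`n + 1` is the variable `n` of the outside. -/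

section Binders

variable {L : FirstOrder.Language.{u, v}}

/-- A substitution, pushed below a quantifier. -/
def up (σ : ℕ → L.Term ℕ) : ℕ → L.Term ℕ
  | 0 => .var 0
  | n + 1 => (σ n).relabel Nat.succ

/-- Weakening by a new variable `0`. -/
def shiftS : ℕ → L.Term ℕ := fun n => .var (n + 1)

/-- Instantiation of the variable `0`. -/
def instS (t : L.Term ℕ) : ℕ → L.Term ℕ
  | 0 => t
  | n + 1 => .var n

/-- Turns the variable `x` into the bound variable `0` of a quantifier to be put in front. -/
def bindS (x : ℕ) : ℕ → L.Term ℕ := fun y => if y = x then .var 0 else .var (y + 1)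

/-- The variables that remain free when `0` is bound. -/
def unbind (X : Finset ℕ) : Finset ℕ := (X.erase 0).image Nat.pred

end Binders

/-! ### Intuitionistic first-order logic over the built-in constraints -/

inductive IForm (L : FirstOrder.Language.{u, v}) : Type (max u v)
  | eq (t t' : L.Term ℕ) : IForm L
  | rel {n : ℕ} (r : L.Relations n) (ts : Fin n → L.Term ℕ) : IForm L
  | bot : IForm L
  | top : IForm L
  | and (φ ψ : IForm L) : IForm L
  | or (φ ψ : IForm L) : IForm L
  | imp (φ ψ : IForm L) : IForm L
  | all (φ : IForm L) : IForm L
  | ex (φ : IForm L) : IForm L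

section IL

variable {L : FirstOrder.Language.{u, v}}

namespace IForm

def subst (σ : ℕ → L.Term ℕ) : IForm L → IForm L
  | .eq t t' => .eq (t.subst σ) (t'.subst σ)
  | .rel r ts => .rel r fun i => (ts i).subst σ
  | .bot => .bot
  | .top => .top
  | .and φ ψ => .and (φ.subst σ) (ψ.subst σ)
  | .or φ ψ => .or (φ.subst σ) (ψ.subst σ)
  | .imp φ ψ => .imp (φ.subst σ) (ψ.subst σ)
  | .all φ => .all (φ.subst (up σ))
  | .ex φ => .ex (φ.subst (up σ))

/-- Free variables. -/
def fv : IForm L → Finset ℕ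
  | .eq t t' => t.varFinset ∪ t'.varFinset
  | .rel _ ts => Finset.univ.biUnion fun i => (ts i).varFinset
  | .bot => ∅
  | .top => ∅
  | .and φ ψ => φ.fv ∪ ψ.fv
  | .or φ ψ => φ.fv ∪ ψ.fv
  | .imp φ ψ => φ.fv ∪ ψ.fv
  | .all φ => unbind φ.fv
  | .ex φ => unbind φ.fv

/-- `∀ x. φ` for a named variable `x`. -/
def allV (x : ℕ) (φ : IForm L) : IForm L := .all (φ.subst (bindS x))
/-- `∃ x. φ` for a named variable `x`. -/
def exV (x : ℕ) (φ : IForm L) : IForm L := .ex (φ.subst (bindS x))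

/-- Universal quantification of the variables in `X`. -/
def alls (X : Finset ℕ) (φ : IForm L) : IForm L := X.sort.foldr allV φ
/-- Existential quantification of the variables in `X`. -/
def exs (X : Finset ℕ) (φ : IForm L) : IForm L := X.sort.foldr exV φ

/-- Universal closure. -/
def univ (φ : IForm L) : IForm L := alls φ.fv φ
/-- Existential closure. -/
def exCl (φ : IForm L) : IForm L := exs φ.fv φ

def neg (φ : IForm L) : IForm L := .imp φ .bot
def iff (φ ψ : IForm L) : IForm L := .and (.imp φ ψ) (.imp ψ φ)

end IForm

/-- Derivability in intuitionistic first-order logic (natural deduction). -/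
inductive IProv : Set (IForm L) → IForm L → Prop
  | hyp {Γ φ} : φ ∈ Γ → IProv Γ φ
  | topI {Γ} : IProv Γ .top
  | botE {Γ φ} : IProv Γ .bot → IProv Γ φ
  | andI {Γ φ ψ} : IProv Γ φ → IProv Γ ψ → IProv Γ (.and φ ψ)
  | andE₁ {Γ φ ψ} : IProv Γ (.and φ ψ) → IProv Γ φ
  | andE₂ {Γ φ ψ} : IProv Γ (.and φ ψ) → IProv Γ ψ
  | orI₁ {Γ φ ψ} : IProv Γ φ → IProv Γ (.or φ ψ)
  | orI₂ {Γ φ ψ} : IProv Γ ψ → IProv Γ (.or φ ψ)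
  | orE {Γ φ ψ χ} : IProv Γ (.or φ ψ) → IProv (insert φ Γ) χ → IProv (insert ψ Γ) χ → IProv Γ χ
  | impI {Γ φ ψ} : IProv (insert φ Γ) ψ → IProv Γ (.imp φ ψ)
  | impE {Γ φ ψ} : IProv Γ (.imp φ ψ) → IProv Γ φ → IProv Γ ψ
  | allI {Γ φ} : IProv (IForm.subst shiftS '' Γ) φ → IProv Γ (.all φ)
  | allE {Γ φ} (t : L.Term ℕ) : IProv Γ (.all φ) → IProv Γ (φ.subst (instS t))
  | exI {Γ φ} (t : L.Term ℕ) : IProv Γ (φ.subst (instS t)) → IProv Γ (.ex φ)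
  | exE {Γ φ χ} : IProv Γ (.ex φ) →
      IProv (insert φ (IForm.subst shiftS '' Γ)) (χ.subst shiftS) → IProv Γ χ

def BAtom.toI : BAtom L → IForm L
  | .falsum => .bot
  | .eq t t' => .eq t t'
  | .rel r ts => .rel r ts

/-- A built-in constraint as a formula. -/
def BuiltinC.toI : BuiltinC L → IForm L
  | .top => .top
  | .atom a => a.toI
  | .and B B' => .and (BuiltinC.toI B) (BuiltinC.toI B')

end IL

/-- The data of a formula `∀(∃ X. B → ∃ X'. B')`. -/
structure CTClause (L : FirstOrder.Language.{u, v}) where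
  X : Finset ℕ
  B : BuiltinC L
  X' : Finset ℕ
  B' : BuiltinC L

def CTClause.toI {L : FirstOrder.Language.{u, v}} (α : CTClause L) : IForm L :=
  (IForm.imp (IForm.exs α.X (BuiltinC.toI α.B)) (IForm.exs α.X' (BuiltinC.toI α.B'))).univ

/-- A constraint theory, given by a set of formulas `∀(∃ X. B → ∃ X'. B')`. -/
abbrev Theory (L : FirstOrder.Language.{u, v}) := Set (CTClause L)

section TheoryDefs

variable {L : FirstOrder.Language.{u, v}}

/-- `CT ⊨ φ`: intuitionistic consequence of the (closed) formulas of the theory. -/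
def Theory.Models (CT : Theory L) (φ : IForm L) : Prop := IProv (CTClause.toI '' CT) φ

/-- The constraint `≐` is an equality for `CT`: the equality axioms are consequences of `CT`. -/
structure Theory.HasEquality (CT : Theory L) : Prop where
  refl (t : L.Term ℕ) : CT.Models (.eq t t)
  symm (s t : L.Term ℕ) : CT.Models (.imp (.eq s t) (.eq t s))
  trans (s t r : L.Term ℕ) : CT.Models (.imp (.and (.eq s t) (.eq t r)) (.eq s r))
  func {n : ℕ} (f : L.Functions n) (ss ts : Fin n → L.Term ℕ) :
    CT.Models (.imp (BuiltinC.toI (Conj.ofFn fun i => .eq (ss i) (ts i)))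
      (.eq (.func f ss) (.func f ts)))
  rel {n : ℕ} (r : L.Relations n) (ss ts : Fin n → L.Term ℕ) :
    CT.Models (.imp (.and (BuiltinC.toI (Conj.ofFn fun i => .eq (ss i) (ts i))) (.rel r ss))
      (.rel r ts))

/-- `CT` decides the satisfiability of every built-in constraint. -/
def Theory.IsComplete (CT : Theory L) : Prop :=
  ∀ B : BuiltinC L, CT.Models (BuiltinC.toI B).exCl ∨ CT.Models (BuiltinC.toI B).exCl.neg

end TheoryDefs

/-! ### States, state equivalence, transitions, entailment -/

/-- A state `⟨G; V⟩`. -/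
structure State (L : FirstOrder.Language.{u, v}) (U : ℕ → Type w) where
  goal : Goal L U
  globals : Finset ℕ

section Operational

variable {L : FirstOrder.Language.{u, v}} {U : ℕ → Type w}

/-- The state `⟨C; B; V⟩`, that is, `⟨C ∧ B; V⟩`. -/
def State.mk3 (C : UserC L U) (B : BuiltinC L) (V : Finset ℕ) : State L U :=
  ⟨.and (UserC.toGoal C) (BuiltinC.toGoal B), V⟩

/-- The strictly local variables of `⟨C; B; V⟩`. -/
def strictLocals (C : UserC L U) (B : BuiltinC L) (V : Finset ℕ) : Finset ℕ :=
  ((UserC.vars C ∪ BuiltinC.vars B) \ V) \ UserC.vars C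

/-- State equivalence. -/
inductive StateEquiv (CT : Theory L) : State L U → State L U → Prop
  | refl (S) : StateEquiv CT S S
  | symm {S T} : StateEquiv CT S T → StateEquiv CT T S
  | trans {S T W} : StateEquiv CT S T → StateEquiv CT T W → StateEquiv CT S W
  | goal {G G' : Goal L U} (V : Finset ℕ) : GoalEquiv G G' → StateEquiv CT ⟨G, V⟩ ⟨G', V⟩
  | subst (C : UserC L U) (x : ℕ) (t : L.Term ℕ) (B : BuiltinC L) (V : Finset ℕ) :
      StateEquiv CT (.mk3 C (.and (.atom (.eq (.var x) t)) B) V)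
        (.mk3 (UserC.subst (single x t) C) (.and (.atom (.eq (.var x) t)) B) V)
  | applyCT (C : UserC L U) (B B' : BuiltinC L) (V : Finset ℕ) :
      CT.Models (.iff (.exs (strictLocals C B V) (BuiltinC.toI B))
        (.exs (strictLocals C B' V) (BuiltinC.toI B'))) →
      StateEquiv CT (.mk3 C B V) (.mk3 C B' V)
  | redundant (G : Goal L U) (x : ℕ) (V : Finset ℕ) :
      x ∉ Goal.vars G → StateEquiv CT ⟨G, insert x V⟩ ⟨G, V⟩
  | failed (G G' : Goal L U) (V V' : Finset ℕ) :
      StateEquiv CT ⟨.and G (.atom (.inr .falsum)), V⟩ ⟨.and G' (.atom (.inr .falsum)), V'⟩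

def stateSetoid (U : ℕ → Type w) (CT : Theory L) : Setoid (State L U) where
  r := StateEquiv CT
  iseqv := ⟨StateEquiv.refl, StateEquiv.symm, StateEquiv.trans⟩

/-- Equivalence classes of states. -/
abbrev StateClass (U : ℕ → Type w) (CT : Theory L) := Quotient (stateSetoid U CT)

/-- The equivalence class `[S]`. -/
def State.cls (CT : Theory L) (S : State L U) : StateClass U CT := Quotient.mk _ S

/-- The transition relation of a program `P` on equivalence classes of states. -/
inductive Step (CT : Theory L) (P : Set (Rule L U)) : StateClass U CT → StateClass U CT → Prop
  | apply (R₀ R : Rule L U) (C : UserC L U) (B : BuiltinC L) (V : Finset ℕ) :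
      R₀ ∈ P → R.IsVariant R₀ →
      Disjoint R.localVars (R.headVars ∪ UserC.vars C ∪ BuiltinC.vars B ∪ V) →
      CT.Models (BuiltinC.toI (.and R.guard B)).exCl →
      Step CT P
        ((State.mk3 (.and (.and R.kept R.removed) C) (.and R.guard B) V).cls CT)
        ((State.mk3 (.and (.and R.kept R.bodyU) C) (.and (.and R.guard R.bodyB) B) V).cls CT)

/-- State entailment: the smallest reflexive and transitive relation on equivalence classes of
states that allows to weaken the built-in store and to omit global variables. -/
inductive Entails (CT : Theory L) : StateClass U CT → StateClass U CT → Prop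
  | refl (S) : Entails CT S S
  | trans {S T W} : Entails CT S T → Entails CT T W → Entails CT S W
  | weaken (C : UserC L U) (B B' : BuiltinC L) (V : Finset ℕ) :
      CT.Models (IForm.imp (.exs (strictLocals C B V) (BuiltinC.toI B))
        (.exs (strictLocals C B' V) (BuiltinC.toI B'))).univ →
      Entails CT ((State.mk3 C B V).cls CT) ((State.mk3 C B' V).cls CT)
  | omitVar (C : UserC L U) (B : BuiltinC L) (x : ℕ) (V : Finset ℕ) :
      Entails CT ((State.mk3 C B (insert x V)).cls CT) ((State.mk3 C B V).cls CT)

end Operational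

/-! ### Intuitionistic first-order linear logic -/

inductive LForm (L : FirstOrder.Language.{u, v}) (U : ℕ → Type w) : Type (max u v w)
  | user {n : ℕ} (c : U n) (ts : Fin n → L.Term ℕ) : LForm L U
  | eq (t t' : L.Term ℕ) : LForm L U
  | rel {n : ℕ} (r : L.Relations n) (ts : Fin n → L.Term ℕ) : LForm L U
  | one : LForm L U
  | zero : LForm L U
  | top : LForm L U
  | tensor (φ ψ : LForm L U) : LForm L U
  | lolli (φ ψ : LForm L U) : LForm L U
  | with (φ ψ : LForm L U) : LForm L U
  | plus (φ ψ : LForm L U) : LForm L U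
  | bang (φ : LForm L U) : LForm L U
  | all (φ : LForm L U) : LForm L U
  | ex (φ : LForm L U) : LForm L U

section LL

variable {L : FirstOrder.Language.{u, v}} {U : ℕ → Type w}

namespace LForm

def subst (σ : ℕ → L.Term ℕ) : LForm L U → LForm L U
  | .user c ts => .user c fun i => (ts i).subst σ
  | .eq t t' => .eq (t.subst σ) (t'.subst σ)
  | .rel r ts => .rel r fun i => (ts i).subst σ
  | .one => .one
  | .zero => .zero
  | .top => .top
  | .tensor φ ψ => .tensor (φ.subst σ) (ψ.subst σ)
  | .lolli φ ψ => .lolli (φ.subst σ) (ψ.subst σ)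
  | .with φ ψ => .with (φ.subst σ) (ψ.subst σ)
  | .plus φ ψ => .plus (φ.subst σ) (ψ.subst σ)
  | .bang φ => .bang (φ.subst σ)
  | .all φ => .all (φ.subst (up σ))
  | .ex φ => .ex (φ.subst (up σ))

/-- Free variables. -/
def fv : LForm L U → Finset ℕ
  | .user _ ts => Finset.univ.biUnion fun i => (ts i).varFinset
  | .eq t t' => t.varFinset ∪ t'.varFinset
  | .rel _ ts => Finset.univ.biUnion fun i => (ts i).varFinset
  | .one => ∅
  | .zero => ∅
  | .top => ∅
  | .tensor φ ψ => φ.fv ∪ ψ.fv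
  | .lolli φ ψ => φ.fv ∪ ψ.fv
  | .with φ ψ => φ.fv ∪ ψ.fv
  | .plus φ ψ => φ.fv ∪ ψ.fv
  | .bang φ => φ.fv
  | .all φ => unbind φ.fv
  | .ex φ => unbind φ.fv

def allV (x : ℕ) (φ : LForm L U) : LForm L U := .all (φ.subst (bindS x))
def exV (x : ℕ) (φ : LForm L U) : LForm L U := .ex (φ.subst (bindS x))

/-- Universal quantification of the variables in `X`. -/
def alls (X : Finset ℕ) (φ : LForm L U) : LForm L U := X.sort.foldr allV φ
/-- Existential quantification of the variables in `X`. -/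
def exs (X : Finset ℕ) (φ : LForm L U) : LForm L U := X.sort.foldr exV φ
/-- Universal closure. -/
def univ (φ : LForm L U) : LForm L U := alls φ.fv φ

end LForm

/-- The sequent calculus of intuitionistic linear logic, without proper (non-logical) leaves. -/
inductive LProv : Multiset (LForm L U) → LForm L U → Prop
  | ident (α) : LProv {α} α
  | cut {Γ Δ α β} : LProv Γ α → LProv (α ::ₘ Δ) β → LProv (Γ + Δ) β
  | tensorL {Γ α β γ} : LProv (α ::ₘ β ::ₘ Γ) γ → LProv (.tensor α β ::ₘ Γ) γ
  | tensorR {Γ Δ α β} : LProv Γ α → LProv Δ β → LProv (Γ + Δ) (.tensor α β)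
  | oneL {Γ α} : LProv Γ α → LProv (.one ::ₘ Γ) α
  | oneR : LProv 0 .one
  | lolliL {Γ Δ α β γ} : LProv Γ α → LProv (β ::ₘ Δ) γ → LProv (.lolli α β ::ₘ (Γ + Δ)) γ
  | lolliR {Γ α β} : LProv (α ::ₘ Γ) β → LProv Γ (.lolli α β)
  | bangR {Γ : Multiset (LForm L U)} {α} :
      LProv (Γ.map .bang) α → LProv (Γ.map .bang) (.bang α)
  | dereliction {Γ α β} : LProv (α ::ₘ Γ) β → LProv (.bang α ::ₘ Γ) β
  | contraction {Γ α β} : LProv (.bang α ::ₘ .bang α ::ₘ Γ) β → LProv (.bang α ::ₘ Γ) β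
  | weakening {Γ α β} : LProv Γ β → LProv (.bang α ::ₘ Γ) β
  | withL₁ {Γ α β γ} : LProv (α ::ₘ Γ) γ → LProv (.with α β ::ₘ Γ) γ
  | withL₂ {Γ α β γ} : LProv (β ::ₘ Γ) γ → LProv (.with α β ::ₘ Γ) γ
  | withR {Γ α β} : LProv Γ α → LProv Γ β → LProv Γ (.with α β)
  | topR (Γ) : LProv Γ .top
  | plusL {Γ α β γ} : LProv (α ::ₘ Γ) γ → LProv (β ::ₘ Γ) γ → LProv (.plus α β ::ₘ Γ) γ
  | plusR₁ {Γ α β} : LProv Γ α → LProv Γ (.plus α β)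
  | plusR₂ {Γ α β} : LProv Γ β → LProv Γ (.plus α β)
  | zeroL (α) : LProv {.zero} α
  | allL {Γ α β} (t : L.Term ℕ) : LProv (α.subst (instS t) ::ₘ Γ) β → LProv (.all α ::ₘ Γ) β
  | allR {Γ : Multiset (LForm L U)} {β} :
      LProv (Γ.map (LForm.subst shiftS)) β → LProv Γ (.all β)
  | exL {Γ : Multiset (LForm L U)} {α β} :
      LProv (α ::ₘ Γ.map (LForm.subst shiftS)) (β.subst shiftS) → LProv (.ex α ::ₘ Γ) β
  | exR {Γ β} (t : L.Term ℕ) : LProv Γ (β.subst (instS t)) → LProv Γ (.ex β)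

/-- Provability of `Θ ⊢ α` for a set `Θ` of (banged) formulas, possibly infinite: finitely many
elements of `Θ` are used, each of them any finite number of times. -/
def LProvable (Θ : Set (LForm L U)) (α : LForm L U) : Prop :=
  ∃ Γ : Multiset (LForm L U), (∀ φ ∈ Γ, φ ∈ Θ) ∧ LProv Γ α

/-! ### Translations -/

/-- The translation of intuitionistic into linear logic. -/
def IForm.star (U : ℕ → Type w) : IForm L → LForm L U
  | .eq t t' => .bang (.eq t t')
  | .rel r ts => .bang (.rel r ts)
  | .bot => .zero
  | .top => .one
  | .and φ ψ => .tensor (φ.star U) (ψ.star U)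
  | .or φ ψ => .plus (φ.star U) (ψ.star U)
  | .imp φ ψ => .bang (.lolli (φ.star U) (ψ.star U))
  | .all φ => .bang (.all (φ.star U))
  | .ex φ => .ex (φ.star U)

def UAtom.toL : UAtom L U → LForm L U
  | .mk c ts => .user c ts

def BAtom.toL (U : ℕ → Type w) : BAtom L → LForm L U
  | .falsum => .zero
  | .eq t t' => .bang (.eq t t')
  | .rel r ts => .bang (.rel r ts)

/-- The translation of goals. -/
def Goal.toL : Goal L U → LForm L U
  | .top => .one
  | .atom a => Sum.elim UAtom.toL (BAtom.toL U) a
  | .and G G' => .tensor (Goal.toL G) (Goal.toL G')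

def UserC.toL (C : UserC L U) : LForm L U := Goal.toL (UserC.toGoal C)
def BuiltinC.toL (U : ℕ → Type w) (B : BuiltinC L) : LForm L U :=
  Goal.toL (BuiltinC.toGoal (U := U) B)

/-- The translation of states: `⟨G; V⟩` becomes `G` with all variables outside `V` quantified. -/
def State.toL (S : State L U) : LForm L U :=
  LForm.exs (Goal.vars S.goal \ S.globals) (Goal.toL S.goal)

/-- The formula `!∀(c(…, xⱼ, …) ⊗ !(xⱼ ≐ y) ⊸ c(…, y, …) ⊗ !(xⱼ ≐ y))`, where `x₀, …, xₙ₋₁, y` are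
the variables `0, …, n - 1, n`. -/
def eqFormula {n : ℕ} (c : U n) (j : Fin n) : LForm L U :=
  .bang (LForm.univ (.lolli
    (.tensor (.user c fun i => .var i) (.bang (.eq (.var j) (.var n))))
    (.tensor (.user c (Function.update (fun i : Fin n => .var i) j (.var n)))
      (.bang (.eq (.var j) (.var n))))))

/-- The translation of constraint theories. -/
def Theory.toL (U : ℕ → Type w) (CT : Theory L) : Set (LForm L U) :=
  (fun α : CTClause L => α.toI.star U) '' CT ∪
    {φ | ∃ (n : ℕ) (c : U n) (j : Fin n), φ = eqFormula c j}

/-- The translation of rules. -/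
def Rule.toL (R : Rule L U) : LForm L U :=
  .bang (LForm.univ (.lolli
    (.tensor (.tensor (UserC.toL R.kept) (UserC.toL R.removed)) (BuiltinC.toL U R.guard))
    (.tensor (UserC.toL R.kept) (LForm.exs R.localVars
      (.tensor (.tensor (UserC.toL R.bodyU) (BuiltinC.toL U R.bodyB))
        (BuiltinC.toL U R.guard))))))

/-- The translation of programs. -/
def programL (P : Set (Rule L U)) : Set (LForm L U) := Rule.toL '' P

end LL

end CHR

namespace CHR

open FirstOrder.Language (Term)

universe u v w

/-! ### Substitutions -/

section Substitutions

variable {L : FirstOrder.Language.{u, v}} {U : ℕ → Type w}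

/-- Composition of substitutions: first `σ`, then `τ`. -/
def scomp (σ τ : ℕ → L.Term ℕ) : ℕ → L.Term ℕ := fun n => (σ n).subst τ

/-- The substitution that sends `0` to `t` and `n + 1` to `σ n`. -/
def consS (t : L.Term ℕ) (σ : ℕ → L.Term ℕ) : ℕ → L.Term ℕ
  | 0 => t
  | n + 1 => σ n

/-- The substitutions agree outside of `X`. -/
def AgreeOff (X : Finset ℕ) (σ τ : ℕ → L.Term ℕ) : Prop := ∀ y, y ∉ X → σ y = τ y

/-- The substitution fixes the variables in `X`. -/
def FixesOn (X : Finset ℕ) (σ : ℕ → L.Term ℕ) : Prop := ∀ y ∈ X, σ y = .var y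

theorem term_subst_subst (σ τ : ℕ → L.Term ℕ) (t : L.Term ℕ) :
    (t.subst σ).subst τ = t.subst (scomp σ τ) := by
  induction t with
  | var => rfl
  | func f ts ih => simp only [Term.subst, ih]

@[simp] theorem term_subst_var (t : L.Term ℕ) : t.subst Term.var = t := by
  induction t with
  | var => rfl
  | func f ts ih => simp only [Term.subst, ih]

theorem term_relabel (f : ℕ → ℕ) (t : L.Term ℕ) : t.relabel f = t.subst (fun n => .var (f n)) := by
  induction t with
  | var => rfl
  | func f ts ih => simp only [Term.relabel, Term.subst, ih]

theorem term_subst_congr {σ τ : ℕ → L.Term ℕ} {t : L.Term ℕ}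
    (h : ∀ x ∈ t.varFinset, σ x = τ x) : t.subst σ = t.subst τ := by
  induction t with
  | var x => exact h x (by simp)
  | func f ts ih =>
    simp only [Term.subst, Term.func.injEq, heq_eq_eq, true_and]
    funext i
    exact ih i fun x hx => h x (by simpa using ⟨i, hx⟩)

theorem mem_term_vars_subst {σ : ℕ → L.Term ℕ} {t : L.Term ℕ} {n : ℕ} :
    n ∈ (t.subst σ).varFinset ↔ ∃ x ∈ t.varFinset, n ∈ (σ x).varFinset := by
  induction t with
  | var x => simp [Term.subst]
  | func f ts ih =>
    simp only [Term.subst, Term.varFinset, Finset.mem_biUnion, Finset.mem_univ, true_and, ih]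
    exact ⟨fun ⟨i, x, hx, h⟩ => ⟨x, ⟨i, hx⟩, h⟩, fun ⟨x, ⟨i, hx⟩, h⟩ => ⟨i, x, hx, h⟩⟩

theorem scomp_assoc (σ τ υ : ℕ → L.Term ℕ) : scomp (scomp σ τ) υ = scomp σ (scomp τ υ) := by
  funext n; exact term_subst_subst _ _ _

@[simp] theorem scomp_var (σ : ℕ → L.Term ℕ) : scomp σ Term.var = σ := by
  funext n; exact term_subst_var _

@[simp] theorem var_scomp (σ : ℕ → L.Term ℕ) : scomp Term.var σ = σ := rfl

theorem relabel_succ (t : L.Term ℕ) : t.relabel Nat.succ = t.subst shiftS := term_relabel _ _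

@[simp] theorem up_var : up (Term.var : ℕ → L.Term ℕ) = Term.var := by
  funext n; cases n <;> rfl

@[simp] theorem shiftS_scomp_consS (t : L.Term ℕ) (σ : ℕ → L.Term ℕ) :
    scomp shiftS (consS t σ) = σ := rfl

@[simp] theorem up_scomp_consS (t : L.Term ℕ) (σ τ : ℕ → L.Term ℕ) :
    scomp (up σ) (consS t τ) = consS t (scomp σ τ) := by
  funext n
  cases n with
  | zero => rfl
  | succ n => simp only [scomp, up, consS, relabel_succ, term_subst_subst]; rfl

theorem up_eq_consS (σ : ℕ → L.Term ℕ) : up σ = consS (.var 0) (scomp σ shiftS) := by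
  funext n
  cases n with
  | zero => rfl
  | succ n => simp only [up, consS, scomp, relabel_succ]

@[simp] theorem consS_scomp (t : L.Term ℕ) (σ τ : ℕ → L.Term ℕ) :
    scomp (consS t σ) τ = consS (t.subst τ) (scomp σ τ) := by
  funext n; cases n <;> rfl

theorem up_scomp_up (σ τ : ℕ → L.Term ℕ) : scomp (up σ) (up τ) = up (scomp σ τ) := by
  rw [up_eq_consS τ, up_scomp_consS, up_eq_consS, scomp_assoc]

theorem instS_eq_consS (t : L.Term ℕ) : instS t = consS t Term.var := by
  funext n; cases n <;> rfl

theorem shiftS_scomp_up (σ : ℕ → L.Term ℕ) : scomp shiftS (up σ) = scomp σ shiftS := by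
  rw [up_eq_consS]; rfl

theorem instS_scomp (t : L.Term ℕ) (σ : ℕ → L.Term ℕ) :
    scomp (instS t) σ = consS (t.subst σ) σ := by
  rw [instS_eq_consS, consS_scomp, var_scomp]

theorem up_scomp_instS (t : L.Term ℕ) (σ : ℕ → L.Term ℕ) :
    scomp (up σ) (instS t) = consS t σ := by
  rw [instS_eq_consS, up_scomp_consS, scomp_var]

/-- The bridge between named quantifiers and de Bruijn form: evaluating the body of a quantifier
over the named variable `x` with bound value `t` amounts to updating the valuation at `x`. -/
theorem bindS_scomp_consS (x : ℕ) (t : L.Term ℕ) (σ : ℕ → L.Term ℕ) :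
    scomp (bindS x) (consS t σ) = Function.update σ x t := by
  funext n
  by_cases h : n = x
  · subst h; simp [scomp, bindS, Term.subst, consS]
  · simp [scomp, bindS, Term.subst, consS, h]

theorem mem_unbind {X : Finset ℕ} {n : ℕ} : n ∈ unbind X ↔ n + 1 ∈ X := by
  simp only [unbind, Finset.mem_image, Finset.mem_erase]
  constructor
  · rintro ⟨a, ⟨h0, h⟩, rfl⟩
    rwa [Nat.pred_eq_sub_one, Nat.sub_add_cancel (Nat.pos_of_ne_zero h0)]
  · intro h
    exact ⟨n + 1, ⟨Nat.succ_ne_zero n, h⟩, rfl⟩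

theorem mem_vars_up_succ {σ : ℕ → L.Term ℕ} {n k : ℕ} :
    n + 1 ∈ (up σ (k + 1)).varFinset ↔ n ∈ (σ k).varFinset := by
  simp only [up, relabel_succ, mem_term_vars_subst, shiftS, Term.varFinset, Finset.mem_singleton]
  exact ⟨fun ⟨x, hx, h⟩ => by obtain rfl : n = x := by omega
                              exact hx, fun h => ⟨n, h, rfl⟩⟩

theorem exists_mem_up {σ : ℕ → L.Term ℕ} {n : ℕ} {X : Finset ℕ} :
    (∃ x ∈ X, n + 1 ∈ (up σ x).varFinset) ↔ ∃ x ∈ unbind X, n ∈ (σ x).varFinset := by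
  constructor
  · rintro ⟨x, hx, h⟩
    cases x with
    | zero => simp [up] at h
    | succ k => exact ⟨k, mem_unbind.2 hx, mem_vars_up_succ.1 h⟩
  · rintro ⟨k, hk, h⟩
    exact ⟨k + 1, mem_unbind.1 hk, mem_vars_up_succ.2 h⟩

theorem up_congr {σ τ : ℕ → L.Term ℕ} {X : Finset ℕ} (h : ∀ x ∈ unbind X, σ x = τ x) :
    ∀ x ∈ X, up σ x = up τ x := by
  intro x hx
  cases x with
  | zero => rfl
  | succ k => simp only [up]; rw [h k (mem_unbind.2 hx)]

theorem AgreeOff.refl (X : Finset ℕ) (σ : ℕ → L.Term ℕ) : AgreeOff X σ σ := fun _ _ => rfl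

theorem fixesOn_var (X : Finset ℕ) : FixesOn X (Term.var : ℕ → L.Term ℕ) := fun _ _ => rfl

theorem FixesOn.mono {X Y : Finset ℕ} {σ : ℕ → L.Term ℕ} (h : FixesOn Y σ) (hXY : X ⊆ Y) :
    FixesOn X σ := fun y hy => h y (hXY hy)

end Substitutions

/-! ### Substitution in formulas of intuitionistic logic -/

section IFormSubst

variable {L : FirstOrder.Language.{u, v}}

namespace IForm

theorem subst_subst (σ τ : ℕ → L.Term ℕ) (φ : IForm L) :
    (φ.subst σ).subst τ = φ.subst (scomp σ τ) := by
  induction φ generalizing σ τ <;> simp only [subst, term_subst_subst, *, up_scomp_up]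

@[simp] theorem subst_var (φ : IForm L) : φ.subst Term.var = φ := by
  induction φ <;> simp only [subst, term_subst_var, *, up_var]

theorem subst_congr {σ τ : ℕ → L.Term ℕ} {φ : IForm L} (h : ∀ x ∈ φ.fv, σ x = τ x) :
    φ.subst σ = φ.subst τ := by
  induction φ generalizing σ τ with
  | eq t t' =>
    simp only [fv, Finset.mem_union] at h
    simp only [subst]
    rw [term_subst_congr fun x hx => h x (.inl hx), term_subst_congr fun x hx => h x (.inr hx)]
  | rel r ts =>
    simp only [subst, IForm.rel.injEq, heq_eq_eq, true_and]
    funext i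
    exact term_subst_congr fun x hx => h x (by simpa [fv] using ⟨i, hx⟩)
  | bot => rfl
  | top => rfl
  | and φ ψ ih ih' =>
    simp only [fv, Finset.mem_union] at h
    simp only [subst]
    rw [ih fun x hx => h x (.inl hx), ih' fun x hx => h x (.inr hx)]
  | or φ ψ ih ih' =>
    simp only [fv, Finset.mem_union] at h
    simp only [subst]
    rw [ih fun x hx => h x (.inl hx), ih' fun x hx => h x (.inr hx)]
  | imp φ ψ ih ih' =>
    simp only [fv, Finset.mem_union] at h
    simp only [subst]
    rw [ih fun x hx => h x (.inl hx), ih' fun x hx => h x (.inr hx)]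
  | all φ ih => simp only [subst]; rw [ih (up_congr h)]
  | ex φ ih => simp only [subst]; rw [ih (up_congr h)]

theorem mem_fv_subst {σ : ℕ → L.Term ℕ} {φ : IForm L} {n : ℕ} :
    n ∈ (φ.subst σ).fv ↔ ∃ x ∈ φ.fv, n ∈ (σ x).varFinset := by
  induction φ generalizing σ n with
  | eq t t' =>
    simp only [subst, fv, Finset.mem_union, mem_term_vars_subst, or_and_right, exists_or]
  | rel r ts =>
    simp only [subst, fv, Finset.mem_biUnion, Finset.mem_univ, true_and, mem_term_vars_subst]
    exact ⟨fun ⟨i, x, hx, h⟩ => ⟨x, ⟨i, hx⟩, h⟩, fun ⟨x, ⟨i, hx⟩, h⟩ => ⟨i, x, hx, h⟩⟩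
  | bot => simp [subst, fv]
  | top => simp [subst, fv]
  | and φ ψ ih ih' => simp only [subst, fv, Finset.mem_union, ih, ih', or_and_right, exists_or]
  | or φ ψ ih ih' => simp only [subst, fv, Finset.mem_union, ih, ih', or_and_right, exists_or]
  | imp φ ψ ih ih' => simp only [subst, fv, Finset.mem_union, ih, ih', or_and_right, exists_or]
  | all φ ih => simp only [subst, fv, mem_unbind, ih, exists_mem_up]
  | ex φ ih => simp only [subst, fv, mem_unbind, ih, exists_mem_up]

theorem subst_of_closed {φ : IForm L} (h : φ.fv = ∅) (σ : ℕ → L.Term ℕ) : φ.subst σ = φ := by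
  conv_rhs => rw [← subst_var φ]
  exact subst_congr (by simp [h])

end IForm

theorem succ_mem_vars_bindS {x y n : ℕ} :
    n + 1 ∈ (bindS x y : L.Term ℕ).varFinset ↔ y = n ∧ y ≠ x := by
  unfold bindS
  split_ifs with h
  · simp [h]
  · simp [h, eq_comm]

namespace IForm

theorem fv_allV (x : ℕ) (φ : IForm L) : (allV x φ).fv = φ.fv.erase x := by
  ext n
  simp only [allV, fv, mem_unbind, mem_fv_subst, succ_mem_vars_bindS, Finset.mem_erase]
  exact ⟨fun ⟨_, hx, rfl, h⟩ => ⟨h, hx⟩, fun ⟨h, hx⟩ => ⟨n, hx, rfl, h⟩⟩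

theorem fv_exV (x : ℕ) (φ : IForm L) : (exV x φ).fv = φ.fv.erase x := fv_allV x φ

theorem fv_alls (X : Finset ℕ) (φ : IForm L) : (alls X φ).fv = φ.fv \ X := by
  have key : ∀ l : List ℕ, (l.foldr allV φ).fv = φ.fv \ l.toFinset := by
    intro l
    induction l with
    | nil => simp
    | cons a l ih => rw [List.foldr_cons, fv_allV, ih]; ext; simp; tauto
  rw [alls, key, Finset.sort_toFinset]

theorem fv_exs (X : Finset ℕ) (φ : IForm L) : (exs X φ).fv = φ.fv \ X := by
  have key : ∀ l : List ℕ, (l.foldr exV φ).fv = φ.fv \ l.toFinset := by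
    intro l
    induction l with
    | nil => simp
    | cons a l ih => rw [List.foldr_cons, fv_exV, ih]; ext; simp; tauto
  rw [exs, key, Finset.sort_toFinset]

theorem fv_univ (φ : IForm L) : φ.univ.fv = ∅ := by
  rw [univ, fv_alls, sdiff_self]; rfl

end IForm

end IFormSubst

/-! ### Substitution in formulas of linear logic -/

section LFormSubst

variable {L : FirstOrder.Language.{u, v}} {U : ℕ → Type w}

namespace LForm

theorem subst_subst (σ τ : ℕ → L.Term ℕ) (φ : LForm L U) :
    (φ.subst σ).subst τ = φ.subst (scomp σ τ) := by
  induction φ generalizing σ τ <;> simp only [subst, term_subst_subst, *, up_scomp_up]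

@[simp] theorem subst_var (φ : LForm L U) : φ.subst Term.var = φ := by
  induction φ <;> simp only [subst, term_subst_var, *, up_var]

theorem subst_congr {σ τ : ℕ → L.Term ℕ} {φ : LForm L U} (h : ∀ x ∈ φ.fv, σ x = τ x) :
    φ.subst σ = φ.subst τ := by
  induction φ generalizing σ τ with
  | eq t t' =>
    simp only [fv, Finset.mem_union] at h
    simp only [subst]
    rw [term_subst_congr fun x hx => h x (.inl hx), term_subst_congr fun x hx => h x (.inr hx)]
  | user r ts =>
    simp only [subst, LForm.user.injEq, heq_eq_eq, true_and]
    funext i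
    exact term_subst_congr fun x hx => h x (by simpa [fv] using ⟨i, hx⟩)
  | rel r ts =>
    simp only [subst, LForm.rel.injEq, heq_eq_eq, true_and]
    funext i
    exact term_subst_congr fun x hx => h x (by simpa [fv] using ⟨i, hx⟩)
  | one => rfl
  | zero => rfl
  | top => rfl
  | bang φ ih => simp only [subst]; rw [ih h]
  | all φ ih => simp only [subst]; rw [ih (up_congr h)]
  | ex φ ih => simp only [subst]; rw [ih (up_congr h)]
  | _ φ ψ ih ih' =>
    simp only [fv, Finset.mem_union] at h
    simp only [subst]
    rw [ih fun x hx => h x (.inl hx), ih' fun x hx => h x (.inr hx)]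

theorem mem_fv_subst {σ : ℕ → L.Term ℕ} {φ : LForm L U} {n : ℕ} :
    n ∈ (φ.subst σ).fv ↔ ∃ x ∈ φ.fv, n ∈ (σ x).varFinset := by
  induction φ generalizing σ n with
  | eq t t' =>
    simp only [subst, fv, Finset.mem_union, mem_term_vars_subst, or_and_right, exists_or]
  | user r ts | rel r ts =>
    simp only [subst, fv, Finset.mem_biUnion, Finset.mem_univ, true_and, mem_term_vars_subst]
    exact ⟨fun ⟨i, x, hx, h⟩ => ⟨x, ⟨i, hx⟩, h⟩, fun ⟨x, ⟨i, hx⟩, h⟩ => ⟨i, x, hx, h⟩⟩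
  | one | zero | top => simp [subst, fv]
  | bang φ ih => simp only [subst, fv, ih]
  | all φ ih => simp only [subst, fv, mem_unbind, ih, exists_mem_up]
  | ex φ ih => simp only [subst, fv, mem_unbind, ih, exists_mem_up]
  | _ φ ψ ih ih' =>
    simp only [subst, fv, Finset.mem_union, ih, ih', or_and_right, exists_or]

theorem subst_of_closed {φ : LForm L U} (h : φ.fv = ∅) (σ : ℕ → L.Term ℕ) : φ.subst σ = φ := by
  conv_rhs => rw [← subst_var φ]
  exact subst_congr (by simp [h])

theorem fv_allV (x : ℕ) (φ : LForm L U) : (allV x φ).fv = φ.fv.erase x := by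
  ext n
  simp only [allV, fv, mem_unbind, mem_fv_subst, succ_mem_vars_bindS, Finset.mem_erase]
  exact ⟨fun ⟨_, hx, rfl, h⟩ => ⟨h, hx⟩, fun ⟨h, hx⟩ => ⟨n, hx, rfl, h⟩⟩

theorem fv_alls (X : Finset ℕ) (φ : LForm L U) : (alls X φ).fv = φ.fv \ X := by
  have key : ∀ l : List ℕ, (l.foldr allV φ).fv = φ.fv \ l.toFinset := by
    intro l
    induction l with
    | nil => simp
    | cons a l ih => rw [List.foldr_cons, fv_allV, ih]; ext; simp; tauto
  rw [alls, key, Finset.sort_toFinset]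

theorem fv_univ (φ : LForm L U) : φ.univ.fv = ∅ := by
  rw [univ, fv_alls, sdiff_self]; rfl

end LForm

theorem IForm.star_subst (σ : ℕ → L.Term ℕ) (φ : IForm L) :
    (φ.subst σ).star U = (φ.star U).subst σ := by
  induction φ generalizing σ <;> simp only [IForm.subst, IForm.star, LForm.subst, *]

theorem IForm.fv_star (φ : IForm L) : (φ.star U).fv = φ.fv := by
  induction φ <;> simp only [IForm.fv, IForm.star, LForm.fv, *]

theorem IForm.star_exs (X : Finset ℕ) (φ : IForm L) :
    (IForm.exs X φ).star U = LForm.exs X (φ.star U) := by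
  unfold IForm.exs LForm.exs
  induction X.sort with
  | nil => rfl
  | cons a l ih => simp only [List.foldr_cons, IForm.exV, LForm.exV, IForm.star, star_subst, ih]

end LFormSubst

/-! ### Substitution in constraints and goals -/

section ConstraintSubst

variable {L : FirstOrder.Language.{u, v}} {U : ℕ → Type w}

theorem UAtom.subst_subst (σ τ : ℕ → L.Term ℕ) (a : UAtom L U) :
    (a.subst σ).subst τ = a.subst (scomp σ τ) := by
  cases a; simp only [UAtom.subst, term_subst_subst]

theorem BAtom.subst_subst (σ τ : ℕ → L.Term ℕ) (a : BAtom L) :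
    (a.subst σ).subst τ = a.subst (scomp σ τ) := by
  cases a <;> simp only [BAtom.subst, term_subst_subst]

theorem UAtom.subst_congr {σ τ : ℕ → L.Term ℕ} {a : UAtom L U} (h : ∀ x ∈ a.vars, σ x = τ x) :
    a.subst σ = a.subst τ := by
  obtain ⟨c, ts⟩ := a
  simp only [subst, UAtom.mk.injEq, heq_eq_eq, true_and]
  funext i
  exact term_subst_congr fun x hx => h x (by simpa [vars] using ⟨i, hx⟩)

theorem BAtom.subst_congr {σ τ : ℕ → L.Term ℕ} {a : BAtom L} (h : ∀ x ∈ a.vars, σ x = τ x) :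
    a.subst σ = a.subst τ := by
  cases a with
  | falsum => rfl
  | eq t t' =>
    simp only [vars, Finset.mem_union] at h
    simp only [subst]
    rw [term_subst_congr fun x hx => h x (.inl hx), term_subst_congr fun x hx => h x (.inr hx)]
  | rel r ts =>
    simp only [subst, BAtom.rel.injEq, heq_eq_eq, true_and]
    funext i
    exact term_subst_congr fun x hx => h x (by simpa [vars] using ⟨i, hx⟩)

@[simp] theorem UAtom.subst_var (a : UAtom L U) : a.subst Term.var = a := by
  cases a; simp only [UAtom.subst, term_subst_var]

@[simp] theorem BAtom.subst_var (a : BAtom L) : a.subst Term.var = a := by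
  cases a <;> simp only [BAtom.subst, term_subst_var]

theorem UAtom.mem_vars_subst {σ : ℕ → L.Term ℕ} {a : UAtom L U} {n : ℕ} :
    n ∈ (a.subst σ).vars ↔ ∃ x ∈ a.vars, n ∈ (σ x).varFinset := by
  obtain ⟨c, ts⟩ := a
  simp only [subst, vars, Finset.mem_biUnion, Finset.mem_univ, true_and, mem_term_vars_subst]
  exact ⟨fun ⟨i, _, x, hx, h⟩ => ⟨x, ⟨i, hx⟩, h⟩,
    fun ⟨x, ⟨i, hx⟩, h⟩ => ⟨i, Finset.mem_univ _, x, hx, h⟩⟩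

theorem BAtom.mem_vars_subst {σ : ℕ → L.Term ℕ} {a : BAtom L} {n : ℕ} :
    n ∈ (a.subst σ).vars ↔ ∃ x ∈ a.vars, n ∈ (σ x).varFinset := by
  cases a with
  | falsum => simp [subst, vars]
  | eq t t' =>
    simp only [subst, vars, Finset.mem_union, mem_term_vars_subst, or_and_right, exists_or]
  | rel r ts =>
    simp only [subst, vars, Finset.mem_biUnion, Finset.mem_univ, true_and, mem_term_vars_subst]
    exact ⟨fun ⟨i, x, hx, h⟩ => ⟨x, ⟨i, hx⟩, h⟩, fun ⟨x, ⟨i, hx⟩, h⟩ => ⟨i, x, hx, h⟩⟩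

/-! ### Atoms, variables and instances of conjunctions -/

/-- The multiset of the atoms of a conjunction. -/
def Conj.atoms {A : Type u} : Conj A → Multiset A
  | .top => 0
  | .atom a => {a}
  | .and C D => C.atoms + D.atoms

theorem Conj.atoms_map {A : Type u} {A' : Type v} (f : A → A') (C : Conj A) :
    (C.map f).atoms = C.atoms.map f := by
  induction C with
  | top => rfl
  | atom a => rfl
  | and C D ih ih' => simp only [Conj.map, atoms, ih, ih', Multiset.map_add]

theorem Conj.mem_varsWith {A : Type u} (f : A → Finset ℕ) (C : Conj A) {x : ℕ} :
    x ∈ C.varsWith f ↔ ∃ a ∈ C.atoms, x ∈ f a := by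
  induction C with
  | top => simp [varsWith, atoms]
  | atom a => simp [varsWith, atoms]
  | and C D ih ih' =>
    simp only [varsWith, atoms, Finset.mem_union, ih, ih', Multiset.mem_add, or_and_right,
      exists_or]

theorem Conj.map_congr {A : Type u} {A' : Type v} {f g : A → A'} {C : Conj A}
    (h : ∀ a ∈ C.atoms, f a = g a) : C.map f = C.map g := by
  induction C with
  | top => rfl
  | atom a => simp only [Conj.map, h a (by simp [atoms])]
  | and C D ih ih' =>
    simp only [atoms, Multiset.mem_add] at h
    simp only [Conj.map, ih fun a ha => h a (.inl ha), ih' fun a ha => h a (.inr ha)]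

theorem Conj.map_id' {A : Type u} {f : A → A} (C : Conj A) (h : ∀ a, f a = a) : C.map f = C := by
  induction C with
  | top => rfl
  | atom a => simp only [Conj.map, h]
  | and C D ih ih' => simp only [Conj.map, ih, ih']

theorem Conj.map_map {A : Type u} {A' : Type v} {A'' : Type w} (f : A → A') (g : A' → A'')
    (C : Conj A) : (C.map f).map g = C.map (fun a => g (f a)) := by
  induction C with
  | top => rfl
  | atom a => rfl
  | and C D ih ih' => simp only [Conj.map, ih, ih']

theorem UserC.subst_subst (σ τ : ℕ → L.Term ℕ) (C : UserC L U) :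
    UserC.subst τ (UserC.subst σ C) = UserC.subst (scomp σ τ) C := by
  simp only [UserC.subst, Conj.map_map, UAtom.subst_subst]

theorem BuiltinC.subst_subst (σ τ : ℕ → L.Term ℕ) (B : BuiltinC L) :
    BuiltinC.subst τ (BuiltinC.subst σ B) = BuiltinC.subst (scomp σ τ) B := by
  simp only [BuiltinC.subst, Conj.map_map, BAtom.subst_subst]

@[simp] theorem UserC.subst_var (C : UserC L U) : UserC.subst Term.var C = C :=
  Conj.map_id' _ UAtom.subst_var

@[simp] theorem BuiltinC.subst_var (B : BuiltinC L) : BuiltinC.subst Term.var B = B :=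
  Conj.map_id' _ BAtom.subst_var

theorem UserC.subst_congr {σ τ : ℕ → L.Term ℕ} {C : UserC L U}
    (h : ∀ x ∈ UserC.vars C, σ x = τ x) : UserC.subst σ C = UserC.subst τ C :=
  Conj.map_congr fun a ha => UAtom.subst_congr fun x hx =>
    h x ((Conj.mem_varsWith _ _).2 ⟨a, ha, hx⟩)

theorem BuiltinC.subst_congr {σ τ : ℕ → L.Term ℕ} {B : BuiltinC L}
    (h : ∀ x ∈ BuiltinC.vars B, σ x = τ x) : BuiltinC.subst σ B = BuiltinC.subst τ B :=
  Conj.map_congr fun a ha => BAtom.subst_congr fun x hx =>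
    h x ((Conj.mem_varsWith _ _).2 ⟨a, ha, hx⟩)

theorem UserC.subst_of_fixesOn {σ : ℕ → L.Term ℕ} {C : UserC L U}
    (h : FixesOn (UserC.vars C) σ) : UserC.subst σ C = C := by
  rw [UserC.subst_congr h]; exact UserC.subst_var C

theorem BuiltinC.subst_of_fixesOn {σ : ℕ → L.Term ℕ} {B : BuiltinC L}
    (h : FixesOn (BuiltinC.vars B) σ) : BuiltinC.subst σ B = B := by
  rw [BuiltinC.subst_congr h]; exact BuiltinC.subst_var B

theorem UserC.mem_vars {C : UserC L U} {x : ℕ} : x ∈ UserC.vars C ↔ ∃ a ∈ C.atoms, x ∈ a.vars :=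
  Conj.mem_varsWith _ _

theorem BuiltinC.mem_vars {B : BuiltinC L} {x : ℕ} :
    x ∈ BuiltinC.vars B ↔ ∃ a ∈ B.atoms, x ∈ a.vars :=
  Conj.mem_varsWith _ _

theorem UserC.mem_vars_subst {σ : ℕ → L.Term ℕ} {C : UserC L U} {n : ℕ} :
    n ∈ UserC.vars (UserC.subst σ C) ↔ ∃ x ∈ UserC.vars C, n ∈ (σ x).varFinset := by
  simp only [UserC.mem_vars, UserC.subst, Conj.atoms_map, Multiset.mem_map]
  constructor
  · rintro ⟨_, ⟨a, ha, rfl⟩, h⟩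
    obtain ⟨x, hx, h⟩ := UAtom.mem_vars_subst.1 h
    exact ⟨x, ⟨a, ha, hx⟩, h⟩
  · rintro ⟨x, ⟨a, ha, hx⟩, h⟩
    exact ⟨_, ⟨a, ha, rfl⟩, UAtom.mem_vars_subst.2 ⟨x, hx, h⟩⟩

theorem BuiltinC.mem_vars_subst {σ : ℕ → L.Term ℕ} {B : BuiltinC L} {n : ℕ} :
    n ∈ BuiltinC.vars (BuiltinC.subst σ B) ↔ ∃ x ∈ BuiltinC.vars B, n ∈ (σ x).varFinset := by
  simp only [BuiltinC.mem_vars, BuiltinC.subst, Conj.atoms_map, Multiset.mem_map]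
  constructor
  · rintro ⟨_, ⟨a, ha, rfl⟩, h⟩
    obtain ⟨x, hx, h⟩ := BAtom.mem_vars_subst.1 h
    exact ⟨x, ⟨a, ha, hx⟩, h⟩
  · rintro ⟨x, ⟨a, ha, hx⟩, h⟩
    exact ⟨_, ⟨a, ha, rfl⟩, BAtom.mem_vars_subst.2 ⟨x, hx, h⟩⟩

theorem BAtom.toI_subst (σ : ℕ → L.Term ℕ) (a : BAtom L) :
    (a.subst σ).toI = a.toI.subst σ := by
  cases a <;> rfl

theorem BuiltinC.toI_subst (σ : ℕ → L.Term ℕ) (B : BuiltinC L) :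
    BuiltinC.toI (BuiltinC.subst σ B) = (BuiltinC.toI B).subst σ := by
  induction B with
  | top => rfl
  | atom a => exact BAtom.toI_subst σ a
  | and B D ih ih' =>
    simp only [BuiltinC.subst] at ih ih'
    simp only [BuiltinC.subst, Conj.map, BuiltinC.toI, IForm.subst, ih, ih']

theorem BAtom.fv_toI (a : BAtom L) : a.toI.fv = a.vars := by
  cases a <;> rfl

theorem BuiltinC.fv_toI (B : BuiltinC L) : (BuiltinC.toI B).fv = BuiltinC.vars B := by
  induction B with
  | top => rfl
  | atom a => exact BAtom.fv_toI a
  | and B D ih ih' =>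
    simp only [BuiltinC.vars] at ih ih'
    simp only [BuiltinC.toI, IForm.fv, ih, ih', BuiltinC.vars, Conj.varsWith]

end ConstraintSubst

end CHR

namespace CHR

open FirstOrder.Language (Term)
open scoped Pointwise

universe u v w

/-! ### Phase semantics

The points of the phase space are constraint stores, that is, pairs of a multiset of user-defined
atoms and a multiset of built-in atoms; the exponential is interpreted by the built-in stores. -/

section Phase

variable {L : FirstOrder.Language.{u, v}} {U : ℕ → Type w}

/-- Constraint stores. -/
abbrev Store (L : FirstOrder.Language.{u, v}) (U : ℕ → Type w) :=
  Multiset (UAtom L U) × Multiset (BAtom L)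

/-- The points orthogonal to `X` with respect to the pole `O`. -/
def perp (O X : Set (Store L U)) : Set (Store L U) := {n | ∀ m ∈ X, m + n ∈ O}

/-- The closure of `X` with respect to the pole `O`. -/
def cl (O X : Set (Store L U)) : Set (Store L U) := perp O (perp O X)

/-- The closed sets with respect to the pole `O`. -/
def IsFact (O Z : Set (Store L U)) : Prop := cl O Z ⊆ Z

variable (U) in
/-- The stores without user-defined atoms. -/
def builtinStores (L : FirstOrder.Language.{u, v}) : Set (Store L U) := {m | m.1 = 0}

theorem subset_cl (O X : Set (Store L U)) : X ⊆ cl O X := fun m hm _ hn => by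
  rw [add_comm]; exact hn m hm

theorem perp_anti {O X Y : Set (Store L U)} (h : X ⊆ Y) : perp O Y ⊆ perp O X :=
  fun _ hn m hm => hn m (h hm)

theorem cl_mono {O X Y : Set (Store L U)} (h : X ⊆ Y) : cl O X ⊆ cl O Y := perp_anti (perp_anti h)

theorem isFact_cl (O X : Set (Store L U)) : IsFact O (cl O X) := fun _ hm n hn =>
  hm n (subset_cl O _ hn)

theorem cl_subset {O X Z : Set (Store L U)} (hZ : IsFact O Z) (h : X ⊆ Z) : cl O X ⊆ Z :=
  (cl_mono h).trans hZ

/-- A fact is its own biorthogonal, so membership can be tested in the contexts orthogonal to it.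
This reduces statements about arbitrary facts to statements about the pole. -/
theorem mem_fact_of_test {O Z : Set (Store L U)} (hZ : IsFact O Z) {m : Store L U}
    (h : ∀ n ∈ perp O Z, m + n ∈ O) : m ∈ Z :=
  hZ fun n hn => by rw [add_comm]; exact h n hn

/-- For a fact `Z`, the points `k` with `k + R ⊆ Z` again form a fact, so it suffices to treat the
generators `X`. Most left rules of the calculus are proved sound in this way. -/
theorem cl_add_subset {O X R Z : Set (Store L U)} (hZ : IsFact O Z) (h : X + R ⊆ Z) :
    cl O X + R ⊆ Z := by
  rintro _ ⟨k, hk, r, hr, rfl⟩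
  refine mem_fact_of_test hZ fun n hn => ?_
  have := hk (r + n) fun x hx => by
    rw [← add_assoc]; exact hn _ (h (Set.add_mem_add hx hr))
  simpa only [add_comm, add_left_comm, add_assoc] using this

/-- The interpretation of formulas of linear logic in the phase space with pole `O`. -/
def interp (O : Set (Store L U)) : LForm L U → (ℕ → L.Term ℕ) → Set (Store L U)
  | .user c ts, σ => cl O {({.mk c fun i => (ts i).subst σ}, 0)}
  | .eq t t', σ => cl O {(0, {.eq (t.subst σ) (t'.subst σ)})}
  | .rel r ts, σ => cl O {(0, {.rel r fun i => (ts i).subst σ})}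
  -- This `0` is the pointwise zero, the singleton of the empty store, in contrast to the empty set
  -- in the next clause.
  | .one, _ => cl O 0
  | .zero, _ => cl O ∅
  | .top, _ => Set.univ
  | .tensor φ ψ, σ => cl O (interp O φ σ + interp O ψ σ)
  | .lolli φ ψ, σ => {m | ∀ x ∈ interp O φ σ, m + x ∈ interp O ψ σ}
  | .with φ ψ, σ => interp O φ σ ∩ interp O ψ σ
  | .plus φ ψ, σ => cl O (interp O φ σ ∪ interp O ψ σ)
  | .bang φ, σ => cl O (interp O φ σ ∩ builtinStores U L)
  | .all φ, σ => {m | ∀ t, m ∈ interp O φ (consS t σ)}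
  | .ex φ, σ => cl O (⋃ t, interp O φ (consS t σ))

theorem isFact_interp (O : Set (Store L U)) (φ : LForm L U) (σ : ℕ → L.Term ℕ) :
    IsFact O (interp O φ σ) := by
  induction φ generalizing σ with
  | user | eq | rel | one | zero | tensor | plus | bang | ex => exact isFact_cl _ _
  | top => exact Set.subset_univ _
  | lolli φ ψ _ ih =>
    refine fun m hm x hx => mem_fact_of_test (ih σ) fun n hn => ?_
    have := hm (x + n) fun k hk => by
      rw [← add_assoc]; exact hn _ (hk x hx)
    simpa only [add_comm, add_left_comm, add_assoc] using this
  | all φ ih =>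
    intro m hm t
    refine ih _ (cl_mono (fun k hk => ?_) hm)
    have hk : ∀ t, k ∈ interp O φ (consS t σ) := hk
    exact hk t
  | _ φ ψ ih ih' =>
    exact fun m hm => ⟨ih σ (cl_mono Set.inter_subset_left hm),
      ih' σ (cl_mono Set.inter_subset_right hm)⟩

theorem interp_subst (O : Set (Store L U)) (φ : LForm L U) (τ σ : ℕ → L.Term ℕ) :
    interp O (φ.subst τ) σ = interp O φ (scomp τ σ) := by
  induction φ generalizing τ σ <;>
    simp only [LForm.subst, interp, term_subst_subst, *, up_scomp_consS]

/-- The interpretation of a context. -/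
def interpCtx (O : Set (Store L U)) (Γ : Multiset (LForm L U)) (σ : ℕ → L.Term ℕ) :
    Set (Store L U) := (Γ.map fun φ => interp O φ σ).sum

theorem interpCtx_cons (O : Set (Store L U)) (φ : LForm L U) (Γ : Multiset (LForm L U))
    (σ : ℕ → L.Term ℕ) : interpCtx O (φ ::ₘ Γ) σ = interp O φ σ + interpCtx O Γ σ := by
  simp [interpCtx]

theorem interpCtx_add (O : Set (Store L U)) (Γ Δ : Multiset (LForm L U))
    (σ : ℕ → L.Term ℕ) : interpCtx O (Γ + Δ) σ = interpCtx O Γ σ + interpCtx O Δ σ := by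
  simp [interpCtx]

theorem interpCtx_shift (O : Set (Store L U)) (Γ : Multiset (LForm L U)) (t : L.Term ℕ)
    (σ : ℕ → L.Term ℕ) :
    interpCtx O (Γ.map (LForm.subst shiftS)) (consS t σ) = interpCtx O Γ σ := by
  simp only [interpCtx, Multiset.map_map, Function.comp_def, interp_subst, shiftS_scomp_consS]

/-- Promotion needs a built-in store for the whole context `!Γ`, but a sum of closures need not be
generated by such stores on the nose. The formulas are therefore replaced by their built-in
generators one at a time, the generators already chosen being moved into `R`. -/
theorem interpCtx_bang_add_subset {O R Z : Set (Store L U)} (hZ : IsFact O Z)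
    (Γ : Multiset (LForm L U)) (σ : ℕ → L.Term ℕ)
    (h : interpCtx O (Γ.map .bang) σ ∩ builtinStores U L + R ⊆ Z) :
    interpCtx O (Γ.map .bang) σ + R ⊆ Z := by
  induction Γ using Multiset.induction generalizing R with
  | empty =>
    refine subset_trans (Set.add_subset_add_right ?_) h
    rw [Multiset.map_zero, interpCtx, Multiset.map_zero, Multiset.sum_zero]
    rintro _ rfl
    exact ⟨rfl, rfl⟩
  | cons φ Γ ih =>
    rw [Multiset.map_cons, interpCtx_cons] at h ⊢
    rw [add_assoc]
    refine cl_add_subset hZ ?_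
    rw [add_left_comm]
    refine ih ?_
    rintro _ ⟨a, ⟨ha, haK⟩, _, ⟨b, ⟨hb, hbK⟩, r, hr, rfl⟩, rfl⟩
    change a + (b + r) ∈ Z
    rw [add_left_comm, ← add_assoc]
    refine h (Set.add_mem_add ⟨Set.add_mem_add (subset_cl _ _ ⟨hb, hbK⟩) ha, ?_⟩ hr)
    change b.1 + a.1 = 0
    rw [show b.1 = 0 from hbK, show a.1 = 0 from haK, add_zero]

/-! ### Soundness of the phase semantics -/

/-- Adding built-in constraints to a store preserves membership. -/
def StoreMonotone (O : Set (Store L U)) : Prop :=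
  ∀ (C : Multiset (UAtom L U)) (B B' : Multiset (BAtom L)), B ⊆ B' → (C, B) ∈ O → (C, B') ∈ O

/-- Induction on the derivation; cut is merely transitivity of inclusion. Built-in stores are not
idempotent in the monoid, and monotonicity of the pole makes up for this in the contraction and
weakening rules. -/
theorem interp_sound {O : Set (Store L U)} (hO : StoreMonotone O) {Γ : Multiset (LForm L U)}
    {φ : LForm L U} (h : LProv Γ φ) (σ : ℕ → L.Term ℕ) : interpCtx O Γ σ ⊆ interp O φ σ := by
  have fact := fun (φ : LForm L U) σ => isFact_interp O φ σ
  -- Inclusion of multisets ignores multiplicities, so this both adds built-in atoms and removes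
  -- repeated ones.
  have builtin_mem : ∀ {k k' : Store L U} {Z}, IsFact O Z → k.1 = k'.1 → k.2 ⊆ k'.2 → k ∈ Z →
      k' ∈ Z := by
    intro k k' Z hZ h1 h2 hk
    refine mem_fact_of_test hZ fun n hn => ?_
    have := hO _ _ (k'.2 + n.2) (fun b hb => by
      rcases Multiset.mem_add.1 hb with hb | hb
      · exact Multiset.mem_add.2 (.inl (h2 hb))
      · exact Multiset.mem_add.2 (.inr hb)) (hn _ hk)
    change (k.1 + n.1, k'.2 + n.2) ∈ O at this
    rw [h1] at this
    exact this
  induction h generalizing σ with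
  | ident α => simp [interpCtx]
  | cut _ _ ih ih' =>
    have ih' := ih' σ
    rw [interpCtx_cons] at ih'
    rw [interpCtx_add]
    exact (Set.add_subset_add_right (ih σ)).trans ih'
  | tensorL _ ih =>
    have ih := ih σ
    rw [interpCtx_cons, interpCtx_cons, ← add_assoc] at ih
    rw [interpCtx_cons]
    exact cl_add_subset (fact _ _) ih
  | tensorR _ _ ih ih' =>
    rw [interpCtx_add]
    exact (Set.add_subset_add (ih σ) (ih' σ)).trans (subset_cl _ _)
  | oneL _ ih =>
    rw [interpCtx_cons]
    exact cl_add_subset (fact _ _) (by rw [zero_add]; exact ih σ)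
  | oneR => exact subset_trans (by simp [interpCtx]) (subset_cl O 0)
  | lolliL _ _ ih ih' =>
    have ih' := ih' σ
    rw [interpCtx_cons] at ih'
    rw [interpCtx_cons, interpCtx_add]
    rintro _ ⟨m, hm, _, ⟨a, ha, b, hb, rfl⟩, rfl⟩
    change m + (a + b) ∈ _
    rw [← add_assoc]
    exact ih' (Set.add_mem_add (hm a (ih σ ha)) hb)
  | lolliR _ ih =>
    have ih := ih σ
    rw [interpCtx_cons] at ih
    intro m hm x hx
    rw [add_comm]
    exact ih (Set.add_mem_add hx hm)
  | @bangR Γ α _ ih =>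
    rw [← add_zero (interpCtx _ _ _)]
    refine interpCtx_bang_add_subset (fact _ _) _ _ ?_
    rw [add_zero]
    exact subset_trans (Set.inter_subset_inter_left _ (ih σ)) (subset_cl _ _)
  | dereliction _ ih =>
    have ih := ih σ
    rw [interpCtx_cons] at ih ⊢
    exact cl_add_subset (fact _ _) ((Set.add_subset_add_right Set.inter_subset_left).trans ih)
  | contraction _ ih =>
    have ih := ih σ
    rw [interpCtx_cons, interpCtx_cons] at ih
    rw [interpCtx_cons]
    refine cl_add_subset (fact _ _) ?_
    rintro _ ⟨k, hk, r, hr, rfl⟩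
    -- The same built-in store `k` serves for both copies of the exponential formula, and its
    -- duplicate is then removed.
    have := ih (Set.add_mem_add (subset_cl _ _ hk) (Set.add_mem_add (subset_cl _ _ hk) hr))
    refine builtin_mem (fact _ _) ?_ ?_ this
    · change k.1 + (k.1 + r.1) = k.1 + r.1
      rw [show k.1 = 0 from hk.2, zero_add]
    · intro b hb
      simp only [Prod.snd_add, Multiset.mem_add] at hb ⊢
      tauto
  | weakening _ ih =>
    rw [interpCtx_cons]
    refine cl_add_subset (fact _ _) ?_
    rintro _ ⟨k, hk, r, hr, rfl⟩
    refine builtin_mem (fact _ _) ?_ ?_ (ih σ hr)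
    · change r.1 = k.1 + r.1
      rw [show k.1 = 0 from hk.2, zero_add]
    · intro b hb
      simp only [Prod.snd_add, Multiset.mem_add]
      tauto
  | withL₁ _ ih =>
    have ih := ih σ
    rw [interpCtx_cons] at ih ⊢
    exact (Set.add_subset_add_right Set.inter_subset_left).trans ih
  | withL₂ _ ih =>
    have ih := ih σ
    rw [interpCtx_cons] at ih ⊢
    exact (Set.add_subset_add_right Set.inter_subset_right).trans ih
  | withR _ _ ih ih' => exact Set.subset_inter (ih σ) (ih' σ)
  | topR => exact Set.subset_univ _
  | plusL _ _ ih ih' =>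
    have ih := ih σ
    have ih' := ih' σ
    rw [interpCtx_cons] at ih ih' ⊢
    refine cl_add_subset (fact _ _) ?_
    rw [Set.union_add]
    exact Set.union_subset ih ih'
  | plusR₁ _ ih => exact ((ih σ).trans Set.subset_union_left).trans (subset_cl _ _)
  | plusR₂ _ ih => exact ((ih σ).trans Set.subset_union_right).trans (subset_cl _ _)
  | zeroL α =>
    simp only [interpCtx, Multiset.map_singleton, Multiset.sum_singleton]
    exact cl_subset (fact _ _) (Set.empty_subset _)
  | allL t _ ih =>
    have ih := ih σ
    rw [interpCtx_cons, interp_subst, instS_scomp] at ih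
    rw [interpCtx_cons]
    refine (Set.add_subset_add_right fun m hm => ?_).trans ih
    have hm : ∀ t, m ∈ interp O _ (consS t σ) := hm
    exact hm _
  | allR _ ih =>
    intro m hm t
    exact ih (consS t σ) (by rwa [interpCtx_shift])
  | exL _ ih =>
    rw [interpCtx_cons]
    refine cl_add_subset (fact _ _) ?_
    rw [Set.iUnion_add]
    refine Set.iUnion_subset fun t => ?_
    have ih := ih (consS t σ)
    rwa [interpCtx_cons, interpCtx_shift, interp_subst, shiftS_scomp_consS] at ih
  | exR t _ ih =>
    have ih := ih σ
    rw [interp_subst, instS_scomp] at ih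
    exact (ih.trans (Set.subset_iUnion (fun t => interp O _ (consS t σ)) _)).trans
      (subset_cl _ _)

/-- New values for a block of variables are a value for the first variable followed by new values
for the others. This is the induction step for quantifier blocks, both in the phase space and in the
two calculi. -/
theorem agreeOff_update_iff {a : ℕ} {l : List ℕ} {σ σ' : ℕ → L.Term ℕ} :
    AgreeOff (a :: l).toFinset σ' σ ↔ ∃ t, AgreeOff l.toFinset σ' (Function.update σ a t) := by
  constructor
  · intro h
    refine ⟨σ' a, fun y hy => ?_⟩
    by_cases hya : y = a
    · subst hya; simp
    · rw [Function.update_of_ne hya]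
      exact h y (by simp_all)
  · rintro ⟨t, h⟩ y hy
    simp only [List.toFinset_cons, Finset.mem_insert, not_or] at hy
    rw [h y hy.2, Function.update_of_ne hy.1]

theorem interp_exs_subset {O Z : Set (Store L U)} (hZ : IsFact O Z) (X : Finset ℕ)
    (φ : LForm L U) (σ : ℕ → L.Term ℕ)
    (h : ∀ σ', AgreeOff X σ' σ → interp O φ σ' ⊆ Z) : interp O (.exs X φ) σ ⊆ Z := by
  have key : ∀ (l : List ℕ) σ, (∀ σ', AgreeOff l.toFinset σ' σ → interp O φ σ' ⊆ Z) →
      interp O (l.foldr LForm.exV φ) σ ⊆ Z := by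
    intro l
    induction l with
    | nil => exact fun σ h => h σ (AgreeOff.refl _ _)
    | cons a l ih =>
      intro σ h
      refine cl_subset hZ (Set.iUnion_subset fun t => ?_)
      rw [interp_subst, bindS_scomp_consS]
      exact ih _ fun σ' hσ' => h σ' (agreeOff_update_iff.2 ⟨t, hσ'⟩)
  exact key _ σ (by rwa [Finset.sort_toFinset])

theorem subset_interp_exs (O : Set (Store L U)) {X : Finset ℕ} (φ : LForm L U)
    {σ σ' : ℕ → L.Term ℕ} (h : AgreeOff X σ' σ) : interp O φ σ' ⊆ interp O (.exs X φ) σ := by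
  have key : ∀ (l : List ℕ) σ, AgreeOff l.toFinset σ' σ →
      interp O φ σ' ⊆ interp O (l.foldr LForm.exV φ) σ := by
    intro l
    induction l with
    | nil =>
      intro σ h
      rw [show σ' = σ from funext fun y => h y (by simp)]
      exact subset_rfl
    | cons a l ih =>
      intro σ h
      obtain ⟨t, h⟩ := agreeOff_update_iff.1 h
      refine ((ih _ h).trans ?_).trans (subset_cl _ _)
      refine subset_trans ?_ (Set.subset_iUnion _ t)
      rw [interp_subst, bindS_scomp_consS]
  exact key _ σ (by rwa [Finset.sort_toFinset])

theorem mem_interp_alls {O : Set (Store L U)} {X : Finset ℕ} {φ : LForm L U} {m : Store L U}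
    {σ : ℕ → L.Term ℕ} :
    m ∈ interp O (.alls X φ) σ ↔ ∀ σ', AgreeOff X σ' σ → m ∈ interp O φ σ' := by
  have key : ∀ (l : List ℕ) σ, m ∈ interp O (l.foldr LForm.allV φ) σ ↔
      ∀ σ', AgreeOff l.toFinset σ' σ → m ∈ interp O φ σ' := by
    intro l
    induction l with
    | nil =>
      refine fun σ => ⟨fun h σ' hσ' => ?_, fun h => h σ (AgreeOff.refl _ _)⟩
      rw [show σ' = σ from funext fun y => hσ' y (by simp)]
      exact h
    | cons a l ih =>
      intro σ
      simp only [List.foldr_cons, LForm.allV, interp, Set.mem_ofPred_eq, interp_subst,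
        bindS_scomp_consS, ih, agreeOff_update_iff]
      exact ⟨fun h σ' ⟨t, ht⟩ => h t σ' ht, fun h t σ' ht => h σ' ⟨t, ht⟩⟩
  rw [LForm.alls, key, Finset.sort_toFinset]

theorem mem_interp_univ {O : Set (Store L U)} {φ : LForm L U} {m : Store L U}
    {σ : ℕ → L.Term ℕ} (h : ∀ σ', m ∈ interp O φ σ') : m ∈ interp O φ.univ σ :=
  mem_interp_alls.2 fun σ' _ => h σ'

theorem zero_mem_interp_bang {O : Set (Store L U)} {φ : LForm L U} {σ : ℕ → L.Term ℕ}
    (h : 0 ∈ interp O φ σ) : 0 ∈ interp O (.bang φ) σ := subset_cl _ _ ⟨h, rfl⟩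

theorem zero_mem_interp_lolli {O : Set (Store L U)} {φ ψ : LForm L U} {σ : ℕ → L.Term ℕ} :
    0 ∈ interp O (.lolli φ ψ) σ ↔ interp O φ σ ⊆ interp O ψ σ := by
  simp only [interp, Set.mem_ofPred_eq, zero_add]; rfl

/-- The star translation puts an exponential in front of each universal quantifier, so the closure
is not an `LForm.univ`. Validity survives each layer because the empty store is a built-in store. -/
theorem zero_mem_interp_star_univ {O : Set (Store L U)} {φ : IForm L}
    {σ : ℕ → L.Term ℕ} (h : ∀ σ', 0 ∈ interp O (φ.star U) σ') :
    0 ∈ interp O (φ.univ.star U) σ := by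
  unfold IForm.univ IForm.alls
  generalize φ.fv.sort = l
  induction l generalizing σ with
  | nil => exact h σ
  | cons a l ih =>
    refine zero_mem_interp_bang fun t => ?_
    rw [IForm.star_subst, interp_subst]
    exact ih

/-- Validity of the hypotheses and provability yield validity. -/
theorem zero_mem_interp_of_provable {O : Set (Store L U)} (hO : StoreMonotone O)
    {Θ : Set (LForm L U)} {φ : LForm L U} (σ : ℕ → L.Term ℕ)
    (hΘ : ∀ θ ∈ Θ, 0 ∈ interp O θ σ) (h : LProvable Θ φ) : 0 ∈ interp O φ σ := by
  obtain ⟨Γ, hΓ, h⟩ := h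
  refine interp_sound hO h σ ?_
  clear h
  induction Γ using Multiset.induction with
  | empty => simp [interpCtx]
  | cons θ Γ ih =>
    rw [interpCtx_cons, ← add_zero (0 : Store L U)]
    exact Set.add_mem_add (hΘ θ (hΓ θ (by simp)))
      (ih fun φ hφ => hΓ φ (Multiset.mem_cons_of_mem hφ))

/-! ### Interpretation of goals -/

/-- The store of an instance of a goal. -/
def Goal.store (σ : ℕ → L.Term ℕ) : Goal L U → Store L U
  | .top => 0
  | .atom (.inl a) => ({a.subst σ}, 0)
  | .atom (.inr b) => (0, {b.subst σ})
  | .and G G' => Goal.store σ G + Goal.store σ G'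

theorem store_toGoal_user (σ : ℕ → L.Term ℕ) (C : UserC L U) :
    Goal.store σ (UserC.toGoal C) = (Conj.atoms (UserC.subst σ C), 0) := by
  induction C with
  | top => rfl
  | atom a => rfl
  | and C D ih ih' =>
    simp only [UserC.toGoal, UserC.subst] at ih ih'
    simp only [UserC.toGoal, UserC.subst, Conj.map, Goal.store, ih, ih', Conj.atoms]
    rfl

theorem store_toGoal_builtin (σ : ℕ → L.Term ℕ) (B : BuiltinC L) :
    Goal.store σ (BuiltinC.toGoal (U := U) B) = (0, Conj.atoms (BuiltinC.subst σ B)) := by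
  induction B with
  | top => rfl
  | atom a => rfl
  | and C D ih ih' =>
    simp only [BuiltinC.toGoal, BuiltinC.subst] at ih ih'
    simp only [BuiltinC.toGoal, BuiltinC.subst, Conj.map, Goal.store, ih, ih', Conj.atoms]
    rfl

theorem cl_add_cl (O X Y : Set (Store L U)) : cl O (cl O X + cl O Y) = cl O (X + Y) := by
  refine subset_antisymm (cl_subset (isFact_cl _ _) ?_)
    (cl_mono (Set.add_subset_add (subset_cl _ _) (subset_cl _ _)))
  refine cl_add_subset (isFact_cl _ _) ?_
  rw [add_comm]
  refine cl_add_subset (isFact_cl _ _) ?_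
  rw [add_comm]
  exact subset_cl _ _

/-- The generator is already a built-in store, so the exponential in front of a built-in atom has no
effect in the phase space. -/
theorem cl_bang_singleton (O : Set (Store L U)) (b : BAtom L) :
    cl O (cl O {((0, {b}) : Store L U)} ∩ builtinStores U L) = cl O {(0, {b})} := by
  refine subset_antisymm (cl_subset (isFact_cl _ _) Set.inter_subset_left) (cl_mono ?_)
  rintro _ rfl
  exact ⟨subset_cl _ _ rfl, rfl⟩

/-- Every store that contains falsity belongs to `O`. -/
def ContainsFailed (O : Set (Store L U)) : Prop := ∀ C B, BAtom.falsum ∈ B → (C, B) ∈ O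

/-- The critical atom is `⊥`, interpreted by the closure of the empty set: a failed store lies in
this closure because it belongs to the pole in every context. -/
theorem interp_goal {O : Set (Store L U)} (hF : ContainsFailed O) (G : Goal L U)
    (σ : ℕ → L.Term ℕ) : interp O (Goal.toL G) σ = cl O {Goal.store σ G} := by
  induction G with
  | top => rfl
  | atom a =>
    rcases a with ⟨c, ts⟩ | _ | ⟨t, t'⟩ | ⟨r, ts⟩
    · rfl
    · refine subset_antisymm (cl_mono (Set.empty_subset _)) (cl_subset (isFact_cl _ _) ?_)
      rintro _ rfl
      exact fun n _ => hF _ _ (by simp [Goal.store, BAtom.subst])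
    · exact cl_bang_singleton O _
    · exact cl_bang_singleton O _
  | and G G' ih ih' =>
    simp only [Goal.toL, interp, ih, ih', cl_add_cl, Goal.store, Set.singleton_add_singleton]

end Phase

/-! ### Reachability of a target state from a store -/

section Reach

variable {L : FirstOrder.Language.{u, v}} {U : ℕ → Type w}

/-- The target state `T` is reachable from the store `(C, B)` by transitions and entailments, where
local variables may be instantiated by arbitrary terms. -/
inductive Reaches (CT : Theory L) (P : Set (Rule L U)) (T : State L U) :
    Multiset (UAtom L U) → Multiset (BAtom L) → Prop
  -- Surplus built-in atoms may be forgotten, whereas the user-defined atoms are resources and have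
  -- to match exactly.
  | done {B} (σ : ℕ → L.Term ℕ) : FixesOn T.globals σ → (T.goal.store σ).2 ⊆ B →
      Reaches CT P T (T.goal.store σ).1 B
  | replace {C B} {n : ℕ} (c : U n) (ts : Fin n → L.Term ℕ) (j : Fin n) (t : L.Term ℕ) :
      BAtom.eq (ts j) t ∈ B → Reaches CT P T (.mk c (Function.update ts j t) ::ₘ C) B →
      Reaches CT P T (.mk c ts ::ₘ C) B
  -- The existential variables of the premise of the clause have the values given by `σ'`. Those of
  -- its conclusion are unknown, so the target must be reachable for every choice `σ''`, in
  -- accordance with the interpretation of `∃` by a union over all terms.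
  | theory {C B} (α : CTClause L) (σ σ' : ℕ → L.Term ℕ) : α ∈ CT → AgreeOff α.X σ' σ →
      Conj.atoms (BuiltinC.subst σ' α.B) ⊆ B →
      (∀ σ'', AgreeOff α.X' σ'' σ →
        Reaches CT P T C (Conj.atoms (BuiltinC.subst σ'' α.B') + B)) →
      Reaches CT P T C B
  -- To the left of the implication in the rule formula, the local variables are quantified
  -- universally, so the guard is matched under `σ`. To the right they are bound again
  -- existentially, which is why the body and the second copy of the guard take new values `σ'`.
  | rule {C B} (R : Rule L U) (σ : ℕ → L.Term ℕ) : R ∈ P →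
      Conj.atoms (BuiltinC.subst σ R.guard) ⊆ B →
      (∀ σ', AgreeOff R.localVars σ' σ →
        Reaches CT P T
          (Conj.atoms (UserC.subst σ R.kept) + Conj.atoms (UserC.subst σ' R.bodyU) + C)
          (Conj.atoms (BuiltinC.subst σ' R.bodyB) + Conj.atoms (BuiltinC.subst σ' R.guard) + B)) →
      Reaches CT P T
        (Conj.atoms (UserC.subst σ R.kept) + Conj.atoms (UserC.subst σ R.removed) + C) B
  | failed {C B} : BAtom.falsum ∈ B → Reaches CT P T C B

theorem Reaches.mono {CT : Theory L} {P : Set (Rule L U)} {T : State L U}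
    {C : Multiset (UAtom L U)} {B B' : Multiset (BAtom L)} (h : Reaches CT P T C B)
    (hB : B ⊆ B') : Reaches CT P T C B' := by
  have aux : ∀ {A B B' : Multiset (BAtom L)}, B ⊆ B' → A + B ⊆ A + B' := by
    intro A B B' h b hb
    rcases Multiset.mem_add.1 hb with hb | hb
    · exact Multiset.mem_add.2 (.inl hb)
    · exact Multiset.mem_add.2 (.inr (h hb))
  induction h generalizing B' with
  | done σ hσ hB' => exact .done σ hσ fun _ hb => hB (hB' hb)
  | replace c ts j t hm _ ih => exact .replace c ts j t (hB hm) (ih hB)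
  | theory α σ σ' hα hσ hm _ ih =>
    exact .theory α σ σ' hα hσ (fun _ hb => hB (hm hb)) fun σ'' h => ih σ'' h (aux hB)
  | rule R σ hR hm _ ih => exact .rule R σ hR (fun _ hb => hB (hm hb)) fun σ' h => ih σ' h (aux hB)
  | failed hm => exact .failed (hB hm)

/-! ### The phase space of a target state and the validity of the axioms -/

/-- The pole of the phase space that belongs to the target state `T`. -/
def pole (CT : Theory L) (P : Set (Rule L U)) (T : State L U) : Set (Store L U) :=
  {m | Reaches CT P T m.1 m.2}

theorem storeMonotone_pole (CT : Theory L) (P : Set (Rule L U)) (T : State L U) :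
    StoreMonotone (pole CT P T) := fun _ _ _ hB h => Reaches.mono h hB

theorem containsFailed_pole (CT : Theory L) (P : Set (Rule L U)) (T : State L U) :
    ContainsFailed (pole CT P T) := fun _ _ h => .failed h

theorem star_toI (B : BuiltinC L) : (BuiltinC.toI B).star U = BuiltinC.toL U B := by
  induction B with
  | top => rfl
  | atom a => cases a <;> rfl
  | and B B' ih ih' =>
    simp only [BuiltinC.toI, IForm.star, ih, ih']
    rfl

theorem interp_builtin (CT : Theory L) (P : Set (Rule L U)) (T : State L U) (B : BuiltinC L)
    (σ : ℕ → L.Term ℕ) : interp (pole CT P T) (BuiltinC.toL U B) σ =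
      cl (pole CT P T) {(0, Conj.atoms (BuiltinC.subst σ B))} := by
  rw [BuiltinC.toL, interp_goal (containsFailed_pole CT P T), store_toGoal_builtin]

theorem interp_user (CT : Theory L) (P : Set (Rule L U)) (T : State L U) (C : UserC L U)
    (σ : ℕ → L.Term ℕ) : interp (pole CT P T) (UserC.toL C) σ =
      cl (pole CT P T) {(Conj.atoms (UserC.subst σ C), 0)} := by
  rw [UserC.toL, interp_goal (containsFailed_pole CT P T), store_toGoal_user]

/-- A context orthogonal to the conclusion of the clause reaches the target from all instances of
`α.B'`, and then `Reaches.theory` says that it does so from any instance of `α.B`. The constructors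
`replace` and `rule` play the same role in the next two lemmas. -/
theorem valid_clause {CT : Theory L} (P : Set (Rule L U)) (T : State L U) {α : CTClause L}
    (hα : α ∈ CT) (σ : ℕ → L.Term ℕ) : 0 ∈ interp (pole CT P T) (α.toI.star U) σ := by
  refine zero_mem_interp_star_univ fun σ => zero_mem_interp_bang (zero_mem_interp_lolli.2 ?_)
  have fact := isFact_interp (pole CT P T) ((IForm.exs α.X' (BuiltinC.toI α.B')).star U) σ
  rw [IForm.star_exs]
  refine interp_exs_subset fact _ _ _ fun σ' hσ' => ?_
  rw [star_toI, interp_builtin]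
  refine cl_subset fact ?_
  rintro _ rfl
  refine mem_fact_of_test fact fun n hn => ?_
  refine .theory α σ σ' hα hσ' (fun b hb => ?_) fun σ'' hσ'' => ?_
  · exact Multiset.mem_add.2 (.inl hb)
  · have mem : ((0, Conj.atoms (BuiltinC.subst σ'' α.B')) : Store L U) ∈
        interp (pole CT P T) ((IForm.exs α.X' (BuiltinC.toI α.B')).star U) σ := by
      rw [IForm.star_exs]
      refine subset_interp_exs _ _ hσ'' ?_
      rw [star_toI, interp_builtin]
      exact subset_cl _ _ rfl
    have hr : Reaches CT P T _ _ := hn _ mem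
    refine hr.mono ?_
    intro b hb
    simp only [Prod.snd_add, Multiset.mem_add] at hb ⊢
    tauto

theorem valid_eqFormula (CT : Theory L) (P : Set (Rule L U)) (T : State L U) {n : ℕ} (c : U n)
    (j : Fin n) (σ : ℕ → L.Term ℕ) : 0 ∈ interp (pole CT P T) (eqFormula c j) σ := by
  refine zero_mem_interp_bang (mem_interp_univ fun σ => zero_mem_interp_lolli.2 ?_)
  simp only [interp, cl_bang_singleton, cl_add_cl, Set.singleton_add_singleton]
  refine cl_subset (isFact_cl _ _) ?_
  rintro _ rfl
  refine mem_fact_of_test (isFact_cl _ _) fun m hm => ?_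
  have := hm _ (subset_cl _ _ rfl)
  simp only [pole, Set.mem_ofPred_eq, Prod.fst_add, Prod.snd_add, Multiset.singleton_add, add_zero,
    zero_add] at this ⊢
  refine .replace c _ j (σ n) (by simp [Term.subst]) ?_
  convert this using 3
  funext i
  by_cases h : i = j
  · subst h; simp [Term.subst]
  · simp [h]

theorem valid_rule (CT : Theory L) {P : Set (Rule L U)} (T : State L U) {R : Rule L U}
    (hR : R ∈ P) (σ : ℕ → L.Term ℕ) : 0 ∈ interp (pole CT P T) R.toL σ := by
  refine zero_mem_interp_bang (mem_interp_univ fun σ => zero_mem_interp_lolli.2 ?_)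
  refine cl_subset (isFact_interp _ _ _) ?_
  simp only [interp, interp_builtin, interp_user, cl_add_cl, Set.singleton_add_singleton]
  refine cl_add_subset (isFact_cl _ _) ?_
  rw [add_comm]
  refine cl_add_subset (isFact_cl _ _) ?_
  rw [Set.singleton_add_singleton]
  rintro _ rfl
  refine mem_fact_of_test (isFact_cl _ _) fun m hm => ?_
  simp only [pole, Set.mem_ofPred_eq, Prod.fst_add, Prod.snd_add, add_zero, zero_add]
  refine .rule R σ hR (fun b hb => Multiset.mem_add.2 (.inl hb)) fun σ' hσ' => ?_
  have mem : ((Conj.atoms (UserC.subst σ' R.bodyU), Conj.atoms (BuiltinC.subst σ' R.bodyB) +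
      Conj.atoms (BuiltinC.subst σ' R.guard)) : Store L U) ∈
      interp (pole CT P T) (LForm.exs R.localVars
        (.tensor (.tensor (UserC.toL R.bodyU) (BuiltinC.toL U R.bodyB))
          (BuiltinC.toL U R.guard))) σ := by
    refine subset_interp_exs _ _ hσ' ?_
    simp only [interp, interp_builtin, interp_user, cl_add_cl, Set.singleton_add_singleton]
    refine subset_cl _ _ ?_
    simp
  have := hm _ (subset_cl _ _ (Set.add_mem_add (subset_cl _ _ rfl) mem))
  simp only [pole, Set.mem_ofPred_eq, Prod.fst_add, Prod.snd_add, zero_add] at this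
  refine this.mono ?_
  intro b hb
  simp only [Multiset.mem_add] at hb ⊢
  tauto

/-- A provable implication between states is witnessed by a derivation from every instance of the
first state that fixes its global variables. -/
theorem reaches_of_provable {CT : Theory L} {P : Set (Rule L U)} {S T : State L U}
    (h : LProvable (programL P ∪ CT.toL U) (LForm.univ (.lolli S.toL T.toL)))
    {ρ : ℕ → L.Term ℕ} (hρ : AgreeOff (Goal.vars S.goal \ S.globals) ρ Term.var) :
    Reaches CT P T (S.goal.store ρ).1 (S.goal.store ρ).2 := by
  have h0 := zero_mem_interp_of_provable (storeMonotone_pole CT P T) Term.var (by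
    rintro θ (⟨R, hR, rfl⟩ | ⟨α, hα, rfl⟩ | ⟨n, c, j, rfl⟩)
    · exact valid_rule CT T hR _
    · exact valid_clause P T hα _
    · exact valid_eqFormula CT P T c j _) h
  -- The universal closure is used at the identity valuation, so that global variables stand for
  -- themselves.
  have h1 := zero_mem_interp_lolli.1 (mem_interp_alls.1 h0 _ (AgreeOff.refl _ _))
  have hF := containsFailed_pole CT P T
  have hS : S.goal.store ρ ∈ interp (pole CT P T) S.toL Term.var := by
    refine subset_interp_exs _ (Goal.toL S.goal) hρ ?_
    rw [interp_goal hF]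
    exact subset_cl _ _ rfl
  -- The pole is the orthogonal of the empty store and hence a fact. It therefore contains the
  -- meaning of `T` as soon as it contains the stores of the instances of its goal.
  have fact : IsFact (pole CT P T) (pole CT P T) := fun m hm => by
    rw [← zero_add m]
    exact hm 0 fun k hk => by rwa [add_zero]
  refine interp_exs_subset fact _ _ _ (fun σ' hσ' => ?_) (h1 hS)
  rw [interp_goal hF]
  refine cl_subset fact ?_
  rintro _ rfl
  exact .done σ' (fun y hy => hσ' y (by simp [hy])) fun _ h => h

end Reach

end CHR

namespace CHR

open FirstOrder.Language (Term)

universe u v w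

/-! ### Derivability in intuitionistic logic -/

section Intuitionistic

variable {L : FirstOrder.Language.{u, v}}

theorem IProv.weaken {Γ Δ : Set (IForm L)} {φ : IForm L} (h : IProv Γ φ) (hΓ : Γ ⊆ Δ) :
    IProv Δ φ := by
  induction h generalizing Δ with
  | hyp h => exact .hyp (hΓ h)
  | topI => exact .topI
  | botE _ ih => exact .botE (ih hΓ)
  | andI _ _ ih ih' => exact .andI (ih hΓ) (ih' hΓ)
  | andE₁ _ ih => exact .andE₁ (ih hΓ)
  | andE₂ _ ih => exact .andE₂ (ih hΓ)
  | orI₁ _ ih => exact .orI₁ (ih hΓ)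
  | orI₂ _ ih => exact .orI₂ (ih hΓ)
  | orE _ _ _ ih ih1 ih2 =>
    exact .orE (ih hΓ) (ih1 (Set.insert_subset_insert hΓ)) (ih2 (Set.insert_subset_insert hΓ))
  | impI _ ih => exact .impI (ih (Set.insert_subset_insert hΓ))
  | impE _ _ ih ih' => exact .impE (ih hΓ) (ih' hΓ)
  | allI _ ih => exact .allI (ih (Set.image_mono hΓ))
  | allE t _ ih => exact .allE t (ih hΓ)
  | exI t _ ih => exact .exI t (ih hΓ)
  | exE _ _ ih ih' => exact .exE (ih hΓ) (ih' (Set.insert_subset_insert (Set.image_mono hΓ)))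

theorem IForm.image_subst_shift (σ : ℕ → L.Term ℕ) (Γ : Set (IForm L)) :
    IForm.subst (up σ) '' (IForm.subst shiftS '' Γ) =
      IForm.subst shiftS '' (IForm.subst σ '' Γ) := by
  simp only [Set.image_image, IForm.subst_subst, shiftS_scomp_up]

theorem IForm.subst_instS (t : L.Term ℕ) (σ : ℕ → L.Term ℕ) (φ : IForm L) :
    (φ.subst (instS t)).subst σ = (φ.subst (up σ)).subst (instS (t.subst σ)) := by
  simp only [IForm.subst_subst, instS_scomp, up_scomp_instS]

theorem IForm.subst_shift_up (σ : ℕ → L.Term ℕ) (φ : IForm L) :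
    (φ.subst shiftS).subst (up σ) = (φ.subst σ).subst shiftS := by
  simp only [IForm.subst_subst, shiftS_scomp_up]

theorem IProv.subst {Γ : Set (IForm L)} {φ : IForm L} (h : IProv Γ φ) (σ : ℕ → L.Term ℕ) :
    IProv (IForm.subst σ '' Γ) (φ.subst σ) := by
  induction h generalizing σ with
  | hyp h => exact .hyp (Set.mem_image_of_mem _ h)
  | topI => exact .topI
  | botE _ ih => exact .botE (ih σ)
  | andI _ _ ih ih' => exact .andI (ih σ) (ih' σ)
  | andE₁ _ ih => exact .andE₁ (ih σ)
  | andE₂ _ ih => exact .andE₂ (ih σ)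
  | orI₁ _ ih => exact .orI₁ (ih σ)
  | orI₂ _ ih => exact .orI₂ (ih σ)
  | orE _ _ _ ih ih1 ih2 =>
    simp only [Set.image_insert_eq] at ih1 ih2
    exact .orE (ih σ) (ih1 σ) (ih2 σ)
  | impI _ ih =>
    simp only [Set.image_insert_eq] at ih
    exact .impI (ih σ)
  | impE _ _ ih ih' => exact .impE (ih σ) (ih' σ)
  | allI _ ih =>
    have ih := ih (up σ)
    rw [IForm.image_subst_shift] at ih
    exact .allI ih
  | allE t _ ih =>
    rw [IForm.subst_instS]
    exact .allE _ (ih σ)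
  | exI t _ ih =>
    have ih := ih σ
    rw [IForm.subst_instS] at ih
    exact .exI _ ih
  | exE _ _ ih ih' =>
    have ih' := ih' (up σ)
    rw [Set.image_insert_eq, IForm.image_subst_shift, IForm.subst_shift_up] at ih'
    exact .exE (ih σ) ih'

/-- The source of whole families of fresh variables: with `N` above everything in use, `x ↦ N + x`
renames apart and `x ↦ x - N` recovers the old names. -/
theorem exists_forall_lt (X : Finset ℕ) : ∃ N, ∀ x ∈ X, x < N :=
  ⟨X.sup id + 1, fun _ hx => Nat.lt_succ_of_le (Finset.le_sup (f := id) hx)⟩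

theorem subst_shift_eq_bind {φ : IForm L} {w : ℕ} (h : w ∉ φ.fv) :
    φ.subst (bindS w) = φ.subst shiftS := by
  refine IForm.subst_congr fun x hx => ?_
  simp only [bindS, shiftS, if_neg (fun he : x = w => h (he ▸ hx))]

/-! ### Consequences of one formula over a constraint theory -/

/-- Derivability of `ψ` from `φ` and the constraint theory. -/
def Theory.Derives (CT : Theory L) (φ ψ : IForm L) : Prop :=
  IProv (insert φ (CTClause.toI '' CT)) ψ

namespace Theory

variable {CT : Theory L} {φ ψ χ : IForm L}

theorem image_subst (CT : Theory L) (σ : ℕ → L.Term ℕ) :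
    IForm.subst σ '' (CTClause.toI '' CT) = CTClause.toI '' CT := by
  rw [Set.image_image]
  exact Set.image_congr fun α _ => IForm.subst_of_closed (IForm.fv_univ _) σ

theorem Models.derives (h : CT.Models ψ) (φ : IForm L) : CT.Derives φ ψ :=
  h.weaken (Set.subset_insert _ _)

theorem models_imp : CT.Models (.imp φ ψ) ↔ CT.Derives φ ψ :=
  ⟨fun h => .impE (Models.derives h φ) (.hyp (Set.mem_insert _ _)), .impI⟩

theorem Models.subst (h : CT.Models φ) (σ : ℕ → L.Term ℕ) : CT.Models (φ.subst σ) := by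
  have := IProv.subst h σ
  rwa [image_subst] at this

theorem Models.all (h : CT.Models φ) (x : ℕ) : CT.Models (.allV x φ) := by
  refine .allI ?_
  rw [image_subst]
  exact h.subst _

theorem Models.univ (h : CT.Models φ) : CT.Models φ.univ := by
  unfold IForm.univ IForm.alls
  generalize φ.fv.sort = l
  induction l with
  | nil => exact h
  | cons a l ih => exact ih.all a

theorem Models.of_univ (h : CT.Models φ.univ) : CT.Models φ := by
  unfold IForm.univ IForm.alls at h
  generalize φ.fv.sort = l at h
  induction l with
  | nil => exact h
  | cons a l ih =>
    refine ih ?_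
    have := IProv.allE (.var a) h
    rw [IForm.subst_subst, instS_eq_consS, bindS_scomp_consS, Function.update_eq_self,
      IForm.subst_var] at this
    exact this

theorem models_of_mem {α : CTClause L} (h : α ∈ CT) : CT.Models α.toI :=
  .hyp (Set.mem_image_of_mem _ h)

namespace Derives

theorem refl (CT : Theory L) (φ : IForm L) : CT.Derives φ φ := .hyp (Set.mem_insert _ _)

theorem trans (h : CT.Derives φ ψ) (h' : CT.Derives ψ χ) : CT.Derives φ χ :=
  .impE (Models.derives (models_imp.2 h') φ) h

theorem subst (h : CT.Derives φ ψ) (σ : ℕ → L.Term ℕ) :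
    CT.Derives (φ.subst σ) (ψ.subst σ) := by
  have := IProv.subst h σ
  rwa [Set.image_insert_eq, image_subst] at this

theorem and (h : CT.Derives φ ψ) (h' : CT.Derives φ χ) : CT.Derives φ (.and ψ χ) := .andI h h'

theorem fst (CT : Theory L) (φ ψ : IForm L) : CT.Derives (.and φ ψ) φ := .andE₁ (refl _ _)

theorem snd (CT : Theory L) (φ ψ : IForm L) : CT.Derives (.and φ ψ) ψ := .andE₂ (refl _ _)

/-- A variable `w` that occurs nowhere is a generic term: binding `w` again in the derivation for `t
= w` gives the premise of `IProv.exE`. Elimination can thus be argued with arbitrary terms in place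
of shifted contexts. -/
theorem ex_elim (h : ∀ t, CT.Derives (.and χ (φ.subst (instS t))) ψ) :
    CT.Derives (.and χ (.ex φ)) ψ := by
  obtain ⟨w, hw⟩ := Infinite.exists_notMem_finset (χ.fv ∪ (IForm.ex φ).fv ∪ ψ.fv)
  simp only [Finset.mem_union, not_or] at hw
  have key := (h (.var w)).subst (bindS w)
  rw [IForm.subst, subst_shift_eq_bind hw.1.1, subst_shift_eq_bind hw.2, IForm.subst_subst,
    instS_scomp] at key
  have hφ : φ.subst (consS ((Term.var w).subst (bindS w)) (bindS w)) = φ := by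
    conv_rhs => rw [← IForm.subst_var φ]
    refine IForm.subst_congr fun x hx => ?_
    cases x with
    | zero => simp [consS, Term.subst, bindS]
    | succ k =>
      have hk : k ≠ w := fun hk => hw.1.2 (mem_unbind.2 (hk ▸ hx))
      simp [consS, bindS, hk]
  rw [hφ] at key
  refine .exE (.andE₂ (refl _ _)) ?_
  refine .impE (IProv.weaken (models_imp.2 key) ?_) (.andI (.andE₁ (ψ := (IForm.ex φ).subst shiftS)
    (.hyp (Set.mem_insert_of_mem _ ⟨_, Set.mem_insert _ _, rfl⟩))) (.hyp (Set.mem_insert _ _)))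
  rw [Set.image_insert_eq, image_subst]
  exact fun x hx => Set.mem_insert_of_mem _ (Set.mem_insert_of_mem _ hx)

theorem ex_intro (t : L.Term ℕ) : CT.Derives (φ.subst (instS t)) (.ex φ) :=
  .exI t (refl _ _)

theorem exs_intro {X : Finset ℕ} {σ σ' : ℕ → L.Term ℕ} (h : AgreeOff X σ' σ) :
    CT.Derives (φ.subst σ') ((IForm.exs X φ).subst σ) := by
  have key : ∀ (l : List ℕ) σ, AgreeOff l.toFinset σ' σ →
      CT.Derives (φ.subst σ') ((l.foldr IForm.exV φ).subst σ) := by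
    intro l
    induction l with
    | nil =>
      intro σ h
      rw [show σ' = σ from funext fun y => h y (by simp)]
      exact refl _ _
    | cons a l ih =>
      intro σ h
      obtain ⟨t, h⟩ := agreeOff_update_iff.1 h
      refine (ih _ h).trans ?_
      have := ex_intro (CT := CT) (φ := ((l.foldr IForm.exV φ).subst (bindS a)).subst (up σ)) t
      rwa [IForm.subst_subst, up_scomp_instS, IForm.subst_subst, bindS_scomp_consS] at this
  exact key _ σ (by rwa [Finset.sort_toFinset])

theorem exs_elim {X : Finset ℕ} {σ : ℕ → L.Term ℕ}
    (h : ∀ σ', AgreeOff X σ' σ → CT.Derives (.and χ (φ.subst σ')) ψ) :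
    CT.Derives (.and χ ((IForm.exs X φ).subst σ)) ψ := by
  have key : ∀ (l : List ℕ) σ,
      (∀ σ', AgreeOff l.toFinset σ' σ → CT.Derives (.and χ (φ.subst σ')) ψ) →
      CT.Derives (.and χ ((l.foldr IForm.exV φ).subst σ)) ψ := by
    intro l
    induction l with
    | nil => exact fun σ h => h σ (AgreeOff.refl _ _)
    | cons a l ih =>
      intro σ h
      refine ex_elim fun t => ?_
      rw [IForm.subst_subst, up_scomp_instS, IForm.subst_subst, bindS_scomp_consS]
      exact ih _ fun σ' hσ' => h σ' (agreeOff_update_iff.2 ⟨t, hσ'⟩)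
  exact key _ σ (by rwa [Finset.sort_toFinset])

theorem exs_intro_of_fixesOn {X : Finset ℕ} {σ : ℕ → L.Term ℕ} (h : FixesOn (φ.fv \ X) σ) :
    CT.Derives (φ.subst σ) (IForm.exs X φ) := by
  have := exs_intro (CT := CT) (φ := φ) (X := X) (σ' := fun y => if y ∈ X then σ y else .var y)
    (σ := .var) fun y hy => if_neg hy
  rw [IForm.subst_var] at this
  rwa [IForm.subst_congr (τ := fun y => if y ∈ X then σ y else .var y)]
  intro y hy
  split_ifs with hX
  · rfl
  · exact h y (by simp [hy, hX])

theorem exs_elim_of_fv {X : Finset ℕ} (h : CT.Derives φ ψ) (hX : Disjoint X ψ.fv) :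
    CT.Derives (IForm.exs X φ) ψ := by
  have key : CT.Derives (.and .top ((IForm.exs X φ).subst .var)) ψ := by
    refine exs_elim fun σ hσ => (snd _ _ _).trans ?_
    have := h.subst σ
    rwa [IForm.subst_congr (φ := ψ) (τ := .var) fun x hx =>
      hσ x fun hx' => Finset.disjoint_left.1 hX hx' hx, IForm.subst_var] at this
  rw [IForm.subst_var] at key
  exact trans (and .topI (refl _ _)) key

end Derives

theorem derives_atom {B : BuiltinC L} {a : BAtom L} (h : a ∈ B.atoms) :
    CT.Derives (BuiltinC.toI B) a.toI := by
  induction B with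
  | top => simp [Conj.atoms] at h
  | atom b =>
    rw [Conj.atoms, Multiset.mem_singleton] at h
    exact h ▸ Derives.refl _ _
  | and B B' ih ih' =>
    rcases Multiset.mem_add.1 h with h | h
    · exact (Derives.fst _ _ _).trans (ih h)
    · exact (Derives.snd _ _ _).trans (ih' h)

theorem derives_builtin {B : BuiltinC L} (h : ∀ a ∈ B.atoms, CT.Derives φ a.toI) :
    CT.Derives φ (BuiltinC.toI B) := by
  induction B with
  | top => exact .topI
  | atom b => exact h b (by simp [Conj.atoms])
  | and B B' ih ih' =>
    exact .and (ih fun a ha => h a (Multiset.mem_add.2 (.inl ha)))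
      (ih' fun a ha => h a (Multiset.mem_add.2 (.inr ha)))

theorem derives_of_subset {B B' : BuiltinC L} (h : B'.atoms ⊆ B.atoms) :
    CT.Derives (BuiltinC.toI B) (BuiltinC.toI B') :=
  derives_builtin fun _ ha => derives_atom (h ha)

theorem _root_.CHR.Conj.mem_atoms_ofFn {A : Type u} {n : ℕ} {f : Fin n → A} {a : A} :
    a ∈ (Conj.ofFn f).atoms ↔ ∃ i, f i = a := by
  have key : ∀ l : List A, a ∈ (l.foldr (fun a C => Conj.and (.atom a) C) .top).atoms ↔ a ∈ l := by
    intro l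
    induction l with
    | nil => simp [Conj.atoms]
    | cons b l ih => simp [Conj.atoms, ih]
  rw [Conj.ofFn, key, List.mem_ofFn]

section Equality

variable (hEq : CT.HasEquality)
include hEq

theorem derives_eq_symm {s t : L.Term ℕ} (h : CT.Derives φ (.eq s t)) :
    CT.Derives φ (.eq t s) := h.trans (models_imp.1 (hEq.symm s t))

theorem derives_eq_trans {s t r : L.Term ℕ} (h : CT.Derives φ (.eq s t))
    (h' : CT.Derives φ (.eq t r)) : CT.Derives φ (.eq s r) :=
  (h.and h').trans (models_imp.1 (hEq.trans s t r))

theorem derives_term_congr {σ τ : ℕ → L.Term ℕ} (t : L.Term ℕ)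
    (h : ∀ x ∈ t.varFinset, CT.Derives φ (.eq (σ x) (τ x))) :
    CT.Derives φ (.eq (t.subst σ) (t.subst τ)) := by
  induction t with
  | var x => exact h x (by simp)
  | func f ts ih =>
    refine Derives.trans (derives_builtin ?_) (models_imp.1 (hEq.func f _ _))
    intro a ha
    obtain ⟨i, rfl⟩ := Conj.mem_atoms_ofFn.1 ha
    exact ih i fun x hx => h x (by simpa using ⟨i, hx⟩)

theorem derives_atom_congr {σ τ : ℕ → L.Term ℕ} (a : BAtom L)
    (h : ∀ x ∈ a.vars, CT.Derives φ (.eq (σ x) (τ x))) (ha : CT.Derives φ (a.subst σ).toI) :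
    CT.Derives φ (a.subst τ).toI := by
  cases a with
  | falsum => exact ha
  | eq t t' =>
    simp only [BAtom.vars, Finset.mem_union] at h
    exact derives_eq_trans hEq
      (derives_eq_symm hEq (derives_term_congr hEq t fun x hx => h x (.inl hx)))
      (derives_eq_trans hEq ha (derives_term_congr hEq t' fun x hx => h x (.inr hx)))
  | rel r ts =>
    refine Derives.trans (.and (derives_builtin ?_) ha) (models_imp.1 (hEq.rel r _ _))
    intro a ha
    obtain ⟨i, rfl⟩ := Conj.mem_atoms_ofFn.1 ha
    exact derives_term_congr hEq _ fun x hx => h x (by simpa [BAtom.vars] using ⟨i, hx⟩)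

theorem derives_builtin_congr {σ τ : ℕ → L.Term ℕ} (B : BuiltinC L)
    (h : ∀ x ∈ BuiltinC.vars B, CT.Derives φ (.eq (σ x) (τ x)))
    (hB : CT.Derives φ (BuiltinC.toI (BuiltinC.subst σ B))) :
    CT.Derives φ (BuiltinC.toI (BuiltinC.subst τ B)) := by
  refine derives_builtin fun a ha => ?_
  rw [BuiltinC.subst, Conj.atoms_map, Multiset.mem_map] at ha
  obtain ⟨a, ha, rfl⟩ := ha
  refine derives_atom_congr hEq a (fun x hx => h x (BuiltinC.mem_vars.2 ⟨a, ha, hx⟩))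
    (hB.trans (derives_atom ?_))
  rw [BuiltinC.subst, Conj.atoms_map]
  exact Multiset.mem_map_of_mem _ ha

end Equality

end Theory

end Intuitionistic

end CHR

namespace CHR

open FirstOrder.Language (Term)

universe u v w

/-! ### State equivalence -/

section Equivalence

variable {L : FirstOrder.Language.{u, v}} {U : ℕ → Type w}

/-- Each goal is equivalent to the right-nested conjunction of a list of its atoms, and permuted
lists give equivalent goals. Rearranging a goal thus reduces to an equality of multisets. -/
theorem GoalEquiv.of_atoms {G G' : Goal L U} (h : G.atoms = G'.atoms) : GoalEquiv G G' := by
  let toGoal : List (UAtom L U ⊕ BAtom L) → Goal L U :=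
    fun l => l.foldr (fun a C => .and (.atom a) C) .top
  have happ : ∀ l l', GoalEquiv (.and (toGoal l) (toGoal l')) (toGoal (l ++ l')) := by
    intro l l'
    induction l with
    | nil => exact .trans (.comm _ _) (.top _)
    | cons a l ih => exact .trans (.assoc _ _ _) (.congr (.refl _) ih)
  have hflat : ∀ G : Goal L U, ∃ l : List (UAtom L U ⊕ BAtom L), (l : Multiset _) = G.atoms ∧
      GoalEquiv G (toGoal l) := by
    intro G
    induction G with
    | top => exact ⟨[], rfl, .refl _⟩
    | atom a => exact ⟨[a], rfl, .symm (.top _)⟩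
    | and G G' ih ih' =>
      obtain ⟨l, hl, h⟩ := ih
      obtain ⟨l', hl', h'⟩ := ih'
      refine ⟨l ++ l', ?_, .trans (.congr h h') (happ l l')⟩
      rw [Conj.atoms, ← hl, ← hl', Multiset.coe_add]
  have hperm : ∀ {l l' : List (UAtom L U ⊕ BAtom L)}, l.Perm l' →
      GoalEquiv (toGoal l) (toGoal l') := by
    intro l l' h
    induction h with
    | nil => exact .refl _
    | cons a _ ih => exact .congr (.refl _) ih
    | swap a b l =>
      exact .trans (.symm (.assoc _ _ _)) (.trans (.congr (.comm _ _) (.refl _)) (.assoc _ _ _))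
    | trans _ _ ih ih' => exact .trans ih ih'
  obtain ⟨l, hl, hG⟩ := hflat G
  obtain ⟨l', hl', hG'⟩ := hflat G'
  exact .trans hG (.trans (hperm (Multiset.coe_eq_coe.1 (by rw [hl, hl', h]))) (.symm hG'))

/-- Every goal splits into a user-defined and a built-in constraint. -/
theorem Goal.exists_split (G : Goal L U) : ∃ (C : UserC L U) (B : BuiltinC L),
    (∀ σ, Goal.store σ G = (Conj.atoms (UserC.subst σ C), Conj.atoms (BuiltinC.subst σ B))) ∧
      GoalEquiv G (.and (UserC.toGoal C) (BuiltinC.toGoal B)) ∧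
      Goal.vars G = UserC.vars C ∪ BuiltinC.vars B := by
  induction G with
  | top => exact ⟨.top, .top, fun σ => rfl, .of_atoms rfl, rfl⟩
  | atom a =>
    rcases a with a | b
    · exact ⟨.atom a, .top, fun σ => rfl, .of_atoms rfl, (Finset.union_empty _).symm⟩
    · exact ⟨.top, .atom b, fun σ => rfl, .of_atoms rfl, (Finset.empty_union _).symm⟩
  | and G G' ih ih' =>
    obtain ⟨C, B, hs, he, hv⟩ := ih
    obtain ⟨C', B', hs', he', hv'⟩ := ih'
    refine ⟨.and C C', .and B B', fun σ => ?_, .trans (.congr he he') (.of_atoms ?_), ?_⟩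
    · rw [Goal.store, hs, hs']; rfl
    · change _ + _ + (_ + _) = _ + _ + (_ + _)
      exact add_add_add_comm _ _ _ _
    · change Goal.vars G ∪ Goal.vars G' = (UserC.vars C ∪ UserC.vars C') ∪
        (BuiltinC.vars B ∪ BuiltinC.vars B')
      rw [hv, hv', Finset.union_union_union_comm]

theorem vars_mk3 (C : UserC L U) (B : BuiltinC L) (V : Finset ℕ) :
    Goal.vars (State.mk3 C B V).goal = UserC.vars C ∪ BuiltinC.vars B := by
  have h1 : ∀ C : UserC L U, Goal.vars (UserC.toGoal C) = UserC.vars C := by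
    intro C
    induction C with
    | top => rfl
    | atom a => rfl
    | and C D ih ih' => exact congrArg₂ _ ih ih'
  have h2 : ∀ B : BuiltinC L, Goal.vars (BuiltinC.toGoal (U := U) B) = BuiltinC.vars B := by
    intro C
    induction C with
    | top => rfl
    | atom a => rfl
    | and C D ih ih' => exact congrArg₂ _ ih ih'
  exact congrArg₂ _ (h1 C) (h2 B)

theorem Conj.exists_atoms_eq {A : Type u} (m : Multiset A) : ∃ C : Conj A, C.atoms = m := by
  induction m using Multiset.induction with
  | empty => exact ⟨.top, rfl⟩
  | cons a m ih =>
    obtain ⟨C, rfl⟩ := ih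
    exact ⟨.and (.atom a) C, by simp [Conj.atoms]⟩

theorem mem_strictLocals {C : UserC L U} {B : BuiltinC L} {V : Finset ℕ} {x : ℕ} :
    x ∈ strictLocals C B V ↔ x ∈ BuiltinC.vars B ∧ x ∉ V ∧ x ∉ UserC.vars C := by
  simp only [strictLocals, Finset.mem_sdiff, Finset.mem_union]
  tauto

variable {CT : Theory L}

theorem StateEquiv.of_atoms {C C' : UserC L U} {B B' : BuiltinC L} (V : Finset ℕ)
    (hC : C.atoms = C'.atoms) (hB : B.atoms = B'.atoms) :
    StateEquiv CT (.mk3 C B V) (.mk3 C' B' V) := by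
  refine .goal V (.of_atoms ?_)
  simp only [Conj.atoms, UserC.toGoal, BuiltinC.toGoal, Conj.atoms_map, hC, hB]

theorem fv_exs_strictLocals (C : UserC L U) (B : BuiltinC L) (V : Finset ℕ) :
    (IForm.exs (strictLocals C B V) (BuiltinC.toI B)).fv ⊆ V ∪ UserC.vars C := by
  intro x hx
  simp only [IForm.fv_exs, BuiltinC.fv_toI, Finset.mem_sdiff, mem_strictLocals,
    Finset.mem_union] at hx ⊢
  tauto

/-- The conclusion has free variables only in `V` and `C`, where no strictly local variable of the
premise occurs, so the quantifiers of the premise can be stripped. -/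
theorem derives_exs_strictLocals {C : UserC L U} {B B' : BuiltinC L} {V : Finset ℕ}
    (h : CT.Derives (BuiltinC.toI B)
      (.exs (strictLocals C B' V) (BuiltinC.toI B'))) :
    CT.Derives (.exs (strictLocals C B V) (BuiltinC.toI B))
      (.exs (strictLocals C B' V) (BuiltinC.toI B')) := by
  refine .exs_elim_of_fv h (Finset.disjoint_left.2 fun x hx hx' => ?_)
  have := fv_exs_strictLocals C B' V hx'
  simp only [mem_strictLocals, Finset.mem_union] at hx this
  tauto

/-- A substitution that fixes `V` and the variables of `C` moves, among the variables of `B`, only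
strictly local ones, and its values are the witnesses. -/
theorem derives_exs_of_inst {C : UserC L U} {B : BuiltinC L} {V : Finset ℕ} {φ : IForm L}
    {σ : ℕ → L.Term ℕ} (hσ : FixesOn (V ∪ UserC.vars C) σ)
    (h : CT.Derives φ (BuiltinC.toI (BuiltinC.subst σ B))) :
    CT.Derives φ (.exs (strictLocals C B V) (BuiltinC.toI B)) := by
  rw [BuiltinC.toI_subst] at h
  refine h.trans (.exs_intro_of_fixesOn (hσ.mono ?_))
  rw [← IForm.fv_exs]
  exact fv_exs_strictLocals C B V

theorem StateEquiv.of_derives {C : UserC L U} {B B' : BuiltinC L} {V : Finset ℕ}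
    (h : CT.Derives (BuiltinC.toI B) (.exs (strictLocals C B' V) (BuiltinC.toI B')))
    (h' : CT.Derives (BuiltinC.toI B') (.exs (strictLocals C B V) (BuiltinC.toI B))) :
    StateEquiv CT (.mk3 C B V) (.mk3 C B' V) :=
  .applyCT C B B' V (.andI (Theory.models_imp.2 (derives_exs_strictLocals h))
    (Theory.models_imp.2 (derives_exs_strictLocals h')))

theorem StateEquiv.of_inst {C : UserC L U} {B B' : BuiltinC L} {V : Finset ℕ}
    {σ τ : ℕ → L.Term ℕ} (hσ : FixesOn (V ∪ UserC.vars C) σ)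
    (h : CT.Derives (BuiltinC.toI B) (BuiltinC.toI (BuiltinC.subst σ B')))
    (hτ : FixesOn (V ∪ UserC.vars C) τ)
    (h' : CT.Derives (BuiltinC.toI B') (BuiltinC.toI (BuiltinC.subst τ B))) :
    StateEquiv CT (.mk3 C B V) (.mk3 C B' V) :=
  .of_derives (derives_exs_of_inst hσ h) (derives_exs_of_inst hτ h')

theorem StateEquiv.of_equivalent {B B' : BuiltinC L} (C : UserC L U) (V : Finset ℕ)
    (h : CT.Derives (BuiltinC.toI B) (BuiltinC.toI B'))
    (h' : CT.Derives (BuiltinC.toI B') (BuiltinC.toI B)) :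
    StateEquiv CT (.mk3 C B V) (.mk3 C B' V) :=
  .of_inst (fixesOn_var _) (by rwa [BuiltinC.subst_var]) (fixesOn_var _)
    (by rwa [BuiltinC.subst_var])

theorem Entails.of_derives {B B' : BuiltinC L} (C : UserC L U) (V : Finset ℕ)
    (h : CT.Derives (BuiltinC.toI B) (BuiltinC.toI B')) :
    Entails CT ((State.mk3 C B V).cls CT) ((State.mk3 C B' V).cls CT) :=
  .weaken C B B' V (Theory.models_imp.2 (derives_exs_strictLocals
    (derives_exs_of_inst (fixesOn_var _) (by rwa [BuiltinC.subst_var])))).univ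

theorem Entails.of_equiv {S T : State L U} (h : StateEquiv CT S T) :
    Entails CT (S.cls CT) (T.cls CT) := by
  have : S.cls CT = T.cls CT := Quotient.sound h
  rw [this]
  exact .refl _

theorem Entails.of_subset_globals (C : UserC L U) (B : BuiltinC L) {V V' : Finset ℕ}
    (h : V' ⊆ V) : Entails CT ((State.mk3 C B V).cls CT) ((State.mk3 C B V').cls CT) := by
  have key : ∀ X : Finset ℕ,
      Entails CT ((State.mk3 C B (X ∪ V')).cls CT) ((State.mk3 C B V').cls CT) := by
    intro X
    induction X using Finset.induction with
    | empty => rw [Finset.empty_union]; exact .refl _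
    | insert x X _ ih =>
      rw [Finset.insert_union]
      exact .trans (.omitVar _ _ _ _) ih
  have := key V
  rwa [Finset.union_eq_left.2 h] at this

theorem StateEquiv.union_globals (G : Goal L U) (X V : Finset ℕ)
    (h : Disjoint X (Goal.vars G)) : StateEquiv CT ⟨G, X ∪ V⟩ ⟨G, V⟩ := by
  induction X using Finset.induction with
  | empty => rw [Finset.empty_union]; exact .refl _
  | insert x X _ ih =>
    rw [Finset.disjoint_insert_left] at h
    rw [Finset.insert_union]
    exact .trans (.redundant _ _ _ h.1) (ih h.2)

/-! ### Elimination, replacement and renaming by means of equations -/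

theorem single_self (x : ℕ) (t : L.Term ℕ) : single x t x = t := Function.update_self _ _ _

theorem single_of_ne {x y : ℕ} (h : y ≠ x) (t : L.Term ℕ) : single x t y = .var y :=
  Function.update_of_ne h _ _

theorem fixesOn_single {x : ℕ} {X : Finset ℕ} (h : x ∉ X) (t : L.Term ℕ) :
    FixesOn X (single x t) := fun y hy => single_of_ne (fun he => h (by rwa [← he])) t

/-- The constraint `x₁ ≐ σ(x₁) ∧ … ∧ xₙ ≐ σ(xₙ) ∧ B`. -/
def eqs (σ : ℕ → L.Term ℕ) (l : List ℕ) (B : BuiltinC L) : BuiltinC L :=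
  l.foldr (fun x B => .and (.atom (.eq (.var x) (σ x))) B) B

theorem mem_atoms_eqs {σ : ℕ → L.Term ℕ} {l : List ℕ} {B : BuiltinC L} {a : BAtom L} :
    a ∈ (eqs σ l B).atoms ↔ (∃ x ∈ l, a = .eq (.var x) (σ x)) ∨ a ∈ B.atoms := by
  induction l with
  | nil => simp [eqs]
  | cons x l ih =>
    change a ∈ {_} + (eqs σ l B).atoms ↔ _
    simp [ih, or_assoc]

theorem mem_vars_eqs {σ : ℕ → L.Term ℕ} {l : List ℕ} {B : BuiltinC L} {y : ℕ} :
    y ∈ BuiltinC.vars (eqs σ l B) ↔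
      (∃ x ∈ l, y = x ∨ y ∈ (σ x).varFinset) ∨ y ∈ BuiltinC.vars B := by
  simp only [BuiltinC.mem_vars, mem_atoms_eqs]
  constructor
  · rintro ⟨a, ⟨x, hx, rfl⟩ | h, hy⟩
    · exact .inl ⟨x, hx, by simpa [BAtom.vars] using hy⟩
    · exact .inr ⟨a, h, hy⟩
  · rintro (⟨x, hx, hy⟩ | ⟨a, h, hy⟩)
    · exact ⟨_, .inl ⟨x, hx, rfl⟩, by simpa [BAtom.vars] using hy⟩
    · exact ⟨a, .inr h, hy⟩

theorem derives_eqs {σ : ℕ → L.Term ℕ} {l : List ℕ} {B : BuiltinC L} {x : ℕ} (hx : x ∈ l) :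
    CT.Derives (BuiltinC.toI (eqs σ l B)) (.eq (.var x) (σ x)) :=
  Theory.derives_atom (a := .eq (.var x) (σ x)) (mem_atoms_eqs.2 (.inl ⟨x, hx, rfl⟩))

theorem derives_eqs_tail {σ : ℕ → L.Term ℕ} {l : List ℕ} {B : BuiltinC L} :
    CT.Derives (BuiltinC.toI (eqs σ l B)) (BuiltinC.toI B) :=
  Theory.derives_of_subset fun _ ha => mem_atoms_eqs.2 (.inr ha)

section Equality

variable (hEq : CT.HasEquality)
include hEq

/-- A local variable may be eliminated by an equation for it. -/
theorem StateEquiv.elim_single (C : UserC L U) {x : ℕ} {t : L.Term ℕ} {B : BuiltinC L}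
    {V : Finset ℕ} (hV : x ∉ V) (hB : x ∉ BuiltinC.vars B) (ht : x ∉ t.varFinset) :
    StateEquiv CT (.mk3 C (.and (.atom (.eq (.var x) t)) B) V)
      (.mk3 (UserC.subst (single x t) C) B V) := by
  -- After the substitution, `x` occurs only in its own equation, hence is strictly local; the value
  -- `t` makes the equation an instance of reflexivity.
  refine .trans (.subst C x t B V) (.of_inst (fixesOn_var _) ?_ (τ := single x t)
    (fixesOn_single ?_ t) ?_)
  · rw [BuiltinC.subst_var]; exact .snd _ _ _
  · simp only [Finset.mem_union, hV, false_or, UserC.mem_vars_subst, not_exists, not_and]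
    intro y _ hxy
    by_cases h : y = x
    · subst h; rw [single_self] at hxy; exact ht hxy
    · rw [single_of_ne h] at hxy
      exact h (Finset.mem_singleton.1 hxy).symm
  · refine .and ?_ ?_
    · have : t.subst (single x t) = t := by
        rw [term_subst_congr (fixesOn_single ht t), term_subst_var]
      change CT.Derives _ (.eq (single x t x) (t.subst (single x t)))
      rw [single_self, this]
      exact (hEq.refl t).derives _
    · have := BuiltinC.subst_of_fixesOn (fixesOn_single hB t)
      rw [BuiltinC.subst] at this
      rw [this]
      exact .refl _ _

/-- Local variables may be eliminated by equations for them. -/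
theorem StateEquiv.elim_eqs (C : UserC L U) {σ : ℕ → L.Term ℕ} {l : List ℕ} {B : BuiltinC L}
    {V : Finset ℕ} (hl : l.Nodup)
    (h : ∀ x ∈ l, x ∉ V ∧ x ∉ BuiltinC.vars B ∧ ∀ y ∈ l, x ∉ (σ y).varFinset) :
    StateEquiv CT (.mk3 C (eqs σ l B) V)
      (.mk3 (UserC.subst (fun x => if x ∈ l then σ x else .var x) C) B V) := by
  induction l generalizing C with
  | nil =>
    simp only [List.not_mem_nil, if_false]
    rw [show (fun x => Term.var x : ℕ → L.Term ℕ) = Term.var from rfl, UserC.subst_var]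
    exact .refl _
  | cons a l ih =>
    rw [List.nodup_cons] at hl
    obtain ⟨haV, haB, haσ⟩ := h a (by simp)
    refine .trans (elim_single hEq C haV ?_ (haσ a (by simp))) ?_
    · change a ∉ BuiltinC.vars (eqs σ l B)
      rw [mem_vars_eqs]
      rintro (⟨x, hx, rfl | hax⟩ | h)
      · exact hl.1 hx
      · exact haσ x (by simp [hx]) hax
      · exact haB h
    · refine .trans (ih _ hl.2 fun x hx => ?_) ?_
      · obtain ⟨h1, h2, h3⟩ := h x (by simp [hx])
        exact ⟨h1, h2, fun y hy => h3 y (by simp [hy])⟩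
      -- Successive substitution equals simultaneous substitution, because no value `σ y` contains
      -- an eliminated variable.
      · rw [UserC.subst_subst]
        convert StateEquiv.refl _ using 3
        funext x
        by_cases hx : x = a
        · subst hx
          simp only [List.mem_cons, true_or, if_true, scomp, single_self]
          conv_lhs => rw [← term_subst_var (σ x)]
          refine term_subst_congr fun y hy => (if_neg fun hyl => ?_).symm
          exact (h y (by simp [hyl])).2.2 x (by simp) hy
        · simp [hx, scomp, single_of_ne hx, Term.subst]

/-- Equal terms may be exchanged in the user-defined constraint. -/
theorem StateEquiv.replace (D : UserC L U) {x : ℕ} {s t : L.Term ℕ} {B : BuiltinC L}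
    {V : Finset ℕ} (hV : x ∉ V) (hB : x ∉ BuiltinC.vars B) (hs : x ∉ s.varFinset)
    (ht : x ∉ t.varFinset) (h : CT.Derives (BuiltinC.toI B) (.eq s t)) :
    StateEquiv CT (.mk3 (UserC.subst (single x s) D) B V)
      (.mk3 (UserC.subst (single x t) D) B V) := by
  -- Elimination read backwards introduces `x ≐ s`; over `B` this is equivalent to `x ≐ t`, which is
  -- then eliminated.
  refine .trans (.symm (elim_single hEq D hV hB hs)) (.trans ?_ (elim_single hEq D hV hB ht))
  refine .of_equivalent _ _ ?_ ?_
  · exact .and (Theory.derives_eq_trans hEq (.fst _ _ _) ((Theory.Derives.snd _ _ _).trans h))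
      (.snd _ _ _)
  · exact .and (Theory.derives_eq_trans hEq (.fst _ _ _)
      (Theory.derives_eq_symm hEq ((Theory.Derives.snd _ _ _).trans h))) (.snd _ _ _)

/-- The renaming of the variables in `F` by `x ↦ N + x`. -/
def _root_.CHR.shiftOn (L : FirstOrder.Language.{u, v}) (N : ℕ) (F : Finset ℕ) : ℕ → L.Term ℕ :=
  fun x => if x ∈ F then .var (N + x) else .var x

omit hEq in
theorem _root_.CHR.mem_vars_shiftOn {N : ℕ} {F : Finset ℕ} {x y : ℕ} :
    y ∈ (shiftOn L N F x).varFinset ↔ (x ∈ F ∧ y = N + x) ∨ (x ∉ F ∧ y = x) := by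
  unfold shiftOn
  split_ifs with h <;> simp [h]

/-- Local variables may be renamed. -/
theorem StateEquiv.rename (C : UserC L U) (B : BuiltinC L) (V F : Finset ℕ) {N : ℕ}
    (hN : ∀ x ∈ V ∪ F ∪ UserC.vars C ∪ BuiltinC.vars B, x < N) (hF : Disjoint F V) :
    StateEquiv CT (.mk3 C B V)
      (.mk3 (UserC.subst (shiftOn L N F) C) (BuiltinC.subst (shiftOn L N F) B) V) := by
  simp only [Finset.mem_union, or_imp, forall_and] at hN
  obtain ⟨⟨⟨hNV, hNF⟩, hNC⟩, hNB⟩ := hN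
  let l := F.sort.map (N + ·)
  have hl : ∀ {x}, x ∈ l ↔ ∃ y ∈ F, N + y = x := by simp [l]
  -- Eliminating the equations `N + y ≐ y` for `y ∈ F` turns the renamed user-defined constraint
  -- back into `C`.
  let κ : ℕ → L.Term ℕ := fun x => .var (x - N)
  have h1 : StateEquiv CT (.mk3 (UserC.subst (shiftOn L N F) C) (eqs κ l B) V) (.mk3 C B V) := by
    refine .trans (elim_eqs hEq _ ?_ ?_) ?_
    · exact (Finset.sort_nodup F _).map fun a b h => Nat.add_left_cancel h
    · intro x hx
      obtain ⟨y, hy, rfl⟩ := hl.1 hx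
      refine ⟨fun h => ?_, fun h => ?_, fun z hz h => ?_⟩
      · have := hNV _ h; omega
      · have := hNB _ h; omega
      · obtain ⟨z, hzF, rfl⟩ := hl.1 hz
        have := hNF _ hzF
        simp only [κ, Term.varFinset, Finset.mem_singleton] at h
        omega
    · rw [UserC.subst_subst]
      convert StateEquiv.refl _ using 2
      refine ((UserC.subst_congr (τ := .var) fun x hx => ?_).trans (UserC.subst_var C)).symm
      by_cases hxF : x ∈ F
      · have : N + x ∈ l := hl.2 ⟨x, hxF, rfl⟩
        simp [scomp, shiftOn, hxF, Term.subst, this, κ]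
      · have : x ∉ l := fun h => by
          obtain ⟨y, hy, rfl⟩ := hl.1 h
          have := hNC _ hx
          omega
        simp [scomp, shiftOn, hxF, Term.subst, this]
  -- Next to the renamed user-defined constraint, the old names in `F` are no longer protected, and
  -- their new names witness them: each equation `N + y ≐ y` becomes `N + y ≐ N + y`.
  refine .trans (.symm h1) (.of_inst (fixesOn_var _) ?_ (τ := shiftOn L N F) ?_ ?_)
  · rw [BuiltinC.subst_var]
    refine Theory.derives_builtin_congr hEq (σ := .var) B (fun x hx => ?_) ?_
    · by_cases hxF : x ∈ F
      · have := derives_eqs (CT := CT) (σ := κ) (l := l) (B := B) (hl.2 ⟨x, hxF, rfl⟩)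
        simp only [shiftOn, hxF, if_true]
        refine Theory.derives_eq_symm hEq ?_
        simpa [κ] using this
      · simp only [shiftOn, hxF, if_false]
        exact (hEq.refl _).derives _
    · rw [BuiltinC.subst_var]
      exact derives_eqs_tail
  · intro x hx
    have : x ∉ F := by
      rcases Finset.mem_union.1 hx with hx | hx
      · exact fun h => Finset.disjoint_left.1 hF h hx
      · obtain ⟨y, hy, h⟩ := UserC.mem_vars_subst.1 hx
        rcases mem_vars_shiftOn.1 h with ⟨_, rfl⟩ | ⟨hyF, rfl⟩
        · intro h; have := hNF _ h; omega
        · exact hyF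
    simp [shiftOn, this]
  · refine Theory.derives_builtin fun a ha => ?_
    rw [BuiltinC.subst, Conj.atoms_map, Multiset.mem_map] at ha
    obtain ⟨a, ha, rfl⟩ := ha
    rcases mem_atoms_eqs.1 ha with ⟨x, hx, rfl⟩ | ha
    · obtain ⟨y, hy, rfl⟩ := hl.1 hx
      have hyF : N + y ∉ F := fun h => by have := hNF _ h; omega
      simp only [BAtom.subst, Term.subst, κ, BAtom.toI, shiftOn, hyF, if_false,
        Nat.add_sub_cancel_left, hy, if_true]
      exact (hEq.refl _).derives _
    · refine Theory.derives_atom ?_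
      rw [BuiltinC.subst, Conj.atoms_map]
      exact Multiset.mem_map_of_mem _ ha

/-- A state is entailed by its instances. -/
theorem Entails.of_instance (C : UserC L U) (B D : BuiltinC L) (V : Finset ℕ)
    {σ : ℕ → L.Term ℕ} (hσ : FixesOn V σ)
    (h : CT.Derives (BuiltinC.toI D) (BuiltinC.toI (BuiltinC.subst σ B))) :
    Entails CT ((State.mk3 (UserC.subst σ C) D V).cls CT) ((State.mk3 C B V).cls CT) := by
  let F := (UserC.vars C ∪ BuiltinC.vars B) \ V
  obtain ⟨N, hN⟩ := exists_forall_lt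
    (V ∪ F ∪ UserC.vars C ∪ BuiltinC.vars B ∪ BuiltinC.vars D ∪
      F.biUnion fun x => (σ x).varFinset)
  simp only [Finset.mem_union (s := V ∪ F ∪ UserC.vars C ∪ BuiltinC.vars B ∪ BuiltinC.vars D),
    Finset.mem_union (s := V ∪ F ∪ UserC.vars C ∪ BuiltinC.vars B), or_imp, forall_and] at hN
  obtain ⟨⟨hN, hND⟩, hNσ⟩ := hN
  have hNσ : ∀ x ∈ F, ∀ y ∈ (σ x).varFinset, y < N := fun x hx y hy =>
    hNσ y (Finset.mem_biUnion.2 ⟨x, hx, hy⟩)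
  have hFV : Disjoint F V := Finset.sdiff_disjoint
  -- Values of `σ` may contain the local variables `F` themselves, so these are renamed apart first.
  -- The instance then arises by eliminating the equations `N + y ≐ σ y`, which in turn imply the
  -- renamed store `B`.
  refine .trans ?_ (.of_equiv (.symm (.rename hEq C B V F hN hFV)))
  simp only [Finset.mem_union, or_imp, forall_and] at hN
  obtain ⟨⟨⟨hNV, hNF⟩, hNC⟩, hNB⟩ := hN
  have hσF : ∀ x, x ∈ UserC.vars C ∪ BuiltinC.vars B → x ∉ F → σ x = .var x := by
    intro x hx hxF
    refine hσ x ?_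
    by_contra hxV
    exact hxF (Finset.mem_sdiff.2 ⟨hx, hxV⟩)
  let l := F.sort.map (N + ·)
  have hl : ∀ {x}, x ∈ l ↔ ∃ y ∈ F, N + y = x := by simp [l]
  let κ : ℕ → L.Term ℕ := fun x => σ (x - N)
  have h1 : StateEquiv CT (.mk3 (UserC.subst (shiftOn L N F) C) (eqs κ l D) V)
      (.mk3 (UserC.subst σ C) D V) := by
    refine .trans (.elim_eqs hEq _ ?_ ?_) ?_
    · exact (Finset.sort_nodup F _).map fun a b h => Nat.add_left_cancel h
    · intro x hx
      obtain ⟨y, hy, rfl⟩ := hl.1 hx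
      refine ⟨fun h => ?_, fun h => ?_, fun z hz h => ?_⟩
      · have := hNV _ h; omega
      · have := hND _ h; omega
      · obtain ⟨z, hzF, rfl⟩ := hl.1 hz
        simp only [κ, Nat.add_sub_cancel_left] at h
        have := hNσ _ hzF _ h
        omega
    · rw [UserC.subst_subst]
      convert StateEquiv.refl _ using 2
      refine UserC.subst_congr fun x hx => ?_
      by_cases hxF : x ∈ F
      · have : N + x ∈ l := hl.2 ⟨x, hxF, rfl⟩
        simp [scomp, shiftOn, hxF, Term.subst, this, κ]
      · have : x ∉ l := fun h => by
          obtain ⟨y, hy, rfl⟩ := hl.1 h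
          have := hNC _ hx
          omega
        simp [scomp, shiftOn, hxF, Term.subst, this, hσF x (Finset.mem_union_left _ hx) hxF]
  refine .trans (.of_equiv (.symm h1)) (.of_derives _ _ ?_)
  refine Theory.derives_builtin_congr hEq (σ := σ) B (fun x hx => ?_) (derives_eqs_tail.trans h)
  by_cases hxF : x ∈ F
  · have := derives_eqs (CT := CT) (σ := κ) (l := l) (B := D) (hl.2 ⟨x, hxF, rfl⟩)
    simp only [shiftOn, hxF, if_true]
    refine Theory.derives_eq_symm hEq ?_
    simpa [κ] using this
  · simp only [shiftOn, hxF, if_false, hσF x (Finset.mem_union_right _ hx) hxF]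
    exact (hEq.refl _).derives _

end Equality

end Equivalence

end CHR

namespace CHR

open FirstOrder.Language (Term)

universe u v w

/-! ### From reachability of stores to transitions -/

section Transitions

variable {L : FirstOrder.Language.{u, v}} {U : ℕ → Type w} {CT : Theory L} {P : Set (Rule L U)}

theorem State.exists_mk3 (T : State L U) : ∃ (C : UserC L U) (B : BuiltinC L),
    (∀ σ, Goal.store σ T.goal =
      (Conj.atoms (UserC.subst σ C), Conj.atoms (BuiltinC.subst σ B))) ∧
      StateEquiv CT T (.mk3 C B T.globals) ∧
      Goal.vars T.goal = UserC.vars C ∪ BuiltinC.vars B := by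
  obtain ⟨C, B, h1, h2, h3⟩ := Goal.exists_split T.goal
  exact ⟨C, B, h1, .goal _ h2, h3⟩

theorem derives_eqs_of {φ : IForm L} {σ : ℕ → L.Term ℕ} {l : List ℕ} {B : BuiltinC L}
    (h : ∀ x ∈ l, CT.Derives φ (.eq (.var x) (σ x))) (hB : CT.Derives φ (BuiltinC.toI B)) :
    CT.Derives φ (BuiltinC.toI (eqs σ l B)) := by
  refine Theory.derives_builtin fun a ha => ?_
  rcases mem_atoms_eqs.1 ha with ⟨x, hx, rfl⟩ | ha
  · exact h x hx
  · exact hB.trans (Theory.derives_atom ha)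

theorem StateEquiv.of_unsatisfiable {B : BuiltinC L} (h : CT.Models (BuiltinC.toI B).exCl.neg)
    (C : UserC L U) (V : Finset ℕ) :
    StateEquiv CT (.mk3 C B V) (.mk3 C (.atom .falsum) V) := by
  have hB : CT.Derives (BuiltinC.toI B) .bot := by
    have h1 := Theory.Derives.exs_intro (CT := CT) (φ := BuiltinC.toI B)
      (X := (BuiltinC.toI B).fv) (AgreeOff.refl _ Term.var)
    rw [IForm.subst_var, IForm.subst_var] at h1
    exact h1.trans (Theory.models_imp.1 h)
  exact .of_equivalent _ _ hB (.botE (Theory.Derives.refl _ _))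

/-- The constraint `exs X B` may be replaced by an instance with fresh variables if it follows
from the built-in store. -/
theorem StateEquiv.exists_witness {X : Finset ℕ} {B D : BuiltinC L} {σ : ℕ → L.Term ℕ}
    (h : CT.Derives (BuiltinC.toI D) ((IForm.exs X (BuiltinC.toI B)).subst σ))
    (C : UserC L U) (V : Finset ℕ) :
    ∃ σ', AgreeOff X σ' σ ∧
      StateEquiv CT (.mk3 C D V) (.mk3 C (.and (BuiltinC.subst σ' B) D) V) := by
  obtain ⟨N, hN⟩ := exists_forall_lt
    (V ∪ UserC.vars C ∪ BuiltinC.vars D ∪ (BuiltinC.vars B).biUnion fun x => (σ x).varFinset)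
  simp only [Finset.mem_union, or_imp, forall_and, Finset.mem_biUnion] at hN
  obtain ⟨⟨⟨hNV, hNC⟩, hND⟩, hNσ⟩ := hN
  refine ⟨fun y => if y ∈ X then .var (N + y) else σ y, fun y hy => if_neg hy,
    .of_derives ?_ ?_⟩
  · refine ((Theory.Derives.refl _ _).and h).trans (.exs_elim fun τ hτ => ?_)
    -- `κ` gives the fresh variables `N + y` the values of the witnesses `τ`, and it fixes all
    -- variables below `N`.
    let κ : ℕ → L.Term ℕ := fun z => if N ≤ z then τ (z - N) else .var z
    have hκ : ∀ z, z < N → κ z = .var z := fun z hz => if_neg (by omega)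
    refine derives_exs_of_inst (σ := κ) ?_ (.and ?_ ?_)
    · intro z hz
      rcases Finset.mem_union.1 hz with hz | hz
      · exact hκ z (hNV z hz)
      · exact hκ z (hNC z hz)
    · change CT.Derives _ (BuiltinC.toI (BuiltinC.subst κ (BuiltinC.subst _ B)))
      have e : BuiltinC.subst (scomp (fun y => if y ∈ X then .var (N + y) else σ y) κ) B =
          BuiltinC.subst τ B := by
        refine BuiltinC.subst_congr fun y hy => ?_
        by_cases hyX : y ∈ X
        · simp [scomp, hyX, Term.subst, κ]
        · simp only [scomp, hyX, if_false]
          rw [hτ y hyX, term_subst_congr (τ := .var), term_subst_var]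
          exact fun z hz => hκ z (hNσ z ⟨y, hy, hz⟩)
      rw [BuiltinC.subst_subst, ← BuiltinC.toI_subst, e]
      exact .snd _ _ _
    · change CT.Derives _ (BuiltinC.toI (BuiltinC.subst κ D))
      rw [BuiltinC.subst_of_fixesOn fun z hz => hκ z (hND z hz)]
      exact .fst _ _ _
  · refine derives_exs_of_inst (fixesOn_var _) ?_
    rw [BuiltinC.subst_var]
    exact .snd _ _ _

theorem Rule.vars_eq (R : Rule L U) : R.vars = R.headVars ∪ R.localVars := by
  ext x
  simp only [Rule.vars, Rule.localVars, Finset.mem_union, Finset.mem_sdiff]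
  tauto

theorem mem_vars_user_rename {ρ : ℕ → ℕ} {C : UserC L U} {z : ℕ} :
    z ∈ UserC.vars (UserC.subst (fun x => .var (ρ x)) C) ↔ ∃ x ∈ UserC.vars C, z = ρ x := by
  simp [UserC.mem_vars_subst]

theorem mem_vars_builtin_rename {ρ : ℕ → ℕ} {B : BuiltinC L} {z : ℕ} :
    z ∈ BuiltinC.vars (BuiltinC.subst (fun x => .var (ρ x)) B) ↔
      ∃ x ∈ BuiltinC.vars B, z = ρ x := by
  simp [BuiltinC.mem_vars_subst]

theorem Rule.mem_headVars_rename {R : Rule L U} {ρ : ℕ → ℕ} {z : ℕ} :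
    z ∈ (R.rename ρ).headVars ↔ ∃ x ∈ R.headVars, z = ρ x := by
  simp only [Rule.headVars, Rule.rename, Finset.mem_union, mem_vars_user_rename, or_and_right,
    exists_or]

theorem Rule.exists_of_mem_localVars_rename {R : Rule L U} {ρ : ℕ → ℕ} {z : ℕ}
    (h : z ∈ (R.rename ρ).localVars) : ∃ x ∈ R.localVars, z = ρ x := by
  simp only [Rule.localVars, Finset.mem_sdiff, Rule.mem_headVars_rename] at h ⊢
  simp only [Rule.rename, Finset.mem_union, mem_vars_user_rename, mem_vars_builtin_rename] at h ⊢
  obtain ⟨(⟨x, hx, rfl⟩ | ⟨x, hx, rfl⟩) | ⟨x, hx, rfl⟩, hz⟩ := h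
  · exact ⟨x, ⟨.inl (.inl hx), fun h => hz ⟨x, h, rfl⟩⟩, rfl⟩
  · exact ⟨x, ⟨.inl (.inr hx), fun h => hz ⟨x, h, rfl⟩⟩, rfl⟩
  · exact ⟨x, ⟨.inr hx, fun h => hz ⟨x, h, rfl⟩⟩, rfl⟩

/-- An instance of a rule whose guard is satisfied can be applied, unless the state is failed. -/
theorem Step.of_instance (hEq : CT.HasEquality) (hCompl : CT.IsComplete) {R : Rule L U}
    (hR : R ∈ P) {σ : ℕ → L.Term ℕ} {B : BuiltinC L}
    (hG : Conj.atoms (BuiltinC.subst σ R.guard) ⊆ B.atoms) (C : UserC L U) (V : Finset ℕ) :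
    (∃ C', StateEquiv CT
      (.mk3 (.and (.and (UserC.subst σ R.kept) (UserC.subst σ R.removed)) C) B V)
      (.mk3 C' (.atom .falsum) V)) ∨
    ∃ σ', AgreeOff R.localVars σ' σ ∧ Step CT P
      ((State.mk3 (.and (.and (UserC.subst σ R.kept) (UserC.subst σ R.removed)) C) B V).cls CT)
      ((State.mk3 (.and (.and (UserC.subst σ R.kept) (UserC.subst σ' R.bodyU)) C)
        (.and (.and (BuiltinC.subst σ' R.bodyB) (BuiltinC.subst σ' R.guard)) B) V).cls CT) := by
  obtain ⟨N, hN⟩ := exists_forall_lt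
    (V ∪ UserC.vars C ∪ BuiltinC.vars B ∪ R.vars.biUnion fun x => (σ x).varFinset)
  simp only [Finset.mem_union, or_imp, forall_and] at hN
  obtain ⟨⟨⟨hNV, hNC⟩, hNB⟩, hNσ⟩ := hN
  have hNσ : ∀ x ∈ R.vars, ∀ y ∈ (σ x).varFinset, y < N := fun x hx y hy =>
    hNσ y (Finset.mem_biUnion.2 ⟨x, hx, hy⟩)
  have hdisj : ∀ x ∈ R.headVars, x ∉ R.localVars := fun x hx h => (Finset.mem_sdiff.1 h).2 hx
  have hhead : ∀ x ∈ R.headVars, x ∈ R.vars := fun x hx => by simp [Rule.vars_eq, hx]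
  have hlocal : ∀ x ∈ R.localVars, x ∈ R.vars := fun x hx => by simp [Rule.vars_eq, hx]
  have hcases : ∀ x ∈ R.vars, x ∈ R.headVars ∨ x ∈ R.localVars := fun x hx => by
    simpa [Rule.vars_eq] using hx
  have hkept : ∀ x ∈ UserC.vars R.kept, x ∈ R.headVars := fun x hx => by simp [Rule.headVars, hx]
  have hremoved : ∀ x ∈ UserC.vars R.removed, x ∈ R.headVars := fun x hx => by
    simp [Rule.headVars, hx]
  have hbodyU : ∀ x ∈ UserC.vars R.bodyU, x ∈ R.vars := fun x hx => by simp [Rule.vars, hx]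
  have hbodyB : ∀ x ∈ BuiltinC.vars R.bodyB, x ∈ R.vars := fun x hx => by simp [Rule.vars, hx]
  have hguard : ∀ x ∈ BuiltinC.vars R.guard, x ∈ R.vars := fun x hx => by simp [Rule.vars, hx]
  -- In the variant `R'`, a head variable `N + x` is tied to `σ x` by an equation and can be
  -- eliminated afterwards. A local variable `N + x` carries no equation and survives as the value
  -- of `x` under `σ'`.
  let ρ : ℕ → L.Term ℕ := fun x => .var (N + x)
  let R' := R.rename (N + ·)
  let l := R.headVars.sort.map (N + ·)
  have hl : ∀ {x}, x ∈ l ↔ ∃ y ∈ R.headVars, N + y = x := by simp [l]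
  have hlnd : l.Nodup := (Finset.sort_nodup _ _).map fun a b h => Nat.add_left_cancel h
  let κ : ℕ → L.Term ℕ := fun x => σ (x - N)
  have hκ : ∀ x, κ (N + x) = σ x := fun x => by simp [κ]
  let σ' : ℕ → L.Term ℕ := fun x => if x ∈ R.localVars then .var (N + x) else σ x
  have hσ' : AgreeOff R.localVars σ' σ := fun y hy => if_neg hy
  have hσ'_head : ∀ x ∈ R.headVars, σ' x = σ x := fun x hx => hσ' x (hdisj x hx)
  have hσ'_local : ∀ x ∈ R.localVars, σ' x = .var (N + x) := fun x hx => if_pos hx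
  let κl : ℕ → L.Term ℕ := fun x => if x ∈ l then κ x else .var x
  have hinst : ∀ D : UserC L U, (∀ x ∈ UserC.vars D, x ∈ R.vars) →
      UserC.subst κl (UserC.subst ρ D) = UserC.subst σ' D := by
    intro D hD
    rw [UserC.subst_subst]
    refine UserC.subst_congr fun x hx => ?_
    change κl (N + x) = σ' x
    rcases hcases x (hD x hx) with h | h
    · rw [hσ'_head x h, ← hκ x]
      exact if_pos (hl.2 ⟨x, h, rfl⟩)
    · rw [hσ'_local x h]
      refine if_neg fun hxl => ?_
      obtain ⟨y, hy, hyx⟩ := hl.1 hxl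
      obtain rfl : y = x := by omega
      exact hdisj y hy h
  have hheadinst : ∀ D : UserC L U, (∀ x ∈ UserC.vars D, x ∈ R.headVars) →
      UserC.subst σ' D = UserC.subst σ D := fun D hD =>
    UserC.subst_congr fun x hx => hσ'_head x (hD x hx)
  have hCfix : UserC.subst κl C = C := by
    refine UserC.subst_of_fixesOn fun x hx => if_neg fun hxl => ?_
    obtain ⟨y, hy, rfl⟩ := hl.1 hxl
    have := hNC _ hx
    omega
  have hcongr : ∀ {φ : IForm L}, (∀ x ∈ l, CT.Derives φ (.eq (.var x) (κ x))) →
      ∀ x ∈ R.vars, CT.Derives φ (.eq (ρ x) (σ' x)) := by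
    intro φ hφ x hx
    rcases hcases x hx with h | h
    · have := hφ (N + x) (hl.2 ⟨x, h, rfl⟩)
      rwa [hκ, ← hσ'_head x h] at this
    · rw [hσ'_local x h]
      exact (hEq.refl _).derives _
  -- the state before the transition
  have hpre : StateEquiv CT
      (.mk3 (.and (.and (UserC.subst σ R.kept) (UserC.subst σ R.removed)) C) B V)
      (.mk3 (.and (.and R'.kept R'.removed) C) (.and R'.guard (eqs κ l B)) V) := by
    -- The guard of the variant can be added to the store: its local variables are strictly local at
    -- this point, and their values under `σ` are witnesses because that instance of the guard is
    -- part of `B`.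
    refine .trans (.symm ?_) (.of_inst (B := eqs κ l B)
      (σ := fun z => if N ≤ z ∧ z - N ∈ R.localVars then σ (z - N) else .var z) ?_ (.and ?_ ?_)
      (fixesOn_var _) ?_)
    · have h1 := StateEquiv.elim_eqs hEq (.and (.and R'.kept R'.removed) C) (σ := κ) (B := B)
        (V := V) hlnd (by
          intro x hx
          obtain ⟨y, hy, rfl⟩ := hl.1 hx
          refine ⟨fun h => ?_, fun h => ?_, fun z hz h => ?_⟩
          · have := hNV _ h; omega
          · have := hNB _ h; omega
          · obtain ⟨z, hzh, rfl⟩ := hl.1 hz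
            rw [hκ] at h
            have := hNσ z (hhead z hzh) _ h
            omega)
      change StateEquiv CT _ (.mk3 (.and (.and (UserC.subst κl (UserC.subst ρ R.kept))
        (UserC.subst κl (UserC.subst ρ R.removed))) (UserC.subst κl C)) B V) at h1
      rwa [hinst _ fun x hx => hhead x (hkept x hx), hinst _ fun x hx => hhead x (hremoved x hx),
        hheadinst _ hkept, hheadinst _ hremoved, hCfix] at h1
    · intro z hz
      refine if_neg ?_
      rintro ⟨hzN, hzl⟩
      rcases Finset.mem_union.1 hz with hz | hz
      · have := hNV z hz; omega
      · rcases Finset.mem_union.1 hz with hz | hz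
        · have hz : z ∈ R'.headVars := hz
          obtain ⟨x, hx, rfl⟩ := Rule.mem_headVars_rename.1 hz
          rw [Nat.add_sub_cancel_left] at hzl
          exact hdisj x hx hzl
        · have := hNC z hz; omega
    · change CT.Derives _ (BuiltinC.toI (BuiltinC.subst _ (BuiltinC.subst ρ R.guard)))
      rw [BuiltinC.subst_subst]
      refine Theory.derives_builtin_congr hEq (σ := σ) _ (fun x hx => ?_)
        (derives_eqs_tail.trans (Theory.derives_of_subset hG))
      rcases hcases x (hguard x hx) with h | h
      · have hx := hdisj x h
        simp only [scomp, ρ, Term.subst, Nat.le_add_right, Nat.add_sub_cancel_left, hx, and_false,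
          if_false]
        have := derives_eqs (CT := CT) (σ := κ) (l := l) (B := B) (hl.2 ⟨x, h, rfl⟩)
        rw [hκ] at this
        exact Theory.derives_eq_symm hEq this
      · simp only [scomp, ρ, Term.subst, Nat.le_add_right, Nat.add_sub_cancel_left, h, and_true,
          if_true]
        exact (hEq.refl _).derives _
    · change CT.Derives _ (BuiltinC.toI (BuiltinC.subst _ (eqs κ l B)))
      rw [BuiltinC.subst_of_fixesOn]
      · exact .refl _ _
      · intro z hz
        refine if_neg ?_
        rintro ⟨hzN, hzl⟩
        rcases mem_vars_eqs.1 hz with ⟨x, hx, h⟩ | hz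
        · obtain ⟨x, hxh, rfl⟩ := hl.1 hx
          rcases h with rfl | h
          · rw [Nat.add_sub_cancel_left] at hzl
            exact hdisj x hxh hzl
          · rw [hκ] at h
            have := hNσ x (hhead x hxh) _ h
            omega
        · have := hNB z hz; omega
    · rw [BuiltinC.subst_var]
      exact .snd _ _ _
  -- Satisfiability of this constraint is the remaining condition for the transition; if it is
  -- refuted, the state is equivalent to a failed one.
  rcases hCompl (.and R'.guard (eqs κ l B)) with hsat | hunsat
  · -- the state after the transition
    have hpost : StateEquiv CT
        (.mk3 (.and (.and R'.kept R'.bodyU) C) (.and (.and R'.guard R'.bodyB) (eqs κ l B)) V)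
        (.mk3 (.and (.and (UserC.subst σ R.kept) (UserC.subst σ' R.bodyU)) C)
          (.and (.and (BuiltinC.subst σ' R.bodyB) (BuiltinC.subst σ' R.guard)) B) V) := by
      have h1 := StateEquiv.elim_eqs hEq (.and (.and R'.kept R'.bodyU) C) (σ := κ)
        (B := .and (.and (BuiltinC.subst σ' R.bodyB) (BuiltinC.subst σ' R.guard)) B)
        (V := V) hlnd (by
          intro x hx
          obtain ⟨y, hy, rfl⟩ := hl.1 hx
          have hfresh : ∀ z ∈ R.vars, N + y ∉ (σ' z).varFinset := by
            intro z hz h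
            rcases hcases z hz with hz' | hz'
            · rw [hσ'_head z hz'] at h
              have := hNσ z hz _ h
              omega
            · rw [hσ'_local z hz'] at h
              obtain rfl : y = z := Nat.add_left_cancel (Finset.mem_singleton.1 h)
              exact hdisj y hy hz'
          refine ⟨fun h => ?_, fun h => ?_, fun z hz h => ?_⟩
          · have := hNV _ h; omega
          · rcases Finset.mem_union.1 h with h | h
            · rcases Finset.mem_union.1 h with h | h
              · obtain ⟨z, hz, h⟩ := BuiltinC.mem_vars_subst.1 h
                exact hfresh z (hbodyB z hz) h
              · obtain ⟨z, hz, h⟩ := BuiltinC.mem_vars_subst.1 h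
                exact hfresh z (hguard z hz) h
            · have := hNB _ h; omega
          · obtain ⟨z, hzh, rfl⟩ := hl.1 hz
            rw [hκ] at h
            have := hNσ z (hhead z hzh) _ h
            omega)
      change StateEquiv CT _ (.mk3 (.and (.and (UserC.subst κl (UserC.subst ρ R.kept))
        (UserC.subst κl (UserC.subst ρ R.bodyU))) (UserC.subst κl C)) _ V) at h1
      rw [hinst _ fun x hx => hhead x (hkept x hx), hinst _ hbodyU,
        hheadinst _ hkept, hCfix] at h1
      -- In the presence of the equations, guard and body of the variant are equivalent to their
      -- instances under `σ'`.
      refine .trans (.of_equivalent _ _ ?_ ?_) h1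
      · have heq : ∀ x ∈ l, CT.Derives
            (BuiltinC.toI (.and (.and R'.guard R'.bodyB) (eqs κ l B))) (.eq (.var x) (κ x)) :=
          fun x hx => (Theory.Derives.snd _ _ _).trans (derives_eqs hx)
        refine derives_eqs_of heq (.and (.and ?_ ?_)
          ((Theory.Derives.snd _ _ _).trans derives_eqs_tail))
        · exact Theory.derives_builtin_congr hEq _ (fun x hx => hcongr heq x (hbodyB x hx))
            ((Theory.Derives.fst _ _ _).trans (.snd _ _ _))
        · exact Theory.derives_builtin_congr hEq _ (fun x hx => hcongr heq x (hguard x hx))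
            ((Theory.Derives.fst _ _ _).trans (.fst _ _ _))
      · have heq : ∀ x ∈ R.vars, CT.Derives (BuiltinC.toI (eqs κ l
            (.and (.and (BuiltinC.subst σ' R.bodyB) (BuiltinC.subst σ' R.guard)) B)))
            (.eq (σ' x) (ρ x)) :=
          fun x hx => Theory.derives_eq_symm hEq (hcongr (fun x hx => derives_eqs hx) x hx)
        have htail := derives_eqs_tail (CT := CT) (σ := κ) (l := l)
          (B := .and (.and (BuiltinC.subst σ' R.bodyB) (BuiltinC.subst σ' R.guard)) B)
        refine .and (.and ?_ ?_) (derives_eqs_of (fun x hx => derives_eqs hx)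
          (htail.trans (.snd _ _ _)))
        · exact Theory.derives_builtin_congr hEq _ (fun x hx => heq x (hguard x hx))
            ((htail.trans (.fst _ _ _)).trans (.snd _ _ _))
        · exact Theory.derives_builtin_congr hEq _ (fun x hx => heq x (hbodyB x hx))
            ((htail.trans (.fst _ _ _)).trans (.fst _ _ _))
    refine .inr ⟨σ', hσ', ?_⟩
    have hstep := Step.apply (CT := CT) R R' C (eqs κ l B) V hR
      ⟨(N + ·), fun a _ b _ h => Nat.add_left_cancel h, rfl⟩ (by
        refine Finset.disjoint_left.2 fun z hz h => ?_
        obtain ⟨x, hx, rfl⟩ := Rule.exists_of_mem_localVars_rename hz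
        simp only [Finset.mem_union] at h
        rcases h with ((h | h) | h) | h
        · exact (Finset.mem_sdiff.1 hz).2 h
        · have := hNC _ h; omega
        · rcases mem_vars_eqs.1 h with ⟨y, hy, h⟩ | h
          · obtain ⟨y, hyh, rfl⟩ := hl.1 hy
            rcases h with h | h
            · obtain rfl : x = y := Nat.add_left_cancel h
              exact hdisj x hyh hx
            · rw [hκ] at h
              have := hNσ y (hhead y hyh) _ h
              omega
          · have := hNB _ h; omega
        · have := hNV _ h; omega) hsat
    have e1 := Quotient.sound (s := stateSetoid U CT) hpre
    have e2 := Quotient.sound (s := stateSetoid U CT) hpost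
    unfold State.cls at hstep ⊢
    rwa [← e1, e2] at hstep
  · exact .inl ⟨_, .trans hpre (.of_unsatisfiable hunsat _ _)⟩

/-! ### From reachability to derivations of states -/

/-- The state `T` is entailed by a state to which `S` can be transformed. -/
def Leads (CT : Theory L) (P : Set (Rule L U)) (S T : State L U) : Prop :=
  ∃ W : State L U, Relation.ReflTransGen (Step CT P) (S.cls CT) (W.cls CT) ∧
    Entails CT (W.cls CT) (T.cls CT)

theorem Leads.of_entails {S T : State L U} (h : Entails CT (S.cls CT) (T.cls CT)) :
    Leads CT P S T := ⟨S, .refl, h⟩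

theorem Leads.of_equiv {S S' T : State L U} (h : StateEquiv CT S S') (h' : Leads CT P S' T) :
    Leads CT P S T := by
  obtain ⟨W, h1, h2⟩ := h'
  have : S.cls CT = S'.cls CT := Quotient.sound h
  exact ⟨W, this ▸ h1, h2⟩

theorem Leads.of_step {S S' T : State L U} (h : Step CT P (S.cls CT) (S'.cls CT))
    (h' : Leads CT P S' T) : Leads CT P S T := by
  obtain ⟨W, h1, h2⟩ := h'
  exact ⟨W, .head h h1, h2⟩

/-- A failed state may exchange its user-defined constraint and its globals for those of `T`, after
which `⊥` implies the built-in store of `T`. -/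
theorem Leads.of_failed (C : UserC L U) (V : Finset ℕ) (T : State L U) :
    Leads CT P (.mk3 C (.atom .falsum) V) T := by
  obtain ⟨C', B', -, hT, -⟩ := T.exists_mk3 (CT := CT)
  have h1 : StateEquiv CT (.mk3 C (.atom .falsum) V) (.mk3 C' (.atom .falsum) T.globals) :=
    .failed _ _ _ _
  exact .of_entails (.trans (.of_equiv h1)
    (.trans (.of_derives C' _ (.botE (Theory.Derives.refl _ _))) (.of_equiv hT.symm)))

/-- Induction on `Reaches`. Premises that hold for all values of the local variables are used at the
fresh variables supplied by `StateEquiv.exists_witness` and `Step.of_instance`. The globals `V`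
never change, and containing those of `T` matters only at the end, where surplus globals are
omitted. -/
theorem Leads.of_reaches (hEq : CT.HasEquality) (hCompl : CT.IsComplete) {T : State L U}
    {Cm : Multiset (UAtom L U)} {Bm : Multiset (BAtom L)} (h : Reaches CT P T Cm Bm)
    {V : Finset ℕ} (hV : T.globals ⊆ V) (C : UserC L U) (B : BuiltinC L) (hC : C.atoms = Cm)
    (hB : B.atoms = Bm) : Leads CT P (.mk3 C B V) T := by
  induction h generalizing C B with
  | done σ hσ hsub =>
    obtain ⟨C', B', hs, hT, -⟩ := T.exists_mk3 (CT := CT)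
    rw [hs] at hC hsub
    refine .of_entails (.trans (.of_equiv (.of_atoms (C' := UserC.subst σ C') (B' := B) V hC rfl))
      (.trans (.of_subset_globals _ _ hV) (.trans ?_ (.of_equiv hT.symm))))
    exact Entails.of_instance hEq _ _ _ _ hσ (Theory.derives_of_subset (by rwa [hB]))
  | @replace C₁ _ n c ts j t hm _ ih =>
    obtain ⟨C₁, rfl⟩ := Conj.exists_atoms_eq C₁
    obtain ⟨x, hx⟩ := Infinite.exists_notMem_finset
      (V ∪ BuiltinC.vars B ∪ UserC.vars C₁ ∪ UAtom.vars (.mk c ts) ∪ t.varFinset)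
    simp only [Finset.mem_union, not_or] at hx
    obtain ⟨⟨⟨⟨hxV, hxB⟩, hxC⟩, hxts⟩, hxt⟩ := hx
    have hxts : ∀ i, x ∉ (ts i).varFinset := fun i h =>
      hxts (by simpa [UAtom.vars] using ⟨i, h⟩)
    -- The fresh variable `x` marks the one argument to be replaced, so other occurrences of `ts j`
    -- stay untouched.
    let D : UserC L U := .and (.atom (.mk c (Function.update ts j (.var x)))) C₁
    have hD : ∀ s, UserC.subst (single x s) D =
        .and (.atom (.mk c (Function.update ts j s))) C₁ := by
      intro s
      refine congrArg₂ Conj.and (congrArg Conj.atom ?_)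
        (UserC.subst_of_fixesOn (fixesOn_single hxC s))
      simp only [UAtom.subst, UAtom.mk.injEq, heq_eq_eq, true_and]
      funext i
      by_cases h : i = j
      · subst h; simp [Term.subst, single_self]
      · simp only [Function.update_of_ne h]
        rw [term_subst_congr (fixesOn_single (hxts i) s), term_subst_var]
    have hrep := StateEquiv.replace hEq D hxV hxB (hxts j) hxt
      (Theory.derives_atom (a := .eq (ts j) t) (by rwa [hB]))
    rw [hD, hD, Function.update_eq_self] at hrep
    refine .of_equiv (.trans (.of_atoms V ?_ rfl) hrep) (ih _ _ ?_ hB)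
    · rw [hC]; simp [Conj.atoms]
    · simp [Conj.atoms]
  | theory α σ σ' hα hσ hm _ ih =>
    have h1 : CT.Derives (BuiltinC.toI B)
        ((IForm.exs α.X' (BuiltinC.toI α.B')).subst σ) := by
      refine Theory.Derives.trans (ψ := (IForm.exs α.X (BuiltinC.toI α.B)).subst σ) ?_
        (Theory.models_imp.1 ((Theory.models_of_mem hα).of_univ.subst σ))
      refine Theory.Derives.trans ?_ (.exs_intro hσ)
      rw [← BuiltinC.toI_subst]
      exact Theory.derives_of_subset (by rwa [hB])
    obtain ⟨σ'', hσ'', hequiv⟩ := StateEquiv.exists_witness h1 C V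
    exact .of_equiv hequiv (ih σ'' hσ'' _ _ hC (by rw [Conj.atoms, hB]))
  | @rule C₁ _ R σ hR hm _ ih =>
    obtain ⟨C₁, rfl⟩ := Conj.exists_atoms_eq C₁
    refine .of_equiv (.of_atoms (B' := B)
      (C' := .and (.and (UserC.subst σ R.kept) (UserC.subst σ R.removed)) C₁) V ?_ rfl) ?_
    · rw [hC]; rfl
    rcases Step.of_instance hEq hCompl hR (by rwa [hB]) C₁ V with ⟨C', h⟩ | ⟨σ', hσ', hstep⟩
    · exact .of_equiv h (.of_failed _ _ _)
    · exact .of_step hstep (ih σ' hσ' _ _ rfl (by rw [← hB]; rfl))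
  | failed hm =>
    refine .of_equiv (.of_equivalent (B' := .atom .falsum) C V ?_
      (.botE (Theory.Derives.refl CT .bot))) (.of_failed C V T)
    exact Theory.derives_atom (a := .falsum) (by rwa [hB])

/-- Completeness of the linear logic semantics. -/
theorem Leads.of_provable (hEq : CT.HasEquality) (hCompl : CT.IsComplete) {S T : State L U}
    (h : LProvable (programL P ∪ CT.toL U) (LForm.univ (.lolli S.toL T.toL))) :
    Leads CT P S T := by
  obtain ⟨C, B, hs, hS, hv⟩ := S.exists_mk3 (CT := CT)
  let F := Goal.vars S.goal \ S.globals
  obtain ⟨N, hN⟩ := exists_forall_lt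
    (S.globals ∪ F ∪ UserC.vars C ∪ BuiltinC.vars B ∪ T.globals)
  have h1 := reaches_of_provable h (ρ := shiftOn L N F) fun y hy => if_neg hy
  rw [hs] at h1
  refine .of_equiv (.trans hS ?_) (Leads.of_reaches hEq hCompl h1
    (Finset.subset_union_right (s₁ := S.globals)) _ _ rfl rfl)
  -- A global variable of `T` may happen to be the name of a local variable of `S`. After renaming
  -- the locals of `S` apart, the additional globals of `T` do not occur in the state and can be
  -- declared global.
  refine .trans (StateEquiv.rename hEq C B S.globals F
    (fun x hx => hN x (Finset.mem_union_left _ hx)) Finset.sdiff_disjoint) ?_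
  have hdisj : ∀ x ∈ T.globals \ S.globals,
      x ∉ UserC.vars (UserC.subst (shiftOn L N F) C) ∪
        BuiltinC.vars (BuiltinC.subst (shiftOn L N F) B) := by
    intro x hx h
    rw [Finset.mem_sdiff] at hx
    have key : ∀ y ∈ Goal.vars S.goal, x ∉ (shiftOn L N F y).varFinset := by
      intro y hy hxy
      rcases mem_vars_shiftOn.1 hxy with ⟨_, rfl⟩ | ⟨hyF, rfl⟩
      · have := hN _ (Finset.mem_union_right _ hx.1)
        omega
      · exact hyF (Finset.mem_sdiff.2 ⟨hy, hx.2⟩)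
    rw [hv] at key
    rcases Finset.mem_union.1 h with h | h
    · obtain ⟨y, hy, h⟩ := UserC.mem_vars_subst.1 h
      exact key y (Finset.mem_union_left _ hy) h
    · obtain ⟨y, hy, h⟩ := BuiltinC.mem_vars_subst.1 h
      exact key y (Finset.mem_union_right _ hy) h
  have h2 := StateEquiv.union_globals (CT := CT)
    (State.mk3 (UserC.subst (shiftOn L N F) C) (BuiltinC.subst (shiftOn L N F) B)
      S.globals).goal (T.globals \ S.globals) S.globals (by
        rw [vars_mk3]
        exact Finset.disjoint_left.2 hdisj)
  rw [Finset.sdiff_union_self_eq_union, Finset.union_comm] at h2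
  exact h2.symm

end Transitions

end CHR

namespace CHR

open FirstOrder.Language (Term)

universe u v w

/-! ### Derivations in linear logic -/

section Linear

variable {L : FirstOrder.Language.{u, v}} {U : ℕ → Type w}

theorem LForm.map_subst_shift (σ : ℕ → L.Term ℕ) (Γ : Multiset (LForm L U)) :
    (Γ.map (LForm.subst shiftS)).map (LForm.subst (up σ)) =
      (Γ.map (LForm.subst σ)).map (LForm.subst shiftS) := by
  simp only [Multiset.map_map, Function.comp_def, LForm.subst_subst, shiftS_scomp_up]

theorem LForm.subst_instS (t : L.Term ℕ) (σ : ℕ → L.Term ℕ) (φ : LForm L U) :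
    (φ.subst (instS t)).subst σ = (φ.subst (up σ)).subst (instS (t.subst σ)) := by
  simp only [LForm.subst_subst, instS_scomp, up_scomp_instS]

theorem LForm.subst_shift_up (σ : ℕ → L.Term ℕ) (φ : LForm L U) :
    (φ.subst shiftS).subst (up σ) = (φ.subst σ).subst shiftS := by
  simp only [LForm.subst_subst, shiftS_scomp_up]

theorem LProv.congr {Γ Δ : Multiset (LForm L U)} {φ : LForm L U} (h : LProv Γ φ) (e : Γ = Δ) :
    LProv Δ φ := e ▸ h

theorem LProv.subst {Γ : Multiset (LForm L U)} {φ : LForm L U} (h : LProv Γ φ)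
    (σ : ℕ → L.Term ℕ) : LProv (Γ.map (LForm.subst σ)) (φ.subst σ) := by
  induction h generalizing σ with
  | ident α => exact .ident _
  | cut _ _ ih ih' =>
    simp only [Multiset.map_cons, Multiset.map_add] at ih ih' ⊢
    exact .cut (ih σ) (ih' σ)
  | tensorL _ ih =>
    simp only [Multiset.map_cons] at ih ⊢
    exact .tensorL (ih σ)
  | tensorR _ _ ih ih' =>
    simp only [Multiset.map_add]
    exact .tensorR (ih σ) (ih' σ)
  | oneL _ ih =>
    simp only [Multiset.map_cons]
    exact .oneL (ih σ)
  | oneR => exact .oneR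
  | lolliL _ _ ih ih' =>
    simp only [Multiset.map_cons, Multiset.map_add] at ih ih' ⊢
    exact .lolliL (ih σ) (ih' σ)
  | lolliR _ ih =>
    simp only [Multiset.map_cons] at ih
    exact .lolliR (ih σ)
  | @bangR Γ α _ ih =>
    have e : (Γ.map .bang).map (LForm.subst σ) = (Γ.map (LForm.subst σ)).map .bang := by
      simp only [Multiset.map_map, Function.comp_def, LForm.subst]
    rw [e]
    exact .bangR (e ▸ ih σ)
  | dereliction _ ih =>
    simp only [Multiset.map_cons] at ih ⊢
    exact .dereliction (ih σ)
  | contraction _ ih =>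
    simp only [Multiset.map_cons] at ih ⊢
    exact .contraction (ih σ)
  | weakening _ ih =>
    simp only [Multiset.map_cons]
    exact .weakening (ih σ)
  | withL₁ _ ih =>
    simp only [Multiset.map_cons] at ih ⊢
    exact .withL₁ (ih σ)
  | withL₂ _ ih =>
    simp only [Multiset.map_cons] at ih ⊢
    exact .withL₂ (ih σ)
  | withR _ _ ih ih' => exact .withR (ih σ) (ih' σ)
  | topR => exact .topR _
  | plusL _ _ ih ih' =>
    simp only [Multiset.map_cons] at ih ih' ⊢
    exact .plusL (ih σ) (ih' σ)
  | plusR₁ _ ih => exact .plusR₁ (ih σ)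
  | plusR₂ _ ih => exact .plusR₂ (ih σ)
  | zeroL => exact .zeroL _
  | allL t _ ih =>
    have ih := ih σ
    rw [Multiset.map_cons, LForm.subst_instS] at ih
    rw [Multiset.map_cons]
    exact .allL _ ih
  | allR _ ih =>
    have ih := ih (up σ)
    rw [LForm.map_subst_shift] at ih
    exact .allR ih
  | exL _ ih =>
    have ih := ih (up σ)
    rw [Multiset.map_cons, LForm.map_subst_shift, LForm.subst_shift_up] at ih
    rw [Multiset.map_cons]
    exact .exL ih
  | exR t _ ih =>
    have ih := ih σ
    rw [LForm.subst_instS] at ih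
    exact .exR _ ih

/-- The rule `LProv.zeroL` allows no side formulas. They are absorbed one at a time: `0` proves `α ⊸
φ`, which is then cut against `α`. -/
theorem LProv.zero_left (Γ : Multiset (LForm L U)) (φ : LForm L U) : LProv (.zero ::ₘ Γ) φ := by
  induction Γ using Multiset.induction generalizing φ with
  | empty => exact .zeroL φ
  | cons α Γ ih =>
    have h := LProv.cut (ih (.lolli α φ)) (.lolliL (.ident α) (Δ := 0) (.ident φ))
    refine h.congr ?_
    rw [add_zero, Multiset.cons_add, add_comm, Multiset.singleton_add]

/-! ### Exponential formulas -/

/-- The formula implies its exponential. -/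
def LForm.IsExponential (α : LForm L U) : Prop := LProv {α} (.bang α)

theorem LForm.isExponential_bang (α : LForm L U) : (LForm.bang α).IsExponential :=
  LProv.bangR (Γ := {α}) (.ident _)

theorem LForm.IsExponential.weakening {α φ : LForm L U} (hα : α.IsExponential)
    {Γ : Multiset (LForm L U)} (h : LProv Γ φ) : LProv (α ::ₘ Γ) φ :=
  LProv.cut hα (.weakening h)

theorem LForm.IsExponential.contraction {α φ : LForm L U} (hα : α.IsExponential)
    {Γ : Multiset (LForm L U)} (h : LProv (α ::ₘ α ::ₘ Γ) φ) : LProv (α ::ₘ Γ) φ := by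
  refine LProv.cut hα (.contraction (.dereliction ?_))
  rw [Multiset.cons_swap]
  exact .dereliction h

/-- The rule `bangR` wants a literal exponential on each hypothesis: dereliction provides it before
promotion, and cuts with `α ⊢ !α` remove it afterwards. -/
theorem LProv.promote {Γ : Multiset (LForm L U)} {φ : LForm L U}
    (hΓ : ∀ α ∈ Γ, α.IsExponential) (h : LProv Γ φ) : LProv Γ (.bang φ) := by
  have h1 : ∀ (Γ E : Multiset (LForm L U)) (φ : LForm L U), LProv (Γ + E) φ →
      LProv (Γ.map .bang + E) φ := by
    intro Γ
    induction Γ using Multiset.induction with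
    | empty => exact fun E φ h => h
    | cons α Γ ih =>
      intro E φ h
      rw [Multiset.map_cons, Multiset.cons_add]
      refine .dereliction ?_
      rw [← Multiset.add_cons]
      exact ih _ _ (h.congr (by simp))
  have h2 : ∀ (Γ E : Multiset (LForm L U)) (φ : LForm L U), (∀ α ∈ Γ, α.IsExponential) →
      LProv (Γ.map .bang + E) φ → LProv (Γ + E) φ := by
    intro Γ
    induction Γ using Multiset.induction with
    | empty => exact fun E φ _ h => h
    | cons α Γ ih =>
      intro E φ hΓ h
      rw [Multiset.cons_add]
      have := ih (.bang α ::ₘ E) φ (fun α hα => hΓ α (Multiset.mem_cons_of_mem hα))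
        (h.congr (by simp))
      rw [Multiset.add_cons] at this
      exact .cut (hΓ α (Multiset.mem_cons_self _ _)) this
  rw [← add_zero Γ] at h ⊢
  have := h1 _ _ _ h
  rw [add_zero] at this
  exact h2 _ _ _ hΓ (by rw [add_zero]; exact .bangR this)

theorem LProv.promote_singleton {α φ : LForm L U} (hα : α.IsExponential) (h : LProv {α} φ) :
    LProv {α} (.bang φ) :=
  .promote (by simpa using hα) h

/-! ### Translation of intuitionistic derivations -/

/-- Atoms, implications and universal formulas carry an exponential, and the units, `⊗`, `⊕` and `∃`
inherit the property. Hence structural rules are available for all translated intuitionistic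
hypotheses. -/
theorem IForm.isExponential_star (φ : IForm L) : (φ.star U).IsExponential := by
  induction φ with
  | eq | rel | imp | all => exact LForm.isExponential_bang _
  | bot => exact .zeroL _
  | top => exact .oneL (LProv.bangR (Γ := 0) .oneR)
  | and φ ψ ih ih' =>
    exact .tensorL (.promote (by simpa using ⟨ih, ih'⟩) (.tensorR (.ident _) (.ident _)))
  | or φ ψ ih ih' =>
    exact .plusL (.promote_singleton ih (.plusR₁ (.ident _)))
      (.promote_singleton ih' (.plusR₂ (.ident _)))
  | ex φ ih =>
    refine .exL (LProv.promote_singleton ih (.exR (.var 0) ?_))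
    rw [LForm.subst_subst, up_scomp_instS]
    have : consS (.var 0) shiftS = (Term.var : ℕ → L.Term ℕ) := by
      funext n; cases n <;> rfl
    rw [this, LForm.subst_var]
    exact .ident _

theorem LProv.weaken_star (Δ : Multiset (IForm L)) {Γ : Multiset (LForm L U)} {φ : LForm L U}
    (h : LProv Γ φ) : LProv (Δ.map (IForm.star U) + Γ) φ := by
  induction Δ using Multiset.induction with
  | empty => simpa using h
  | cons δ Δ ih =>
    rw [Multiset.map_cons, Multiset.cons_add]
    exact δ.isExponential_star.weakening ih

/-- This reconciles the set contexts of `IProv` with multisets: the copies of `φ` among the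
hypotheses are contracted to a single one, which weakening supplies if there is none. -/
theorem LProv.absorb_star {Γ : Set (IForm L)} {φ : IForm L} {χ : LForm L U}
    (Δ : Multiset (IForm L)) (E : Multiset (LForm L U)) (hΔ : ∀ δ ∈ Δ, δ ∈ insert φ Γ)
    (h : LProv (Δ.map (IForm.star U) + E) χ) :
    ∃ Δ' : Multiset (IForm L), (∀ δ ∈ Δ', δ ∈ Γ) ∧
      LProv (φ.star U ::ₘ (Δ'.map (IForm.star U) + E)) χ := by
  induction Δ using Multiset.induction generalizing E with
  | empty => exact ⟨0, by simp, φ.isExponential_star.weakening h⟩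
  | cons δ Δ ih =>
    obtain ⟨Δ', hΔ', h'⟩ := ih (δ.star U ::ₘ E) (fun δ hδ => hΔ δ (Multiset.mem_cons_of_mem hδ))
      (h.congr (by simp))
    rcases hΔ δ (Multiset.mem_cons_self _ _) with rfl | hδ
    · rw [Multiset.add_cons] at h'
      exact ⟨Δ', hΔ', δ.isExponential_star.contraction h'⟩
    · refine ⟨δ ::ₘ Δ', ?_, h'.congr (by simp)⟩
      intro γ hγ
      rcases Multiset.mem_cons.1 hγ with rfl | hγ
      · exact hδ
      · exact hΔ' γ hγ

theorem exists_map_eq_of_mem_image {A : Type u} {A' : Type v} {f : A → A'} {Γ : Set A}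
    (Δ : Multiset A') (h : ∀ δ ∈ Δ, δ ∈ f '' Γ) :
    ∃ Δ' : Multiset A, (∀ δ ∈ Δ', δ ∈ Γ) ∧ Δ = Δ'.map f := by
  induction Δ using Multiset.induction with
  | empty => exact ⟨0, by simp, rfl⟩
  | cons δ Δ ih =>
    obtain ⟨Δ', hΔ', rfl⟩ := ih fun δ hδ => h δ (Multiset.mem_cons_of_mem hδ)
    obtain ⟨γ, hγ, rfl⟩ := h δ (Multiset.mem_cons_self _ _)
    refine ⟨γ ::ₘ Δ', ?_, by simp⟩
    intro δ hδ
    rcases Multiset.mem_cons.1 hδ with rfl | hδ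
    · exact hγ
    · exact hΔ' δ hδ

theorem map_star_shift (Δ : Multiset (IForm L)) :
    (Δ.map (IForm.subst shiftS)).map (IForm.star U) =
      (Δ.map (IForm.star U)).map (LForm.subst shiftS) := by
  simp only [Multiset.map_map, Function.comp_def, IForm.star_subst]

theorem forall_mem_add {A : Type u} {p : A → Prop} {Δ Δ' : Multiset A} (h : ∀ δ ∈ Δ, p δ)
    (h' : ∀ δ ∈ Δ', p δ) : ∀ δ ∈ Δ + Δ', p δ := fun δ hδ =>
  (Multiset.mem_add.1 hδ).elim (h δ) (h' δ)

/-- Intuitionistic derivations translate to linear ones. -/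
theorem IProv.star (U : ℕ → Type w) {Γ : Set (IForm L)} {φ : IForm L} (h : IProv Γ φ) :
    ∃ Δ : Multiset (IForm L), (∀ δ ∈ Δ, δ ∈ Γ) ∧ LProv (Δ.map (IForm.star U)) (φ.star U) := by
  have absorb : ∀ {Γ : Set (IForm L)} {φ χ : IForm L},
      (∃ Δ : Multiset (IForm L), (∀ δ ∈ Δ, δ ∈ insert φ Γ) ∧
        LProv (Δ.map (IForm.star U)) (χ.star U)) →
      ∃ Δ : Multiset (IForm L), (∀ δ ∈ Δ, δ ∈ Γ) ∧
        LProv (φ.star U ::ₘ Δ.map (IForm.star U)) (χ.star U) := by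
    rintro Γ φ χ ⟨Δ, hΔ, h⟩
    obtain ⟨Δ', hΔ', h'⟩ := LProv.absorb_star Δ 0 hΔ (h.congr (by simp))
    exact ⟨Δ', hΔ', h'.congr (by simp)⟩
  have cut1 : ∀ {Γ : Multiset (LForm L U)} {α β : LForm L U}, LProv Γ α → LProv {α} β →
      LProv Γ β := fun h h' => (LProv.cut h (Δ := 0) h').congr (add_zero _)
  have exponential : ∀ {Δ : Multiset (IForm L)}, ∀ α ∈ Δ.map (IForm.star U),
      α.IsExponential := by
    intro Δ α hα
    obtain ⟨δ, _, rfl⟩ := Multiset.mem_map.1 hα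
    exact δ.isExponential_star
  induction h with
  | @hyp _ φ h => exact ⟨{φ}, by simpa using h, .ident _⟩
  | topI => exact ⟨0, by simp, .oneR⟩
  | botE _ ih =>
    obtain ⟨Δ, hΔ, h⟩ := ih
    exact ⟨Δ, hΔ, cut1 h (.zeroL _)⟩
  | andI _ _ ih ih' =>
    obtain ⟨Δ, hΔ, h⟩ := ih
    obtain ⟨Δ', hΔ', h'⟩ := ih'
    exact ⟨Δ + Δ', forall_mem_add hΔ hΔ', by rw [Multiset.map_add]; exact .tensorR h h'⟩
  | @andE₁ _ φ ψ _ ih =>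
    obtain ⟨Δ, hΔ, h⟩ := ih
    refine ⟨Δ, hΔ, cut1 h (.tensorL (Γ := 0) ?_)⟩
    rw [Multiset.cons_swap]
    exact ψ.isExponential_star.weakening (.ident _)
  | @andE₂ _ φ ψ _ ih =>
    obtain ⟨Δ, hΔ, h⟩ := ih
    exact ⟨Δ, hΔ, cut1 h (.tensorL (Γ := 0) (φ.isExponential_star.weakening (.ident _)))⟩
  | orI₁ _ ih =>
    obtain ⟨Δ, hΔ, h⟩ := ih
    exact ⟨Δ, hΔ, .plusR₁ h⟩
  | orI₂ _ ih =>
    obtain ⟨Δ, hΔ, h⟩ := ih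
    exact ⟨Δ, hΔ, .plusR₂ h⟩
  | orE _ _ _ ih ih1 ih2 =>
    obtain ⟨Δ, hΔ, h⟩ := ih
    obtain ⟨Δ1, hΔ1, h1⟩ := absorb ih1
    obtain ⟨Δ2, hΔ2, h2⟩ := absorb ih2
    -- `plusL` requires the same context in both branches, so each branch is weakened by the
    -- hypotheses of the other.
    refine ⟨Δ + (Δ1 + Δ2), forall_mem_add hΔ (forall_mem_add hΔ1 hΔ2), ?_⟩
    rw [Multiset.map_add]
    refine .cut h (.plusL ((h1.weaken_star Δ2).congr ?_) ((h2.weaken_star Δ1).congr ?_))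
    · rw [Multiset.add_cons, Multiset.map_add, add_comm]
    · rw [Multiset.add_cons, Multiset.map_add]
  | impI _ ih =>
    obtain ⟨Δ, hΔ, h⟩ := absorb ih
    exact ⟨Δ, hΔ, .promote exponential (.lolliR h)⟩
  | impE _ _ ih ih' =>
    obtain ⟨Δ, hΔ, h⟩ := ih
    obtain ⟨Δ', hΔ', h'⟩ := ih'
    refine ⟨Δ + Δ', forall_mem_add hΔ hΔ', ?_⟩
    rw [Multiset.map_add]
    exact .cut h (.dereliction ((LProv.lolliL h' (Δ := 0) (.ident _)).congr (by simp)))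
  | allI _ ih =>
    obtain ⟨Δ, hΔ, h⟩ := ih
    obtain ⟨Δ', hΔ', rfl⟩ := exists_map_eq_of_mem_image Δ hΔ
    rw [map_star_shift] at h
    exact ⟨Δ', hΔ', .promote exponential (.allR h)⟩
  | allE t _ ih =>
    obtain ⟨Δ, hΔ, h⟩ := ih
    refine ⟨Δ, hΔ, cut1 h (.dereliction (Γ := 0) (.allL t ?_))⟩
    rw [IForm.star_subst]
    exact .ident _
  | exI t _ ih =>
    obtain ⟨Δ, hΔ, h⟩ := ih
    rw [IForm.star_subst] at h
    exact ⟨Δ, hΔ, .exR t h⟩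
  | exE _ _ ih ih' =>
    obtain ⟨Δ, hΔ, h⟩ := ih
    obtain ⟨Δ', hΔ', h'⟩ := absorb ih'
    obtain ⟨Δ', hΔ'', rfl⟩ := exists_map_eq_of_mem_image Δ' hΔ'
    rw [map_star_shift, IForm.star_subst] at h'
    refine ⟨Δ + Δ', forall_mem_add hΔ hΔ'', ?_⟩
    rw [Multiset.map_add]
    exact .cut h (.exL h')

/-! ### Derivability from a theory -/

/-- Derivability of a sequent from finitely many formulas of a theory. -/
def Seq (Θ : Set (LForm L U)) (Γ : Multiset (LForm L U)) (φ : LForm L U) : Prop :=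
  ∃ Δ : Multiset (LForm L U), (∀ θ ∈ Δ, θ ∈ Θ) ∧ LProv (Γ + Δ) φ

/-- The formulas of the theory are closed. -/
def IsClosedTheory (Θ : Set (LForm L U)) : Prop := ∀ θ ∈ Θ, θ.fv = ∅

namespace Seq

variable {Θ : Set (LForm L U)} {Γ Γ' : Multiset (LForm L U)} {φ ψ χ : LForm L U}

theorem congr (h : Seq Θ Γ φ) (e : Γ = Γ') : Seq Θ Γ' φ := e ▸ h

theorem ident (Θ : Set (LForm L U)) (φ : LForm L U) : Seq Θ {φ} φ := ⟨0, by simp, .ident φ⟩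

theorem cut (h : Seq Θ Γ φ) (h' : Seq Θ (φ ::ₘ Γ') ψ) : Seq Θ (Γ + Γ') ψ := by
  obtain ⟨Δ, hΔ, h⟩ := h
  obtain ⟨Δ', hΔ', h'⟩ := h'
  rw [Multiset.cons_add] at h'
  exact ⟨Δ + Δ', forall_mem_add hΔ hΔ', (LProv.cut h h').congr (add_add_add_comm _ _ _ _)⟩

theorem trans (h : Seq Θ Γ φ) (h' : Seq Θ {φ} ψ) : Seq Θ Γ ψ :=
  (cut h (Γ' := 0) h').congr (add_zero _)

theorem tensorL (h : Seq Θ (φ ::ₘ ψ ::ₘ Γ) χ) : Seq Θ (.tensor φ ψ ::ₘ Γ) χ := by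
  obtain ⟨Δ, hΔ, h⟩ := h
  rw [Multiset.cons_add, Multiset.cons_add] at h
  exact ⟨Δ, hΔ, by rw [Multiset.cons_add]; exact .tensorL h⟩

theorem tensorR (h : Seq Θ Γ φ) (h' : Seq Θ Γ' ψ) : Seq Θ (Γ + Γ') (.tensor φ ψ) := by
  obtain ⟨Δ, hΔ, h⟩ := h
  obtain ⟨Δ', hΔ', h'⟩ := h'
  exact ⟨Δ + Δ', forall_mem_add hΔ hΔ', (LProv.tensorR h h').congr (add_add_add_comm _ _ _ _)⟩

theorem tensor_mono (h : Seq Θ {φ} ψ) {φ' ψ' : LForm L U} (h' : Seq Θ {φ'} ψ') :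
    Seq Θ {.tensor φ φ'} (.tensor ψ ψ') := tensorL (Γ := 0) (tensorR h h')

theorem zeroL (Θ : Set (LForm L U)) (Γ : Multiset (LForm L U)) (φ : LForm L U) :
    Seq Θ (.zero ::ₘ Γ) φ := ⟨0, by simp, (LProv.zero_left Γ φ).congr (by simp)⟩

theorem lolliL (h : Seq Θ Γ φ) (h' : Seq Θ (ψ ::ₘ Γ') χ) :
    Seq Θ (.lolli φ ψ ::ₘ (Γ + Γ')) χ := by
  obtain ⟨Δ, hΔ, h⟩ := h
  obtain ⟨Δ', hΔ', h'⟩ := h'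
  rw [Multiset.cons_add] at h'
  refine ⟨Δ + Δ', forall_mem_add hΔ hΔ', (LProv.lolliL h h').congr ?_⟩
  rw [Multiset.cons_add, add_add_add_comm]

theorem weakening (hφ : φ.IsExponential) (h : Seq Θ Γ ψ) : Seq Θ (φ ::ₘ Γ) ψ := by
  obtain ⟨Δ, hΔ, h⟩ := h
  exact ⟨Δ, hΔ, by rw [Multiset.cons_add]; exact hφ.weakening h⟩

theorem contraction (hφ : φ.IsExponential) (h : Seq Θ (φ ::ₘ φ ::ₘ Γ) ψ) :
    Seq Θ (φ ::ₘ Γ) ψ := by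
  obtain ⟨Δ, hΔ, h⟩ := h
  rw [Multiset.cons_add, Multiset.cons_add] at h
  exact ⟨Δ, hΔ, by rw [Multiset.cons_add]; exact hφ.contraction h⟩

theorem map_subst_theory (hΘ : IsClosedTheory Θ) {Δ : Multiset (LForm L U)}
    (hΔ : ∀ θ ∈ Δ, θ ∈ Θ) (σ : ℕ → L.Term ℕ) : Δ.map (LForm.subst σ) = Δ := by
  conv_rhs => rw [← Multiset.map_id Δ]
  exact Multiset.map_congr rfl fun θ hθ => LForm.subst_of_closed (hΘ θ (hΔ θ hθ)) σ

theorem subst (hΘ : IsClosedTheory Θ) (h : Seq Θ Γ φ) (σ : ℕ → L.Term ℕ) :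
    Seq Θ (Γ.map (LForm.subst σ)) (φ.subst σ) := by
  obtain ⟨Δ, hΔ, h⟩ := h
  have := h.subst σ
  rw [Multiset.map_add, map_subst_theory hΘ hΔ] at this
  exact ⟨Δ, hΔ, this⟩

/-- As in `Theory.Derives.ex_elim`, a fresh variable serves as the generic term; since the axioms
are closed, binding it again leaves them unchanged. -/
theorem ex_elim (hΘ : IsClosedTheory Θ) (h : ∀ t, Seq Θ (φ.subst (instS t) ::ₘ Γ) ψ) :
    Seq Θ (.ex φ ::ₘ Γ) ψ := by
  obtain ⟨w, hw⟩ := Infinite.exists_notMem_finset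
    ((Γ.map LForm.fv).sup ∪ (LForm.ex φ).fv ∪ ψ.fv)
  simp only [Finset.mem_union, not_or] at hw
  obtain ⟨⟨hwΓ, hwφ⟩, hwψ⟩ := hw
  have hshift : ∀ {α : LForm L U}, w ∉ α.fv → α.subst (bindS w) = α.subst shiftS := by
    intro α h
    refine LForm.subst_congr fun x hx => ?_
    simp only [bindS, shiftS, if_neg (fun he : x = w => h (he ▸ hx))]
  have key := (h (.var w)).subst hΘ (bindS w)
  have hΓ : Γ.map (LForm.subst (bindS w)) = Γ.map (LForm.subst shiftS) :=
    Multiset.map_congr rfl fun α hα => hshift fun hwα =>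
      hwΓ (Multiset.le_sup (Multiset.mem_map_of_mem LForm.fv hα) hwα)
  have hφ : (φ.subst (instS (.var w))).subst (bindS w) = φ := by
    rw [LForm.subst_subst, instS_scomp]
    conv_rhs => rw [← LForm.subst_var φ]
    refine LForm.subst_congr fun x hx => ?_
    cases x with
    | zero => simp [consS, Term.subst, bindS]
    | succ k =>
      have hk : k ≠ w := fun hk => hwφ (mem_unbind.2 (hk ▸ hx))
      simp [consS, bindS, hk]
  rw [Multiset.map_cons, hφ, hΓ, hshift hwψ] at key
  obtain ⟨Δ, hΔ, key⟩ := key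
  refine ⟨Δ, hΔ, ?_⟩
  rw [Multiset.cons_add] at key ⊢
  refine .exL ?_
  rwa [Multiset.map_add, map_subst_theory hΘ hΔ]

theorem exs_intro {X : Finset ℕ} {σ σ' : ℕ → L.Term ℕ} (h : AgreeOff X σ' σ) :
    Seq Θ {φ.subst σ'} ((LForm.exs X φ).subst σ) := by
  have key : ∀ (l : List ℕ) σ, AgreeOff l.toFinset σ' σ →
      Seq Θ {φ.subst σ'} ((l.foldr LForm.exV φ).subst σ) := by
    intro l
    induction l with
    | nil =>
      intro σ h
      rw [show σ' = σ from funext fun y => h y (by simp)]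
      exact ident _ _
    | cons a l ih =>
      intro σ h
      obtain ⟨t, h⟩ := agreeOff_update_iff.1 h
      obtain ⟨Δ, hΔ, h⟩ := ih _ h
      refine ⟨Δ, hΔ, .exR t ?_⟩
      rwa [LForm.subst_subst, up_scomp_instS, LForm.subst_subst, bindS_scomp_consS]
  exact key _ σ (by rwa [Finset.sort_toFinset])

theorem exs_elim (hΘ : IsClosedTheory Θ) {X : Finset ℕ} {σ : ℕ → L.Term ℕ}
    (h : ∀ σ', AgreeOff X σ' σ → Seq Θ (φ.subst σ' ::ₘ Γ) ψ) :
    Seq Θ ((LForm.exs X φ).subst σ ::ₘ Γ) ψ := by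
  have key : ∀ (l : List ℕ) σ,
      (∀ σ', AgreeOff l.toFinset σ' σ → Seq Θ (φ.subst σ' ::ₘ Γ) ψ) →
      Seq Θ ((l.foldr LForm.exV φ).subst σ ::ₘ Γ) ψ := by
    intro l
    induction l with
    | nil => exact fun σ h => h σ (AgreeOff.refl _ _)
    | cons a l ih =>
      intro σ h
      refine ex_elim hΘ fun t => ?_
      rw [LForm.subst_subst, up_scomp_instS, LForm.subst_subst, bindS_scomp_consS]
      exact ih _ fun σ' hσ' => h σ' (agreeOff_update_iff.2 ⟨t, hσ'⟩)
  exact key _ σ (by rwa [Finset.sort_toFinset])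

theorem use_theory (hφ : .bang φ.univ ∈ Θ) (σ : ℕ → L.Term ℕ) (h : Seq Θ (φ.subst σ ::ₘ Γ) ψ) :
    Seq Θ Γ ψ := by
  have key : ∀ (l : List ℕ) (σ : ℕ → L.Term ℕ) (Γ : Multiset (LForm L U)),
      LProv (φ.subst σ ::ₘ Γ) ψ → LProv ((l.foldr LForm.allV φ).subst σ ::ₘ Γ) ψ := by
    intro l σ Γ h
    induction l with
    | nil => exact h
    | cons a l ih =>
      refine .allL (σ a) ?_
      rwa [LForm.subst_subst, up_scomp_instS, LForm.subst_subst, bindS_scomp_consS,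
        Function.update_eq_self]
  obtain ⟨Δ, hΔ, h⟩ := h
  refine ⟨.bang φ.univ ::ₘ Δ, ?_, ?_⟩
  · intro θ hθ
    rcases Multiset.mem_cons.1 hθ with rfl | hθ
    · exact hφ
    · exact hΔ θ hθ
  · rw [Multiset.cons_add] at h
    have := key φ.fv.sort σ _ h
    rw [← LForm.alls, ← LForm.univ, LForm.subst_of_closed (LForm.fv_univ φ)] at this
    rw [Multiset.add_cons]
    exact .dereliction this

theorem provable_univ (hΘ : IsClosedTheory Θ) (h : Seq Θ {φ} ψ) :
    LProvable Θ (LForm.univ (.lolli φ ψ)) := by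
  obtain ⟨Δ, hΔ, h⟩ := h
  refine ⟨Δ, hΔ, ?_⟩
  have key : ∀ (l : List ℕ) (χ : LForm L U), LProv Δ χ → LProv Δ (l.foldr LForm.allV χ) := by
    intro l χ h
    induction l with
    | nil => exact h
    | cons a l ih =>
      refine .allR ?_
      have := ih.subst (bindS a)
      rw [map_subst_theory hΘ hΔ] at this ⊢
      exact this
  exact key _ _ (.lolliR h)

end Seq

end Linear

end CHR

namespace CHR

open FirstOrder.Language (Term)

universe u v w

/-! ### Soundness of the linear logic semantics -/

section Soundness

variable {L : FirstOrder.Language.{u, v}} {U : ℕ → Type w}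

theorem isClosedTheory (CT : Theory L) (P : Set (Rule L U)) :
    IsClosedTheory (programL P ∪ CT.toL U) := by
  rintro θ (⟨R, hR, rfl⟩ | ⟨α, hα, rfl⟩ | ⟨n, c, j, rfl⟩)
  · exact LForm.fv_univ _
  · exact (IForm.fv_star _).trans (IForm.fv_univ _)
  · exact LForm.fv_univ _

theorem Goal.fv_toL (G : Goal L U) : (Goal.toL G).fv = Goal.vars G := by
  induction G with
  | top => rfl
  | atom a => rcases a with ⟨c, ts⟩ | _ | ⟨t, t'⟩ | ⟨r, ts⟩ <;> rfl
  | and G G' ih ih' => exact congrArg₂ _ ih ih'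

theorem UserC.fv_toL (C : UserC L U) : (UserC.toL C).fv = UserC.vars C := by
  induction C with
  | top => rfl
  | atom a => cases a; rfl
  | and C D ih ih' => exact congrArg₂ _ ih ih'

theorem UserC.toL_subst (σ : ℕ → L.Term ℕ) (C : UserC L U) :
    UserC.toL (UserC.subst σ C) = (UserC.toL C).subst σ := by
  induction C with
  | top => rfl
  | atom a => cases a; rfl
  | and C D ih ih' => exact congrArg₂ LForm.tensor ih ih'

theorem BuiltinC.fv_toL (B : BuiltinC L) : (BuiltinC.toL U B).fv = BuiltinC.vars B := by
  rw [← star_toI, IForm.fv_star, BuiltinC.fv_toI]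

theorem BuiltinC.toL_subst (σ : ℕ → L.Term ℕ) (B : BuiltinC L) :
    BuiltinC.toL U (BuiltinC.subst σ B) = (BuiltinC.toL U B).subst σ := by
  rw [← star_toI, ← star_toI, BuiltinC.toI_subst, IForm.star_subst]

/-- The translation of `S` implies the translation of `T`. -/
def Implies (Θ : Set (LForm L U)) (S T : State L U) : Prop := Seq Θ {S.toL} T.toL

section Closed

variable {Θ : Set (LForm L U)} (hΘ : IsClosedTheory Θ)
include hΘ

/-- Together with `Seq.state_intro`, this replaces the quantifier prefix of a state by arbitrary
instances of its goal that fix the globals, so quantifiers need not be handled in the arguments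
about states. -/
theorem Seq.state_elim {S : State L U} {χ : LForm L U}
    (h : ∀ σ, FixesOn S.globals σ → Seq Θ {(Goal.toL S.goal).subst σ} χ) :
    Seq Θ {S.toL} χ := by
  have key : Seq Θ ((LForm.exs (Goal.vars S.goal \ S.globals) (Goal.toL S.goal)).subst .var ::ₘ 0)
      χ := .exs_elim hΘ fun σ hσ => h σ fun y hy => hσ y (by simp [hy])
  rwa [LForm.subst_var] at key

omit hΘ in
theorem Seq.state_intro {S : State L U} {σ : ℕ → L.Term ℕ} (h : FixesOn S.globals σ) :
    Seq Θ {(Goal.toL S.goal).subst σ} S.toL := by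
  let X := Goal.vars S.goal \ S.globals
  have key : Seq Θ {(Goal.toL S.goal).subst fun y => if y ∈ X then σ y else .var y}
      ((LForm.exs X (Goal.toL S.goal)).subst .var) := .exs_intro fun y hy => if_neg hy
  rw [LForm.subst_var] at key
  rw [LForm.subst_congr (τ := fun y => if y ∈ X then σ y else .var y)]
  · exact key
  · intro y hy
    split_ifs with hX
    · rfl
    · rw [Goal.fv_toL] at hy
      refine h y ?_
      by_contra hyV
      exact hX (Finset.mem_sdiff.2 ⟨hy, hyV⟩)

omit hΘ in
theorem Implies.trans {S T W : State L U} (h : Implies Θ S T) (h' : Implies Θ T W) :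
    Implies Θ S W := Seq.trans h h'

theorem Implies.of_instances {S T : State L U}
    (h : ∀ σ, FixesOn S.globals σ → ∃ σ', FixesOn T.globals σ' ∧
      Seq Θ {(Goal.toL S.goal).subst σ} ((Goal.toL T.goal).subst σ')) : Implies Θ S T :=
  Seq.state_elim hΘ fun σ hσ => by
    obtain ⟨σ', hσ', h⟩ := h σ hσ
    exact h.trans (.state_intro hσ')

end Closed

/-! ### Rearranging tensor products -/

section AC

variable {Θ : Set (LForm L U)} (φ ψ χ : LForm L U)

theorem Seq.tensor_comm : Seq Θ {.tensor φ ψ} (.tensor ψ φ) :=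
  .tensorL (Γ := 0) ((Seq.tensorR (.ident Θ ψ) (.ident Θ φ)).congr (by rw [add_comm]; rfl))

theorem Seq.tensor_assoc :
    Seq Θ {.tensor (.tensor φ ψ) χ} (.tensor φ (.tensor ψ χ)) :=
  .tensorL (Γ := 0) (.tensorL (.tensorR (.ident _ _) (.tensorR (.ident _ _) (.ident _ _))))

theorem Seq.tensor_assoc_symm :
    Seq Θ {.tensor φ (.tensor ψ χ)} (.tensor (.tensor φ ψ) χ) := by
  refine .tensorL (Γ := 0) ?_
  rw [Multiset.cons_swap]
  refine .tensorL ((Seq.tensorR (.tensorR (.ident Θ φ) (.ident Θ ψ)) (.ident Θ χ)).congr ?_)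
  simp only [← Multiset.singleton_add]
  abel

/-- The resource bookkeeping of a rule application: the heads `φ`, `ψ` and the guard `α` are
consumed, while the rest `χ` of the user-defined constraint and the rest `β` of the built-in store
remain next to the conclusion `δ`. -/
theorem Seq.lolli_apply {φ ψ χ α β δ γ : LForm L U} (h : Seq Θ (δ ::ₘ {χ, β}) γ) :
    Seq Θ (.lolli (.tensor (.tensor φ ψ) α) δ ::ₘ
      {.tensor (.tensor (.tensor φ ψ) χ) (.tensor α β)}) γ := by
  have h1 := Seq.lolliL (.tensorR (.tensorR (.ident Θ φ) (.ident Θ ψ)) (.ident Θ α)) h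
  have h2 := Seq.tensorL (φ := α) (ψ := β)
    (Γ := {φ, ψ, χ, .lolli (.tensor (.tensor φ ψ) α) δ}) (h1.congr (by
      simp only [Multiset.insert_eq_cons, ← Multiset.singleton_add]; abel))
  have h3 := Seq.tensorL (φ := .tensor (.tensor φ ψ) χ) (ψ := .tensor α β)
    (Γ := {.lolli (.tensor (.tensor φ ψ) α) δ}) (.tensorL (.tensorL (h2.congr (by
      simp only [Multiset.insert_eq_cons, ← Multiset.singleton_add]; abel))))
  exact h3.congr (Multiset.cons_swap _ _ 0)

theorem LForm.isExponential_one : (LForm.one : LForm L U).IsExponential :=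
  IForm.isExponential_star .top

end AC

theorem GoalEquiv.seq {Θ : Set (LForm L U)} {G G' : Goal L U} (h : GoalEquiv G G') :
    Seq Θ {Goal.toL G} (Goal.toL G') ∧ Seq Θ {Goal.toL G'} (Goal.toL G) := by
  induction h with
  | refl G => exact ⟨.ident _ _, .ident _ _⟩
  | symm _ ih => exact ih.symm
  | trans _ _ ih ih' => exact ⟨ih.1.trans ih'.1, ih'.2.trans ih.2⟩
  | congr _ _ ih ih' => exact ⟨.tensor_mono ih.1 ih'.1, .tensor_mono ih.2 ih'.2⟩
  | assoc G F E => exact ⟨.tensor_assoc _ _ _, .tensor_assoc_symm _ _ _⟩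
  | comm G F => exact ⟨.tensor_comm _ _, .tensor_comm _ _⟩
  | top G =>
    refine ⟨.tensorL (Γ := 0) ?_, ⟨0, by simp, ?_⟩⟩
    · rw [Multiset.cons_swap]
      exact .weakening LForm.isExponential_one (.ident _ _)
    · exact (LProv.tensorR (.ident _) .oneR).congr (by simp)

/-! ### Operational moves as linear implications -/

variable {CT : Theory L} {P : Set (Rule L U)}

theorem Theory.Derives.seq {φ ψ : IForm L} (h : CT.Derives φ ψ) (P : Set (Rule L U)) :
    Seq (programL P ∪ CT.toL U) {φ.star U} (ψ.star U) := by
  obtain ⟨Δ, hΔ, h⟩ := IProv.star U h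
  obtain ⟨Δ', hΔ', h'⟩ := LProv.absorb_star Δ 0 hΔ (h.congr (add_zero _).symm)
  refine ⟨Δ'.map (IForm.star U), fun θ hθ => ?_, h'.congr (by simp)⟩
  obtain ⟨δ, hδ, rfl⟩ := Multiset.mem_map.1 hθ
  obtain ⟨α, hα, rfl⟩ := hΔ' δ hδ
  exact .inr (.inl ⟨α, hα, rfl⟩)

theorem Seq.replace_arg (CT : Theory L) (P : Set (Rule L U)) {n : ℕ} (c : U n)
    (ts : Fin n → L.Term ℕ) (j : Fin n) (t : L.Term ℕ) :
    Seq (programL P ∪ CT.toL U) {.user c ts, .bang (.eq (ts j) t)}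
      (.user c (Function.update ts j t)) := by
  -- The variables below `n` in `eqFormula` receive the arguments and the variable `n` receives the
  -- new term; larger ones do not occur in it.
  let σ : ℕ → L.Term ℕ := fun k => if h : k < n then ts ⟨k, h⟩ else t
  have hσ : ∀ i : Fin n, σ i = ts i := fun i => by simp [σ]
  have hσn : σ n = t := by simp [σ]
  refine .use_theory (.inr (.inr ⟨n, c, j, rfl⟩)) σ ?_
  have e : (fun i => (Function.update (fun i : Fin n => (Term.var (i : ℕ) : L.Term ℕ)) j
      (.var n) i).subst σ) = Function.update ts j t := by
    funext i
    by_cases h : i = j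
    · subst h; simp [Term.subst, hσn]
    · simp [h, Term.subst, hσ]
  simp only [LForm.subst, e, Term.subst, hσ, hσn]
  have h1 := Seq.tensorR (.ident (programL P ∪ CT.toL U) (.user c ts))
    (.ident _ (.bang (.eq (ts j) t)))
  have h2 : Seq (programL P ∪ CT.toL U)
      (.tensor (.user c (Function.update ts j t)) (.bang (.eq (ts j) t)) ::ₘ 0)
      (.user c (Function.update ts j t)) := by
    refine .tensorL ?_
    rw [Multiset.cons_swap]
    exact .weakening (LForm.isExponential_bang _) (.ident _ _)
  exact (Seq.lolliL h1 h2).congr (by rw [add_zero]; rfl)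

/-- User-defined constraints respect equality. -/
theorem Seq.user_congr (P : Set (Rule L U)) (hEq : CT.HasEquality) {β : IForm L}
    {σ τ : ℕ → L.Term ℕ} (C : UserC L U)
    (h : ∀ x ∈ UserC.vars C, CT.Derives β (.eq (σ x) (τ x))) :
    Seq (programL P ∪ CT.toL U) {(UserC.toL C).subst σ, β.star U} ((UserC.toL C).subst τ) := by
  have hβ := β.isExponential_star (U := U)
  induction C with
  | top =>
    change Seq _ (_ ::ₘ {_}) _
    rw [← Multiset.cons_zero, Multiset.cons_swap]
    exact .weakening hβ (.ident _ _)
  | atom a =>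
    obtain ⟨c, ts⟩ := a
    rename_i n
    have hts : ∀ j, CT.Derives β (.eq ((ts j).subst σ) ((ts j).subst τ)) := fun j =>
      Theory.derives_term_congr hEq _ fun x hx => h x (by
        simpa [UserC.vars, Conj.varsWith, UAtom.vars] using ⟨j, hx⟩)
    -- The equality formulas change one argument at a time; `J` is the set of positions already
    -- changed. Each change spends a copy of `β`, recovered by contraction.
    have key : ∀ J : Finset (Fin n), Seq (programL P ∪ CT.toL U)
        {.user c fun i => (ts i).subst σ, β.star U}
        (.user c fun i => if i ∈ J then (ts i).subst τ else (ts i).subst σ) := by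
      intro J
      induction J using Finset.induction with
      | empty =>
        simp only [Finset.notMem_empty, if_false]
        change Seq _ (_ ::ₘ {_}) _
        rw [← Multiset.cons_zero, Multiset.cons_swap]
        exact .weakening hβ (.ident _ _)
      | insert j J hj ih =>
        let ss : Fin n → L.Term ℕ := fun i => if i ∈ J then (ts i).subst τ else (ts i).subst σ
        have e : (fun i => if i ∈ insert j J then (ts i).subst τ else (ts i).subst σ) =
            Function.update ss j ((ts j).subst τ) := by
          funext i
          by_cases h : i = j
          · subst h; simp
          · simp [h, ss]
        rw [e]
        have hssj : ss j = (ts j).subst σ := by simp [ss, hj]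
        have h1 := Seq.replace_arg CT P c ss j ((ts j).subst τ)
        rw [hssj] at h1
        have h2 := Seq.cut ih h1
        have h3 := Seq.cut ((hts j).seq P) (Γ' := {.user c fun i => (ts i).subst σ, β.star U})
          (h2.congr (by
            simp only [Multiset.insert_eq_cons, ← Multiset.singleton_add, IForm.star]; abel))
        change Seq _ (_ ::ₘ {_}) _
        rw [← Multiset.cons_zero, Multiset.cons_swap]
        refine .contraction hβ (h3.congr ?_)
        simp only [Multiset.insert_eq_cons, ← Multiset.singleton_add, add_zero]
        abel
    have := key Finset.univ
    simp only [Finset.mem_univ, if_true] at this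
    exact this
  | and C D ih ih' =>
    have h1 := ih fun x hx => h x (Finset.mem_union_left _ hx)
    have h2 := ih' fun x hx => h x (Finset.mem_union_right _ hx)
    refine .tensorL ?_
    refine Seq.congr (.contraction hβ ((Seq.tensorR h1 h2).congr
      (Γ' := β.star U ::ₘ β.star U ::ₘ {(UserC.toL C).subst σ, (UserC.toL D).subst σ}) ?_)) ?_
    · simp only [Multiset.insert_eq_cons, ← Multiset.singleton_add]; abel
    · simp only [Multiset.insert_eq_cons, ← Multiset.singleton_add]
      change _ = {(UserC.toL C).subst σ} + ({(UserC.toL D).subst σ} + _)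
      abel

/-- The strictly local variables of `B'` occur neither in `V` nor in `C`, so giving them the
witnesses obtained from `B` disturbs neither the globals nor the instance of `C`. -/
theorem Implies.of_derives {C : UserC L U} {B B' : BuiltinC L} {V : Finset ℕ}
    (h : CT.Derives (.exs (strictLocals C B V) (BuiltinC.toI B))
      (.exs (strictLocals C B' V) (BuiltinC.toI B'))) (P : Set (Rule L U)) :
    Implies (programL P ∪ CT.toL U) (.mk3 C B V) (.mk3 C B' V) := by
  have hΘ := isClosedTheory CT P
  refine Seq.state_elim hΘ fun σ hσ => ?_
  refine .tensorL (Γ := 0) ?_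
  have h1 : Seq (programL P ∪ CT.toL U) {(BuiltinC.toL U B).subst σ}
      ((LForm.exs (strictLocals C B' V) (BuiltinC.toL U B')).subst σ) := by
    have := (h.seq P).subst hΘ σ
    rw [IForm.star_exs, IForm.star_exs, star_toI, star_toI] at this
    exact (Seq.exs_intro (AgreeOff.refl _ _)).trans this
  have h2 : Seq (programL P ∪ CT.toL U)
      ((LForm.exs (strictLocals C B' V) (BuiltinC.toL U B')).subst σ ::ₘ
        {(UserC.toL C).subst σ}) (State.mk3 C B' V).toL := by
    refine .exs_elim hΘ fun σ' hσ' => ?_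
    have hagree : ∀ x, x ∈ V ∨ x ∈ UserC.vars C → σ' x = σ x := fun x hx =>
      hσ' x (by rw [mem_strictLocals]; tauto)
    have hC : (UserC.toL C).subst σ = (UserC.toL C).subst σ' :=
      LForm.subst_congr fun x hx => (hagree x (.inr (by rwa [UserC.fv_toL] at hx))).symm
    rw [hC]
    have h3 := Seq.state_intro (Θ := programL P ∪ CT.toL U) (S := State.mk3 C B' V) (σ := σ')
      fun x hx => (hagree x (.inl hx)).trans (hσ x hx)
    refine Seq.trans ?_ h3
    refine (Seq.tensorR (.ident _ ((UserC.toL C).subst σ'))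
      (.ident _ ((BuiltinC.toL U B').subst σ'))).congr ?_
    rw [add_comm]; rfl
  exact (Seq.cut h1 h2).congr (by rw [add_comm]; rfl)

theorem StateEquiv.implies (hEq : CT.HasEquality) (P : Set (Rule L U)) {S T : State L U}
    (h : StateEquiv CT S T) :
    Implies (programL P ∪ CT.toL U) S T ∧ Implies (programL P ∪ CT.toL U) T S := by
  have hΘ := isClosedTheory CT P
  induction h with
  | refl S => exact ⟨.ident _ _, .ident _ _⟩
  | symm _ ih => exact ih.symm
  | trans _ _ ih ih' => exact ⟨ih.1.trans ih'.1, ih'.2.trans ih.2⟩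
  | goal V h =>
    exact ⟨.of_instances hΘ fun σ hσ => ⟨σ, hσ, h.seq.1.subst hΘ σ⟩,
      .of_instances hΘ fun σ hσ => ⟨σ, hσ, h.seq.2.subst hΘ σ⟩⟩
  | subst C x t B V =>
    -- The equation is needed twice, to rewrite `C` and to remain in the store; being exponential,
    -- it can be duplicated. With `σ` and `τ` arbitrary, both directions of the substitution rule
    -- are covered.
    have key : ∀ (σ τ σ' : ℕ → L.Term ℕ), (∀ y ∈ UserC.vars C,
        CT.Derives (.eq (σ' x) (t.subst σ')) (.eq (σ y) (τ y))) →
        Seq (programL P ∪ CT.toL U)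
          {.tensor ((UserC.toL C).subst σ) (.tensor (.bang (.eq (σ' x) (t.subst σ')))
            ((BuiltinC.toL U B).subst σ'))}
          (.tensor ((UserC.toL C).subst τ) (.tensor (.bang (.eq (σ' x) (t.subst σ')))
            ((BuiltinC.toL U B).subst σ'))) := by
      intro σ τ σ' h
      refine .tensorL (Γ := 0) ?_
      rw [Multiset.cons_swap]
      refine .tensorL ?_
      refine .contraction (LForm.isExponential_bang _) ?_
      have h1 := Seq.user_congr P hEq C h
      refine (Seq.tensorR h1 (.tensorR (.ident _ (.bang (.eq (σ' x) (t.subst σ'))))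
        (.ident _ ((BuiltinC.toL U B).subst σ')))).congr ?_
      simp only [Multiset.insert_eq_cons, ← Multiset.singleton_add, add_zero, IForm.star]
      abel
    have hy : ∀ (σ : ℕ → L.Term ℕ) y, CT.Derives (.eq (σ x) (t.subst σ))
        (.eq (σ y) (scomp (single x t) σ y)) := by
      intro σ y
      by_cases h : y = x
      · subst h
        simp only [scomp, single_self]
        exact .refl _ _
      · simp only [scomp, single_of_ne h, Term.subst]
        exact (hEq.refl _).derives _
    have e : ∀ σ : ℕ → L.Term ℕ, (UserC.toL (UserC.subst (single x t) C)).subst σ =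
        (UserC.toL C).subst (scomp (single x t) σ) := fun σ => by
      rw [UserC.toL_subst, LForm.subst_subst]
    refine ⟨.of_instances hΘ fun σ hσ => ⟨σ, hσ, ?_⟩, .of_instances hΘ fun σ hσ => ⟨σ, hσ, ?_⟩⟩
    · change Seq _ {.tensor ((UserC.toL C).subst σ) _}
        (.tensor ((UserC.toL (UserC.subst (single x t) C)).subst σ) _)
      rw [e]
      exact key _ _ σ fun y _ => hy σ y
    · change Seq _ {.tensor ((UserC.toL (UserC.subst (single x t) C)).subst σ) _}
        (.tensor ((UserC.toL C).subst σ) _)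
      rw [e]
      exact key _ _ σ fun y _ => Theory.derives_eq_symm hEq (hy σ y)
  | applyCT C B B' V h =>
    exact ⟨.of_derives (Theory.models_imp.1 (.andE₁ h)) P,
      .of_derives (Theory.models_imp.1 (.andE₂ h)) P⟩
  | redundant G x V hx =>
    refine ⟨.of_instances hΘ fun σ hσ => ⟨σ, hσ.mono (Finset.subset_insert _ _), .ident _ _⟩,
      -- The target also requires `x` to be fixed; resetting its value is harmless because `x` does
      -- not occur in the goal.
      .of_instances hΘ fun σ hσ => ⟨Function.update σ x (.var x), fun y hy => ?_, ?_⟩⟩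
    · by_cases h : y = x
      · subst h; simp
      · rw [Function.update_of_ne h]
        exact hσ y (Finset.mem_of_mem_insert_of_ne hy h)
    · have : (Goal.toL G).subst σ = (Goal.toL G).subst (Function.update σ x (.var x)) := by
        refine LForm.subst_congr fun y hy => ?_
        rw [Goal.fv_toL] at hy
        rw [Function.update_of_ne fun h : y = x => hx (h ▸ hy)]
      rw [this]
      exact .ident _ _
  | failed G G' V V' =>
    have key : ∀ (G : Goal L U) (V : Finset ℕ) (χ : LForm L U),
        Seq (programL P ∪ CT.toL U)
          {State.toL ⟨.and G (.atom (.inr .falsum)), V⟩} χ := by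
      intro G V χ
      refine Seq.state_elim hΘ fun σ _ => .tensorL (Γ := 0) ?_
      rw [Multiset.cons_swap]
      exact .zeroL _ _ _
    exact ⟨key _ _ _, key _ _ _⟩

theorem Implies.of_cls_eq (hEq : CT.HasEquality) (P : Set (Rule L U)) {S T : State L U}
    (h : S.cls CT = T.cls CT) : Implies (programL P ∪ CT.toL U) S T :=
  (StateEquiv.implies hEq P (Quotient.exact h)).1

theorem Entails.implies (hEq : CT.HasEquality) (P : Set (Rule L U)) {a b : StateClass U CT}
    (h : Entails CT a b) : ∀ S T : State L U, S.cls CT = a → T.cls CT = b →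
      Implies (programL P ∪ CT.toL U) S T := by
  have hΘ := isClosedTheory CT P
  induction h with
  | refl a => exact fun S T hS hT => .of_cls_eq hEq P (hS.trans hT.symm)
  | @trans a b c _ _ ih ih' =>
    intro S T hS hT
    obtain ⟨W, hW⟩ := Quotient.exists_rep b
    exact (ih S W hS hW).trans (ih' W T hW hT)
  | weaken C B B' V h =>
    intro S T hS hT
    exact (Implies.of_cls_eq hEq P hS).trans
      ((Implies.of_derives (Theory.models_imp.1 h.of_univ) P).trans
        (.of_cls_eq hEq P hT.symm))
  | omitVar C B x V =>
    intro S T hS hT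
    refine (Implies.of_cls_eq hEq P hS).trans (Implies.trans ?_ (.of_cls_eq hEq P hT.symm))
    exact .of_instances hΘ fun σ hσ => ⟨σ, hσ.mono (Finset.subset_insert _ _), .ident _ _⟩

/-- Injectivity is essential: otherwise a local variable could be identified with a head variable
and cease to be local. -/
theorem Rule.mem_localVars_rename {R : Rule L U} {ρ : ℕ → ℕ}
    (hρ : Set.InjOn ρ (R.vars : Set ℕ)) {x : ℕ} (hx : x ∈ R.localVars) :
    ρ x ∈ (R.rename ρ).localVars := by
  have hxv : x ∈ R.vars := by simp [Rule.vars_eq, hx]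
  simp only [Rule.localVars, Finset.mem_sdiff, Rule.mem_headVars_rename] at hx ⊢
  simp only [Rule.rename, Finset.mem_union, mem_vars_user_rename, mem_vars_builtin_rename] at hx ⊢
  refine ⟨?_, ?_⟩
  · obtain ⟨(h | h) | h, -⟩ := hx
    · exact .inl (.inl ⟨x, h, rfl⟩)
    · exact .inl (.inr ⟨x, h, rfl⟩)
    · exact .inr ⟨x, h, rfl⟩
  · rintro ⟨y, hy, hxy⟩
    have hyv : y ∈ R.vars := by simp [Rule.vars_eq, hy]
    exact hx.2 (hρ hxv hyv hxy ▸ hy)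

/-- The formula of `R₀` is instantiated along the renaming followed by `σ`. Its conclusion supplies
values `τ` for the local variables, and by freshness these can be assigned to the local variables of
the variant without changing the heads, `C`, `B` or `V`. -/
theorem Step.implies_apply {R₀ R : Rule L U} {C : UserC L U} {B : BuiltinC L} {V : Finset ℕ}
    (hR₀ : R₀ ∈ P) (hR : R.IsVariant R₀)
    (hdisj : Disjoint R.localVars (R.headVars ∪ UserC.vars C ∪ BuiltinC.vars B ∪ V)) :
    Implies (programL P ∪ CT.toL U)
      (.mk3 (.and (.and R.kept R.removed) C) (.and R.guard B) V)
      (.mk3 (.and (.and R.kept R.bodyU) C) (.and (.and R.guard R.bodyB) B) V) := by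
  have hΘ := isClosedTheory CT P
  obtain ⟨ρ, hρ, rfl⟩ := hR
  let υ : ℕ → L.Term ℕ := fun x => .var (ρ x)
  have heU : ∀ (D : UserC L U) τ, (UserC.toL (UserC.subst υ D)).subst τ =
      (UserC.toL D).subst (scomp υ τ) := fun D τ => by rw [UserC.toL_subst, LForm.subst_subst]
  have heB : ∀ (D : BuiltinC L) τ, (BuiltinC.toL U (BuiltinC.subst υ D)).subst τ =
      (BuiltinC.toL U D).subst (scomp υ τ) := fun D τ => by
    rw [BuiltinC.toL_subst, LForm.subst_subst]
  refine Seq.state_elim hΘ fun σ hσ => ?_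
  change Seq _ {.tensor (.tensor (.tensor ((UserC.toL (UserC.subst υ R₀.kept)).subst σ)
    ((UserC.toL (UserC.subst υ R₀.removed)).subst σ)) ((UserC.toL C).subst σ))
    (.tensor ((BuiltinC.toL U (BuiltinC.subst υ R₀.guard)).subst σ)
      ((BuiltinC.toL U B).subst σ))} _
  rw [heU, heU, heB]
  refine .use_theory (.inl ⟨R₀, hR₀, rfl⟩) (scomp υ σ) ?_
  -- the conclusion of the rule yields the new state
  have hnew : Seq (programL P ∪ CT.toL U)
      ((LForm.exs R₀.localVars (.tensor (.tensor (UserC.toL R₀.bodyU)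
        (BuiltinC.toL U R₀.bodyB)) (BuiltinC.toL U R₀.guard))).subst (scomp υ σ) ::ₘ
        {(UserC.toL R₀.kept).subst (scomp υ σ), (UserC.toL C).subst σ,
          (BuiltinC.toL U B).subst σ})
      (State.mk3 (.and (.and (R₀.rename ρ).kept (R₀.rename ρ).bodyU) C)
        (.and (.and (R₀.rename ρ).guard (R₀.rename ρ).bodyB) B) V).toL := by
    refine .exs_elim hΘ fun τ hτ => ?_
    classical
    -- `τ` is transported along the renaming; injectivity of `ρ` on the variables of the rule makes
    -- the chosen preimage unique.
    let σ' : ℕ → L.Term ℕ := fun z =>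
      if h : ∃ y ∈ R₀.localVars, ρ y = z then τ h.choose else σ z
    have hσ'_out : ∀ z, z ∉ (R₀.rename ρ).localVars → σ' z = σ z := by
      intro z hz
      refine dif_neg ?_
      rintro ⟨y, hy, rfl⟩
      exact hz (Rule.mem_localVars_rename hρ hy)
    have hσ'_rule : ∀ x ∈ R₀.vars, σ' (ρ x) = τ x := by
      intro x hx
      have hlocal : ∀ y ∈ R₀.localVars, ρ y = ρ x → y = x := fun y hy h =>
        hρ (by simp [Rule.vars_eq, hy]) hx h
      by_cases h : ∃ y ∈ R₀.localVars, ρ y = ρ x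
      · simp only [σ', dif_pos h]
        rw [hlocal _ h.choose_spec.1 h.choose_spec.2]
      · simp only [σ', dif_neg h]
        exact (hτ x fun hxl => h ⟨x, hxl, rfl⟩).symm
    have hout : ∀ {z}, z ∈ (R₀.rename ρ).headVars ∪ UserC.vars C ∪ BuiltinC.vars B ∪ V →
        σ' z = σ z := fun hz => hσ'_out _ fun h => Finset.disjoint_left.1 hdisj h hz
    have hV : FixesOn V σ' := fun z hz => by
      rw [hout (by simp [hz])]
      exact hσ z hz
    have eC : (UserC.toL C).subst σ = (UserC.toL C).subst σ' := LForm.subst_congr fun z hz => by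
      rw [UserC.fv_toL] at hz
      rw [hout (by simp [hz])]
    have eB : (BuiltinC.toL U B).subst σ = (BuiltinC.toL U B).subst σ' :=
      LForm.subst_congr fun z hz => by
        rw [BuiltinC.fv_toL] at hz
        rw [hout (by simp [hz])]
    have eU : ∀ D : UserC L U, UserC.vars D ⊆ R₀.vars →
        (UserC.toL D).subst τ = (UserC.toL (UserC.subst υ D)).subst σ' := fun D hD => by
      rw [heU]
      refine LForm.subst_congr fun z hz => ?_
      rw [UserC.fv_toL] at hz
      exact (hσ'_rule z (hD hz)).symm
    have eBu : ∀ D : BuiltinC L, BuiltinC.vars D ⊆ R₀.vars →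
        (BuiltinC.toL U D).subst τ = (BuiltinC.toL U (BuiltinC.subst υ D)).subst σ' :=
      fun D hD => by
        rw [heB]
        refine LForm.subst_congr fun z hz => ?_
        rw [BuiltinC.fv_toL] at hz
        exact (hσ'_rule z (hD hz)).symm
    have hkept : UserC.vars R₀.kept ⊆ R₀.headVars := Finset.subset_union_left
    have ek : (UserC.toL R₀.kept).subst (scomp υ σ) = (UserC.toL R₀.kept).subst τ :=
      LForm.subst_congr fun z hz => by
        rw [UserC.fv_toL] at hz
        exact (hτ z fun h => (Finset.mem_sdiff.1 h).2 (hkept hz)).symm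
    rw [ek, eC, eB, eU _ (hkept.trans (by rw [Rule.vars_eq]; exact Finset.subset_union_left))]
    simp only [LForm.subst]
    rw [eU R₀.bodyU (by unfold Rule.vars; intro x hx; simp [hx]),
      eBu R₀.bodyB (by unfold Rule.vars; intro x hx; simp [hx]),
      eBu R₀.guard (by unfold Rule.vars; intro x hx; simp [hx])]
    have h3 := Seq.state_intro (Θ := programL P ∪ CT.toL U)
      (S := State.mk3 (.and (.and (R₀.rename ρ).kept (R₀.rename ρ).bodyU) C)
        (.and (.and (R₀.rename ρ).guard (R₀.rename ρ).bodyB) B) V) (σ := σ') hV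
    refine .tensorL (.tensorL (Seq.trans ?_ h3))
    refine (Seq.tensorR (.tensorR (.tensorR (.ident _ ((UserC.toL
      (UserC.subst υ R₀.kept)).subst σ')) (.ident _ ((UserC.toL
      (UserC.subst υ R₀.bodyU)).subst σ'))) (.ident _ ((UserC.toL C).subst σ')))
      (.tensorR (.tensorR (.ident _ ((BuiltinC.toL U (BuiltinC.subst υ R₀.guard)).subst σ'))
        (.ident _ ((BuiltinC.toL U (BuiltinC.subst υ R₀.bodyB)).subst σ')))
        (.ident _ ((BuiltinC.toL U B).subst σ')))).congr ?_
    simp only [Multiset.insert_eq_cons, ← Multiset.singleton_add]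
    abel
  exact Seq.lolli_apply (.tensorL (hnew.congr (Multiset.cons_swap _ _ _)))

theorem Step.implies (hEq : CT.HasEquality) {a b : StateClass U CT} (h : Step CT P a b) :
    ∀ S T : State L U, S.cls CT = a → T.cls CT = b → Implies (programL P ∪ CT.toL U) S T := by
  have hΘ := isClosedTheory CT P
  intro S T hS hT
  obtain ⟨R₀, R, C, B, V, hR₀, hR, hdisj, -⟩ := h
  exact (Implies.of_cls_eq hEq P hS).trans
    ((Step.implies_apply hR₀ hR hdisj).trans (.of_cls_eq hEq P hT.symm))

/-- Soundness of the linear logic semantics. -/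
theorem Leads.provable (hEq : CT.HasEquality) {S T : State L U} (h : Leads CT P S T) :
    LProvable (programL P ∪ CT.toL U) (LForm.univ (.lolli S.toL T.toL)) := by
  have hΘ := isClosedTheory CT P
  obtain ⟨W, hsteps, hent⟩ := h
  have key : ∀ {a b : StateClass U CT}, Relation.ReflTransGen (Step CT P) a b →
      ∀ S T : State L U, S.cls CT = a → T.cls CT = b →
        Implies (programL P ∪ CT.toL U) S T := by
    intro a b h
    induction h with
    | refl => exact fun S T hS hT => .of_cls_eq hEq P (hS.trans hT.symm)
    | @tail b c _ hstep ih =>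
      intro S T hS hT
      obtain ⟨W, hW⟩ := Quotient.exists_rep b
      exact (ih S W hS hW).trans (hstep.implies hEq W T hW hT)
  exact Seq.provable_univ hΘ ((key hsteps S W rfl rfl).trans (hent.implies hEq P W T rfl rfl))

end Soundness

end CHR

theorem mainTheorem4 {L : FirstOrder.Language} {U : ℕ → Type*} (CT : CHR.Theory L)
    (hEq : CT.HasEquality) (hCompl : CT.IsComplete) (P : Set (CHR.Rule L U))
    (S T : CHR.State L U) :
    (∃ W : CHR.State L U,
        Relation.ReflTransGen (CHR.Step CT P) (S.cls CT) (W.cls CT) ∧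
          CHR.Entails CT (W.cls CT) (T.cls CT)) ↔
      CHR.LProvable (CHR.programL P ∪ CT.toL U)
        (CHR.LForm.univ (.lolli S.toL T.toL)) :=
  ⟨CHR.Leads.provable hEq, CHR.Leads.of_provable hEq hCompl⟩
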